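/- Let $g=\mathrm{diag}(1,-1,-1,-1)$, and let $\gamma^0,\dots,\gamma^3$ be Dirac matrices on $\mathbb C^4$: $\gamma^a\gamma^b+\gamma^b\gamma^a=2g^{ab}$ and $(\gamma^a)^\dagger=\gamma^0\gamma^a\gamma^0$. On the unit hyperboloid $z\cdot z=1$, $z^0>0$, identified with $\mathbb R^3$ through $z^0=\sqrt{1+|\vec z|^2}$, let $d\mu(z)=d^3z/z^0$, and write $\gamma\cdot z=\gamma^az_a$ and $\bar x=x^\dagger\gamma^0$ for $x\in\mathbb C^4$. Let $\mathcal H$ be the Hilbert space of classes of $\mathbb C^4$-valued measurable functions on the hyperboloid with scalar product $(g,f)=\int\overline{g(z)}\,\gamma\cdot z\,f(z)\,d\mu(z)$. Let $C_0^k$ be the compactly supported functions on the hyperboloid that are $C^k$ in $\vec z$. Put $\Gamma f(z)=\gamma\cdot z\,f(z)$, $G_\kappa=e^{i\kappa\Gamma}$. Let $\delta_a=h_a^b\nabla_b$, with $h_a^b=g_a^b-z_az^b$, be the derivative tangent to the hyperboloid, and let $$\gamma_T^a=\gamma^a-z^a\,\gamma\cdot z,\qquad p_a=i\Big(\delta_a+\tfrac12\,\gamma\cdot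 z\,\gamma_{T\,a}-\tfrac32 z_a\Big),\qquad h=-i\,\gamma_T^a\,p_a .$$ For $\kappa>0$ and $f\in C_0^\infty$ let $$F_\kappa f(u)=\Big(\frac{\kappa}{2\pi}\Big)^{3/2}\int e^{-i\kappa\,u\cdot z\,\gamma\cdot z}\,\gamma\cdot z\,f(z)\,d\mu(z),\qquad F_\kappa^*f(u)=\Big(\frac{\kappa}{2\pi}\Big)^{3/2}\int e^{+i\kappa\,u\cdot z\,\gamma\cdot u}\,\gamma\cdot z\,f(z)\,d\mu(z).$$ Then for every $\kappa>0$ the map $F_\kappa$ extends from $C_0^\infty$ to a bounded operator on $\mathcal H$, again denoted $F_\kappa$, whose adjoint is given on $C_0^\infty$ by the second integral; and the operator $T_\kappa=i\,G_{\kappa+\pi/4}F_\kappa$ satisfies, for every $f\in C_0^2$, $$\|T_\kappa f-f\|=\|T_\kappa^*f-f\|\le\frac1\kappa\big(\|hf\|+\|h^2f\|\big),$$ with all norms taken in $\mathcal H$. -/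

import Mathlib

open MeasureTheory
open scoped Matrix ComplexConjugate

noncomputable section

namespace HypDirac

/-- Spatial vectors; a point of the unit hyperboloid `z² = 1`, `z⁰ > 0` is given by its spatial
part `z ∈ ℝ³`, its time component being `√(1 + |z|²)`. -/
abbrev Space := EuclideanSpace ℝ (Fin 3)

/-- Values of the wave functions: `ℂ⁴`. -/
abbrev Spinor := EuclideanSpace ℂ (Fin 4)

/-- The diagonal entries of the Minkowski metric `g = diag(1,-1,-1,-1)`. -/
def sgn : Fin 4 → ℝ := ![1, -1, -1, -1]

/-- The metric tensor (the same array with upper and with lower indices). -/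
def metric (a b : Fin 4) : ℝ := if a = b then sgn a else 0

/-- Dirac matrices `γ⁰, …, γ³` on `ℂ⁴`: the Clifford relations, and the hermiticity relation
`(γᵃ)† = γ⁰ γᵃ γ⁰` on which the Dirac conjugation rests. -/
structure DiracMatrices where
  mat : Fin 4 → Matrix (Fin 4) (Fin 4) ℂ
  anticomm : ∀ a b, mat a * mat b + mat b * mat a
    = ((2 * metric a b : ℝ) : ℂ) • (1 : Matrix (Fin 4) (Fin 4) ℂ)
  conjTranspose : ∀ a, (mat a)ᴴ = mat 0 * mat a * mat 0

set_option maxHeartbeats 2000000 in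
/-- The standard (Dirac) representation is an example. -/
instance : Nonempty DiracMatrices := by
  refine ⟨⟨![!![1, 0, 0, 0; 0, 1, 0, 0; 0, 0, -1, 0; 0, 0, 0, -1],
    !![0, 0, 0, 1; 0, 0, 1, 0; 0, -1, 0, 0; -1, 0, 0, 0],
    !![0, 0, 0, -Complex.I; 0, 0, Complex.I, 0; 0, Complex.I, 0, 0; -Complex.I, 0, 0, 0],
    !![0, 0, 1, 0; 0, 0, 0, -1; -1, 0, 0, 0; 0, 1, 0, 0]], ?_, ?_⟩⟩
  · intro a b
    fin_cases a <;> fin_cases b <;> simp [metric, sgn] <;>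
      (ext i j; fin_cases i <;> fin_cases j <;> simp <;> norm_num)
  · intro a
    fin_cases a <;> simp <;> (ext i j; fin_cases i <;> fin_cases j <;> simp)

/-- A matrix acting on a spinor. -/
abbrev act (A : Matrix (Fin 4) (Fin 4) ℂ) : Spinor →L[ℂ] Spinor :=
  Matrix.toEuclideanCLM (𝕜 := ℂ) A

/-- The time component `z⁰ = √(1 + |z|²)`. -/
def time (z : Space) : ℝ := Real.sqrt (1 + ‖z‖ ^ 2)

/-- The four-vector `zᵃ` on the unit hyperboloid. -/
def pt (z : Space) : Fin 4 → ℝ := ![time z, z 0, z 1, z 2]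

/-- The Minkowski product `u·v = u⁰v⁰ - u¹v¹ - u²v² - u³v³`. -/
def mdot (u v : Fin 4 → ℝ) : ℝ := ∑ a, sgn a * u a * v a

/-- The invariant measure `2 δ(z² - 1) θ(z⁰) d⁴z = d³z / z⁰` on the unit hyperboloid. -/
def hypMeasure : Measure Space :=
  volume.withDensity fun z => ENNReal.ofReal (1 / time z)

variable (D : DiracMatrices)

/-- `γ·v = γᵃ v_a`. -/
def slash (v : Fin 4 → ℝ) : Matrix (Fin 4) (Fin 4) ℂ :=
  ∑ a, ((sgn a * v a : ℝ) : ℂ) • D.mat a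

/-- `γ·z` at a point of the hyperboloid. -/
def gz (z : Space) : Matrix (Fin 4) (Fin 4) ℂ := slash D (pt z)

/-- The Dirac conjugate pairing `x̄ y = x† γ⁰ y` of two spinors. -/
def dbar (x y : Spinor) : ℂ := inner ℂ x (act (D.mat 0) y)

/-! ### Algebra -/

lemma one_le_time (z : Space) : 1 ≤ time z := by
  unfold time
  rw [Real.one_le_sqrt]
  nlinarith [sq_nonneg ‖z‖]

lemma time_pos (z : Space) : 0 < time z := lt_of_lt_of_le one_pos (one_le_time z)

lemma mdot_pt (z : Space) : mdot (pt z) (pt z) = 1 := by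
  have h : time z * time z = 1 + (z 0 ^ 2 + z 1 ^ 2 + z 2 ^ 2) := by
    unfold time
    rw [Real.mul_self_sqrt (by positivity), EuclideanSpace.norm_sq_eq]
    simp [Fin.sum_univ_three]
  simp [mdot, pt, sgn, Fin.sum_univ_four]
  linarith

lemma mat_zero_sq : D.mat 0 * D.mat 0 = 1 := by
  have h := D.anticomm 0 0
  rw [← two_smul ℂ (D.mat 0 * D.mat 0)] at h
  have : ((2 * metric 0 0 : ℝ) : ℂ) = 2 := by simp [metric, sgn]
  rw [this] at h
  exact smul_right_injective _ (two_ne_zero : (2 : ℂ) ≠ 0) h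

lemma slash_anticomm (v w : Fin 4 → ℝ) : slash D v * slash D w + slash D w * slash D v
    = ((2 * mdot v w : ℝ) : ℂ) • (1 : Matrix (Fin 4) (Fin 4) ℂ) := by
  have : slash D v * slash D w + slash D w * slash D v
      = ∑ a, ∑ b, (((sgn a * v a : ℝ) : ℂ) * ((sgn b * w b : ℝ) : ℂ)) •
          (D.mat a * D.mat b + D.mat b * D.mat a) := by
    unfold slash
    simp only [Finset.sum_mul_sum, smul_add, Finset.sum_add_distrib]
    congr 1
    · simp only [smul_mul_smul_comm]
    · rw [Finset.sum_comm]
      refine Finset.sum_congr rfl fun a _ => Finset.sum_congr rfl fun b _ => ?_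
      rw [smul_mul_smul_comm, mul_comm]
  rw [this]
  simp only [D.anticomm, smul_smul, ← Finset.sum_smul]
  congr 1
  norm_cast
  simp [metric, mdot, Fin.sum_univ_four, sgn]
  ring

lemma gz_sq (z : Space) : gz D z * gz D z = 1 := by
  have h := slash_anticomm D (pt z) (pt z)
  rw [mdot_pt, ← two_smul ℂ (slash D (pt z) * slash D (pt z))] at h
  have h2 : ((2 * 1 : ℝ) : ℂ) = 2 := by simp
  rw [h2] at h
  exact smul_right_injective _ (two_ne_zero : (2 : ℂ) ≠ 0) h

lemma zero_anticomm_gz (z : Space) : D.mat 0 * gz D z + gz D z * D.mat 0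
    = ((2 * time z : ℝ) : ℂ) • (1 : Matrix (Fin 4) (Fin 4) ℂ) := by
  have h := slash_anticomm D (Pi.single 0 1) (pt z)
  have h0 : slash D (Pi.single 0 1) = D.mat 0 := by
    simp [slash, Fin.sum_univ_four, sgn]
  have h1 : mdot (Pi.single 0 1) (pt z) = time z := by
    simp [mdot, Fin.sum_univ_four, sgn, pt]
  rwa [h0, h1] at h

lemma gz_conjTranspose (z : Space) : (gz D z)ᴴ = D.mat 0 * gz D z * D.mat 0 := by
  simp only [gz, slash, Matrix.conjTranspose_sum, Matrix.conjTranspose_smul, D.conjTranspose,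
    Finset.mul_sum, Finset.sum_mul, mul_smul_comm, smul_mul_assoc]
  simp

lemma mat_zero_conjTranspose : (D.mat 0)ᴴ = D.mat 0 := by
  rw [D.conjTranspose, mat_zero_sq, one_mul]

/-- The matrix `γ⁰ γ·z` of the scalar product. -/
def weight (z : Space) : Matrix (Fin 4) (Fin 4) ℂ := D.mat 0 * gz D z

lemma weight_conjTranspose (z : Space) : (weight D z)ᴴ = weight D z := by
  simp only [weight, Matrix.conjTranspose_mul, gz_conjTranspose, mat_zero_conjTranspose]
  rw [mul_assoc, mat_zero_sq, mul_one]

lemma weight_sq (z : Space) :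
    weight D z * weight D z = ((2 * time z : ℝ) : ℂ) • weight D z - 1 := by
  have h := zero_anticomm_gz D z
  have h' : gz D z * D.mat 0
      = ((2 * time z : ℝ) : ℂ) • (1 : Matrix (Fin 4) (Fin 4) ℂ) - D.mat 0 * gz D z := by
    rw [← h]; abel
  calc weight D z * weight D z = D.mat 0 * (gz D z * D.mat 0) * gz D z := by
        simp only [weight, mul_assoc]
    _ = ((2 * time z : ℝ) : ℂ) • weight D z - (D.mat 0 * D.mat 0) * (gz D z * gz D z) := by
        rw [h']; simp only [weight, mul_sub, sub_mul, mul_smul_comm, smul_mul_assoc, mul_one,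
          mul_assoc]
    _ = _ := by rw [mat_zero_sq, gz_sq, one_mul]

/-- Normalisation `(2 (z⁰ + 1))^{-1/2}`. -/
def nrm (z : Space) : ℝ := (Real.sqrt (2 * (time z + 1)))⁻¹

lemma nrm_sq (z : Space) : nrm z * nrm z * (2 * (time z + 1)) = 1 := by
  have h : 0 < 2 * (time z + 1) := by have := time_pos z; positivity
  unfold nrm
  rw [← mul_inv, Real.mul_self_sqrt h.le, inv_mul_cancel₀ h.ne']

/-- The positive square root of `γ⁰ γ·z`. -/
def root (z : Space) : Matrix (Fin 4) (Fin 4) ℂ := (nrm z : ℂ) • (weight D z + 1)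

/-- The inverse of `root`. -/
def rootInv (z : Space) : Matrix (Fin 4) (Fin 4) ℂ :=
  (nrm z : ℂ) • (((2 * time z + 1 : ℝ) : ℂ) • 1 - weight D z)

lemma root_conjTranspose (z : Space) : (root D z)ᴴ = root D z := by
  simp [root, weight_conjTranspose]

lemma nrm_sq' (z : Space) : (nrm z : ℂ) * nrm z * (2 * (time z + 1)) = 1 := by
  exact_mod_cast nrm_sq z

lemma root_sq (z : Space) : root D z * root D z = weight D z := by
  have h : (weight D z + 1) * (weight D z + 1)
      = ((2 * (time z + 1) : ℝ) : ℂ) • weight D z := by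
    have : (weight D z + 1) * (weight D z + 1)
        = weight D z * weight D z + (2 : ℂ) • weight D z + 1 := by
      rw [two_smul]; noncomm_ring
    rw [this, weight_sq]
    push_cast
    module
  rw [root, smul_mul_smul_comm, h, smul_smul]
  push_cast
  rw [nrm_sq', one_smul]

lemma root_mul_rootInv (z : Space) : root D z * rootInv D z = 1 := by
  have h : (weight D z + 1) * (((2 * time z + 1 : ℝ) : ℂ) • 1 - weight D z)
      = ((2 * (time z + 1) : ℝ) : ℂ) • 1 := by
    have : (weight D z + 1) * (((2 * time z + 1 : ℝ) : ℂ) • 1 - weight D z)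
        = ((2 * time z + 1 : ℝ) : ℂ) • weight D z - weight D z * weight D z
          + ((2 * time z + 1 : ℝ) : ℂ) • 1 - weight D z := by
      rw [add_mul, mul_sub, mul_smul_comm, mul_one, one_mul]; abel
    rw [this, weight_sq]
    push_cast
    module
  rw [root, rootInv, smul_mul_smul_comm, h, smul_smul]
  push_cast
  rw [nrm_sq', one_smul]

lemma rootInv_mul_root (z : Space) : rootInv D z * root D z = 1 :=
  mul_eq_one_comm.mp (root_mul_rootInv D z)

lemma inner_act (A : Matrix (Fin 4) (Fin 4) ℂ) (x y : Spinor) :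
    inner ℂ (act A x) y = inner ℂ x (act Aᴴ y) := by
  have : act Aᴴ = ContinuousLinearMap.adjoint (act A) :=
    map_star (Matrix.toEuclideanCLM (n := Fin 4) (𝕜 := ℂ)) A
  rw [this, ContinuousLinearMap.adjoint_inner_right]

lemma act_mul (A B : Matrix (Fin 4) (Fin 4) ℂ) (x : Spinor) :
    act (A * B) x = act A (act B x) := by
  simp [act]

lemma act_one (x : Spinor) : act 1 x = x := by
  simp [act]

lemma dbar_gz (z : Space) (x y : Spinor) :
    dbar D x (act (gz D z) y) = inner ℂ (act (root D z) x) (act (root D z) y) := by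
  rw [inner_act, root_conjTranspose, ← act_mul, root_sq, weight, act_mul, dbar]

/-! ### Regularity -/

lemma contDiff_time {n : WithTop ℕ∞} : ContDiff ℝ n time := by
  unfold time
  refine ContDiff.sqrt ?_ fun z => by positivity
  exact contDiff_const.add (contDiff_norm_sq ℝ)

lemma contDiff_pt {n : WithTop ℕ∞} (a : Fin 4) : ContDiff ℝ n fun z => pt z a := by
  have h (i : Fin 3) : ContDiff ℝ n fun z : Space => z i :=
    (EuclideanSpace.proj (𝕜 := ℝ) i : Space →L[ℝ] ℝ).contDiff
  fin_cases a
  · exact contDiff_time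
  · exact h 0
  · exact h 1
  · exact h 2

lemma contDiff_ofReal {n : WithTop ℕ∞} {f : Space → ℝ} (h : ContDiff ℝ n f) :
    ContDiff ℝ n fun z => (f z : ℂ) := Complex.ofRealCLM.contDiff.comp h

lemma contDiff_act_gz {n : WithTop ℕ∞} : ContDiff ℝ n fun z => act (gz D z) := by
  simp only [act, gz, slash, map_sum, map_smul]
  exact ContDiff.sum fun a _ =>
    (contDiff_ofReal (contDiff_const.mul (contDiff_pt a))).smul contDiff_const

lemma contDiff_apply {n : WithTop ℕ∞} {A : Space → Spinor →L[ℂ] Spinor} {f : Space → Spinor}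
    (hA : ContDiff ℝ n A) (hf : ContDiff ℝ n f) : ContDiff ℝ n fun z => A z (f z) :=
  ((ContinuousLinearMap.restrictScalarsL ℂ Spinor Spinor ℝ ℝ).contDiff.comp hA).clm_apply hf

lemma continuous_nrm : Continuous nrm := by
  unfold nrm
  have h : Continuous time := (contDiff_time (n := 0)).continuous
  refine Continuous.inv₀ (by fun_prop) fun z => ?_
  have := time_pos z
  positivity

lemma continuous_act_weight : Continuous fun z => act (weight D z) := by
  simp only [act, weight, map_mul]
  exact continuous_const.mul (contDiff_act_gz (n := 0) D).continuous

lemma continuous_act_root : Continuous fun z => act (root D z) := by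
  simp only [act, root, map_smul, map_add, map_one]
  exact (Complex.continuous_ofReal.comp continuous_nrm).smul
    ((continuous_act_weight D).add continuous_const)

lemma continuous_act_rootInv : Continuous fun z => act (rootInv D z) := by
  simp only [act, rootInv, map_smul, map_sub, map_one]
  have h : Continuous time := (contDiff_time (n := 0)).continuous
  exact (Complex.continuous_ofReal.comp continuous_nrm).smul
    (((Complex.continuous_ofReal.comp (by fun_prop)).smul continuous_const).sub
      (continuous_act_weight D))

lemma aesm_act {A : Space → Spinor →L[ℂ] Spinor} (hA : Continuous A) {f : Space → Spinor}
    (hf : AEStronglyMeasurable f hypMeasure) :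
    AEStronglyMeasurable (fun z => A z (f z)) hypMeasure :=
  (ContinuousLinearMap.apply ℂ Spinor).flip.aestronglyMeasurable_comp₂
    hA.aestronglyMeasurable hf

instance : IsLocallyFiniteMeasure hypMeasure := by
  have h : Continuous fun z => 1 / time z :=
    continuous_const.div (contDiff_time (n := 0)).continuous fun z => (time_pos z).ne'
  exact IsLocallyFiniteMeasure.withDensity_ofReal h

/-! ### The Hilbert space -/

lemma integrable_iff {f : Space → Spinor} (hf : AEStronglyMeasurable f hypMeasure) :
    Integrable (fun z => dbar D (f z) (act (gz D z) (f z))) hypMeasure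
      ↔ MemLp (fun z => act (root D z) (f z)) 2 hypMeasure := by
  have hm := aesm_act (continuous_act_root D) hf
  rw [memLp_two_iff_integrable_sq_norm hm]
  simp only [dbar_gz, inner_self_eq_norm_sq_to_K]
  constructor
  · intro h; simpa [← Complex.ofReal_pow] using h.re
  · intro h; simpa using h.ofReal (𝕜 := ℂ)

/-- Equivalence classes of measurable functions with `∫ f̄ γ·z f dμ < ∞`. -/
def stateSubmodule : Submodule ℂ (Space →ₘ[hypMeasure] Spinor) where
  carrier := {f | Integrable (fun z => dbar D (f z) (act (gz D z) (f z))) hypMeasure}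
  zero_mem' := by
    have : (fun z => dbar D ((0 : Space →ₘ[hypMeasure] Spinor) z)
        (act (gz D z) ((0 : Space →ₘ[hypMeasure] Spinor) z))) =ᵐ[hypMeasure] fun _ => 0 := by
      filter_upwards [AEEqFun.coeFn_zero (α := Space) (β := Spinor) (μ := hypMeasure)] with z hz
      simp [hz, dbar]
    exact (integrable_congr this).mpr (integrable_zero _ _ _)
  add_mem' := by
    intro f g hf hg
    simp only [Set.mem_ofPred_eq] at *
    rw [integrable_iff D (AEEqFun.aestronglyMeasurable _)] at *
    refine (memLp_congr_ae ?_).mpr (hf.add hg)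
    filter_upwards [AEEqFun.coeFn_add f g] with z hz
    simp [hz]
  smul_mem' := by
    intro c f hf
    simp only [Set.mem_ofPred_eq] at *
    rw [integrable_iff D (AEEqFun.aestronglyMeasurable _)] at *
    refine (memLp_congr_ae ?_).mpr (hf.const_smul c)
    filter_upwards [AEEqFun.coeFn_smul c f] with z hz
    simp [hz]

/-- The Hilbert space of equivalence classes of spinor functions on the unit hyperboloid, with
the scalar product `(g, f) = ∫ ḡ γ·z f dμ` introduced below. -/
def State : Type := stateSubmodule D

instance : AddCommGroup (State D) := inferInstanceAs (AddCommGroup (stateSubmodule D))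
instance : Module ℂ (State D) := inferInstanceAs (Module ℂ (stateSubmodule D))

variable {D}

/-- A representative of an element of the Hilbert space. -/
def State.fn (f : State D) : Space → Spinor := f.1

lemma State.aesm (f : State D) : AEStronglyMeasurable f.fn hypMeasure :=
  AEEqFun.aestronglyMeasurable _

lemma State.memLp (f : State D) : MemLp (fun z => act (root D z) (f.fn z)) 2 hypMeasure :=
  (integrable_iff D f.aesm).mp f.2

lemma State.add_fn (f g : State D) : (f + g).fn =ᵐ[hypMeasure] fun z => f.fn z + g.fn z :=
  AEEqFun.coeFn_add f.1 g.1

lemma State.smul_fn (c : ℂ) (f : State D) : (c • f).fn =ᵐ[hypMeasure] fun z => c • f.fn z :=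
  AEEqFun.coeFn_smul c f.1

lemma State.ext' {f g : State D} (h : f.fn =ᵐ[hypMeasure] g.fn) : f = g :=
  Subtype.ext (AEEqFun.ext h)

lemma State.zero_fn : (0 : State D).fn =ᵐ[hypMeasure] fun _ => 0 :=
  AEEqFun.coeFn_zero

variable (D) in
/-- The class of a function with `∫ f̄ γ·z f dμ < ∞`. -/
def State.mk (f : Space → Spinor) (hf : AEStronglyMeasurable f hypMeasure)
    (hi : Integrable (fun z => dbar D (f z) (act (gz D z) (f z))) hypMeasure) : State D :=
  ⟨AEEqFun.mk f hf, by
    refine (integrable_congr ?_).mpr hi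
    filter_upwards [AEEqFun.coeFn_mk f hf] with z hz
    rw [hz]⟩

lemma State.mk_fn (f : Space → Spinor) (hf : AEStronglyMeasurable f hypMeasure)
    (hi : Integrable (fun z => dbar D (f z) (act (gz D z) (f z))) hypMeasure) :
    (State.mk D f hf hi).fn =ᵐ[hypMeasure] f :=
  AEEqFun.coeFn_mk f hf

lemma integrable_inner_of_memLp {f g : Space → Spinor} (hf : MemLp f 2 hypMeasure)
    (hg : MemLp g 2 hypMeasure) : Integrable (fun z => (inner ℂ (f z) (g z) : ℂ)) hypMeasure := by
  refine (integrable_congr ?_).mp (L2.integrable_inner (𝕜 := ℂ) (hf.toLp f) (hg.toLp g))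
  filter_upwards [hf.coeFn_toLp, hg.coeFn_toLp] with z h1 h2
  rw [h1, h2]

lemma State.integrable (f g : State D) :
    Integrable (fun z => dbar D (f.fn z) (act (gz D z) (g.fn z))) hypMeasure := by
  simp only [dbar_gz]
  exact integrable_inner_of_memLp f.memLp g.memLp

variable (D) in
/-- The scalar product `(g, f) = ∫ ḡ γ·z f dμ`. -/
@[reducible] def stateCore : InnerProductSpace.Core ℂ (State D) where
  inner g f := ∫ z, dbar D (g.fn z) (act (gz D z) (f.fn z)) ∂hypMeasure
  conj_inner_symm f g := by
    rw [← integral_conj]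
    simp only [dbar_gz, inner_conj_symm]
  re_inner_nonneg f := by
    have := integral_re (𝕜 := ℂ) (integrable_inner_of_memLp f.memLp f.memLp)
    change 0 ≤ RCLike.re (∫ z, _ ∂hypMeasure)
    simp only [dbar_gz]
    rw [← this]
    exact integral_nonneg fun z => inner_self_nonneg
  add_left f g k := by
    rw [← integral_add (f.integrable k) (g.integrable k)]
    refine integral_congr_ae ?_
    filter_upwards [f.add_fn g] with z hz
    simp [hz, dbar]
  smul_left f g c := by
    rw [← integral_const_mul]
    refine integral_congr_ae ?_
    filter_upwards [f.smul_fn c] with z hz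
    simp [hz, dbar, mul_comm]
  definite f h := by
    simp only [dbar_gz, inner_self_eq_norm_sq_to_K] at h
    have h2 : ∫ z, ‖act (root D z) (f.fn z)‖ ^ 2 ∂hypMeasure = 0 := by
      have : ((∫ z, ‖act (root D z) (f.fn z)‖ ^ 2 ∂hypMeasure : ℝ) : ℂ) = 0 := by
        rw [← h, ← integral_complex_ofReal]
        simp
      exact_mod_cast this
    rw [integral_eq_zero_iff_of_nonneg (fun z => by positivity)
      ((memLp_two_iff_integrable_sq_norm f.memLp.1).mp f.memLp)] at h2
    refine State.ext' ?_
    filter_upwards [h2, State.zero_fn (D := D)] with z hz h0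
    have hz' : act (root D z) (f.fn z) = 0 := by simpa using hz
    rw [h0, ← act_one (f.fn z), ← rootInv_mul_root D z, act_mul, hz', map_zero]

instance : NormedAddCommGroup (State D) := (stateCore D).toNormedAddCommGroup

instance : InnerProductSpace ℂ (State D) := InnerProductSpace.ofCore (stateCore D).toCore

lemma State.inner_def (g f : State D) :
    inner ℂ g f = ∫ z, dbar D (g.fn z) (act (gz D z) (f.fn z)) ∂hypMeasure := rfl

variable (D) in
/-- The identification with square integrable functions, for the proof of completeness. -/
def toL2 : State D →ₗᵢ[ℂ] Lp Spinor 2 hypMeasure where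
  toFun f := f.memLp.toLp _
  map_add' f g := by
    rw [← MemLp.toLp_add]
    refine MemLp.toLp_congr _ _ ?_
    filter_upwards [f.add_fn g] with z hz
    simp [hz]
  map_smul' c f := by
    simp only [RingHom.id_apply]
    rw [← MemLp.toLp_const_smul]
    refine MemLp.toLp_congr _ _ ?_
    filter_upwards [f.smul_fn c] with z hz
    simp [hz]
  norm_map' f := by
    have h : (inner ℂ (f.memLp.toLp _) (f.memLp.toLp _) : ℂ) = inner ℂ f f := by
      rw [L2.inner_def, State.inner_def]
      refine integral_congr_ae ?_
      filter_upwards [f.memLp.coeFn_toLp] with z hz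
      rw [hz, dbar_gz]
    rw [inner_self_eq_norm_sq_to_K, inner_self_eq_norm_sq_to_K] at h
    have h' : ‖f.memLp.toLp _‖ ^ 2 = ‖f‖ ^ 2 := by exact_mod_cast h
    exact (sq_eq_sq₀ (norm_nonneg _) (norm_nonneg _)).mp h'

lemma toL2_surjective : Function.Surjective (toL2 D) := by
  intro φ
  have hm := aesm_act (continuous_act_rootInv D) (Lp.aestronglyMeasurable φ)
  have hr : ∀ z, act (root D z) (act (rootInv D z) (φ z)) = φ z := fun z => by
    rw [← act_mul, root_mul_rootInv, act_one]
  refine ⟨State.mk D _ hm ?_, ?_⟩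
  · rw [integrable_iff D hm]
    simp only [hr]
    exact Lp.memLp φ
  · refine Lp.ext ?_
    refine (MemLp.coeFn_toLp (State.memLp _)).trans ?_
    filter_upwards [State.mk_fn (D := D) _ hm _] with z hz
    rw [hz, hr]

instance : CompleteSpace (State D) :=
  (LinearIsometryEquiv.ofSurjective (toL2 D) toL2_surjective).toIsometryEquiv.completeSpace

/-! ### The operator of multiplication by `γ·z` and the group it generates -/

lemma dbar_gz_gz (z : Space) (x y : Spinor) :
    dbar D (act (gz D z) x) (act (gz D z) (act (gz D z) y)) = dbar D x (act (gz D z) y) := by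
  have h : D.mat 0 * gz D z * D.mat 0 * (D.mat 0 * gz D z * gz D z) = D.mat 0 * gz D z := by
    calc D.mat 0 * gz D z * D.mat 0 * (D.mat 0 * gz D z * gz D z)
          = D.mat 0 * gz D z * (D.mat 0 * D.mat 0) * (gz D z * gz D z) := by
          simp only [mul_assoc]
      _ = _ := by rw [mat_zero_sq, gz_sq, mul_one, mul_one]
  rw [dbar, dbar, inner_act, gz_conjTranspose]
  simp only [← act_mul]
  conv_rhs => rw [← h]
  simp only [mul_assoc]

variable (D) in
/-- The operator `Γ f(z) = γ·z f(z)`. -/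
def Gam : State D →L[ℂ] State D :=
  LinearMap.mkContinuous
    { toFun := fun f => State.mk D (fun z => act (gz D z) (f.fn z))
        (aesm_act (contDiff_act_gz (n := 0) D).continuous f.aesm)
        (by simp only [dbar_gz_gz]; exact f.integrable f)
      map_add' := fun f g => by
        refine State.ext' ?_
        filter_upwards [State.mk_fn (D := D) (fun z => act (gz D z) ((f + g).fn z)) _ _,
          State.mk_fn (D := D) (fun z => act (gz D z) (f.fn z)) _ _,
          State.mk_fn (D := D) (fun z => act (gz D z) (g.fn z)) _ _,
          f.add_fn g, State.add_fn (State.mk D (fun z => act (gz D z) (f.fn z)) _ _)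
            (State.mk D (fun z => act (gz D z) (g.fn z)) _ _)] with z h1 h2 h3 h4 h5
        rw [h1, h5, h2, h3, h4, map_add]
      map_smul' := fun c f => by
        refine State.ext' ?_
        filter_upwards [State.mk_fn (D := D) (fun z => act (gz D z) ((c • f).fn z)) _ _,
          State.mk_fn (D := D) (fun z => act (gz D z) (f.fn z)) _ _,
          f.smul_fn c, State.smul_fn c (State.mk D (fun z => act (gz D z) (f.fn z)) _ _)]
          with z h1 h2 h3 h4
        rw [h1, RingHom.id_apply, h4, h2, h3, map_smul] }
    1 (fun f => by
      rw [one_mul]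
      refine le_of_eq ?_
      have h : ∀ g k : State D, (inner ℂ g g : ℂ) = inner ℂ k k → ‖g‖ = ‖k‖ := by
        intro g k h
        rw [inner_self_eq_norm_sq_to_K, inner_self_eq_norm_sq_to_K] at h
        have h' : ‖g‖ ^ 2 = ‖k‖ ^ 2 := by exact_mod_cast h
        exact (sq_eq_sq₀ (norm_nonneg _) (norm_nonneg _)).mp h'
      refine h _ _ ?_
      rw [State.inner_def, State.inner_def]
      refine integral_congr_ae ?_
      filter_upwards [State.mk_fn (D := D) (fun z => act (gz D z) (f.fn z)) _ _] with z hz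
      simp only [LinearMap.coe_mk, AddHom.coe_mk]
      rw [hz, dbar_gz_gz])

variable (D) in
/-- `G_κ = e^{iκΓ}`. -/
def G (κ : ℝ) : State D →L[ℂ] State D := NormedSpace.exp ((Complex.I * κ) • Gam D)

/-! ### Test functions and differential operators -/

/-- The class `C₀ᵏ` of `k`-times continuously differentiable functions of compact support. -/
structure C0 (k : WithTop ℕ∞) where
  toFun : Space → Spinor
  contDiff : ContDiff ℝ k toFun
  compact : HasCompactSupport toFun

variable (D) in
/-- The element of the Hilbert space given by a function of class `C₀ᵏ`. -/
def toState {k : WithTop ℕ∞} (f : C0 k) : State D :=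
  State.mk D f.toFun f.contDiff.continuous.aestronglyMeasurable (by
    have hc := f.contDiff.continuous
    rw [integrable_iff D hc.aestronglyMeasurable]
    refine Continuous.memLp_of_hasCompactSupport ((continuous_act_root D).clm_apply hc) ?_
    refine f.compact.mono ?_
    intro z hz h
    exact hz (by simp [h]))

/-- Covariant components `z_a`. -/
def low (a : Fin 4) (z : Space) : ℝ := sgn a * pt z a

/-- The projection tensor `h_a^b = g_a^b - z_a z^b`. -/
def proj (a b : Fin 4) (z : Space) : ℝ := (if a = b then 1 else 0) - low a z * pt z b

/-- The derivative `δ_a` tangent to the hyperboloid. It is `h_a^b ∇_b` applied to any extension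
of the function off the hyperboloid; the extension used here is the one that does not depend on
the time coordinate, so that only the three spatial partial derivatives contribute. -/
def delta (a : Fin 4) (f : Space → Spinor) (z : Space) : Spinor :=
  ∑ j : Fin 3, proj a j.succ z • fderiv ℝ f z (EuclideanSpace.single j 1)

variable (D) in
/-- The tangential Dirac matrices `γ_T^a = γ^a - z^a γ·z`. -/
def gT (a : Fin 4) (z : Space) : Matrix (Fin 4) (Fin 4) ℂ :=
  D.mat a - (pt z a : ℂ) • gz D z

variable (D) in
/-- `p_a = i (δ_a + ½ γ·z γ_{T a} - (3/2) z_a)`. -/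
def momentum (a : Fin 4) (f : Space → Spinor) (z : Space) : Spinor :=
  Complex.I • (delta a f z + (1 / 2 : ℂ) • act (gz D z) (act ((sgn a : ℂ) • gT D a z) (f z))
    - (3 / 2 * low a z : ℂ) • f z)

variable (D) in
/-- `h = -i γ_T·p = -i γ_T^a p_a`. -/
def hFun (f : Space → Spinor) (z : Space) : Spinor :=
  -Complex.I • ∑ a, act (gT D a z) (momentum D a f z)

lemma contDiff_act_gT {n : WithTop ℕ∞} (a : Fin 4) : ContDiff ℝ n fun z => act (gT D a z) := by
  simp only [act, gT, map_sub, map_smul]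
  exact contDiff_const.sub ((contDiff_ofReal (contDiff_pt a)).smul (contDiff_act_gz D))

lemma contDiff_csmul {n : WithTop ℕ∞} {c : Space → ℂ} {f : Space → Spinor}
    (hc : ContDiff ℝ n c) (hf : ContDiff ℝ n f) : ContDiff ℝ n fun z => c z • f z :=
  hc.smul hf

lemma contDiff_hFun (k : ℕ) {f : Space → Spinor} (hf : ContDiff ℝ ((k + 1 : ℕ) : WithTop ℕ∞) f) :
    ContDiff ℝ (k : WithTop ℕ∞) (hFun D f) := by
  have hk : ContDiff ℝ (k : WithTop ℕ∞) f := hf.of_le (by exact_mod_cast Nat.le_succ k)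
  have hlow (a : Fin 4) : ContDiff ℝ (k : WithTop ℕ∞) (low a) :=
    contDiff_const.mul (contDiff_pt a)
  have hδ (a : Fin 4) : ContDiff ℝ (k : WithTop ℕ∞) (delta a f) := by
    refine ContDiff.sum fun j _ => contDiff_smul.comp (ContDiff.prodMk ?_ ?_)
    · exact contDiff_const.sub ((hlow a).mul (contDiff_pt _))
    · exact (hf.fderiv_right (m := (k : WithTop ℕ∞)) (by norm_cast)).clm_apply contDiff_const
  have hm (a : Fin 4) : ContDiff ℝ (k : WithTop ℕ∞) (momentum D a f) := by
    refine ContDiff.const_smul _ (((hδ a).add (ContDiff.const_smul _ ?_)).sub ?_)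
    · refine contDiff_apply (contDiff_act_gz D) (contDiff_apply ?_ hk)
      simp only [act, map_smul]
      exact (contDiff_act_gT a).const_smul _
    · exact contDiff_csmul (contDiff_const.mul (contDiff_ofReal (hlow a))) hk
  exact ContDiff.const_smul _ (ContDiff.sum fun a _ => contDiff_apply (contDiff_act_gT a) (hm a))

lemma compact_hFun {f : Space → Spinor} (hf : HasCompactSupport f) :
    HasCompactSupport (hFun D f) := by
  refine HasCompactSupport.mono' hf ?_
  intro z hz
  by_contra h
  refine hz ?_
  have h1 : f z = 0 := image_eq_zero_of_notMem_tsupport h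
  have h2 : fderiv ℝ f z = 0 := fderiv_of_notMem_tsupport (𝕜 := ℝ) h
  simp [hFun, momentum, delta, h1, h2]

variable (D) in
/-- The operator `h : C₀^{k+1} → C₀^k`. -/
def hOp {k : ℕ} (f : C0 ((k + 1 : ℕ) : WithTop ℕ∞)) : C0 (k : WithTop ℕ∞) where
  toFun := hFun D f.toFun
  contDiff := contDiff_hFun k f.contDiff
  compact := compact_hFun f.compact

/-! ### The Fourier-type transformation on the hyperboloid -/

variable (D) in
/-- `(κ/2π)^{3/2} ∫ e^{-iκ u·z γ·z} γ·z f(z) dμ(z)`. -/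
def fourierInt (κ : ℝ) (f : Space → Spinor) (u : Space) : Spinor :=
  (((κ / (2 * Real.pi)) ^ (3 / 2 : ℝ) : ℝ) : ℂ) • ∫ z,
    act (NormedSpace.exp ((-Complex.I * κ * mdot (pt u) (pt z)) • gz D z))
      (act (gz D z) (f z)) ∂hypMeasure

variable (D) in
/-- `(κ/2π)^{3/2} ∫ e^{+iκ u·z γ·u} γ·z f(z) dμ(z)`. -/
def fourierStarInt (κ : ℝ) (f : Space → Spinor) (u : Space) : Spinor :=
  (((κ / (2 * Real.pi)) ^ (3 / 2 : ℝ) : ℝ) : ℂ) • ∫ z,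
    act (NormedSpace.exp ((Complex.I * κ * mdot (pt u) (pt z)) • gz D u))
      (act (gz D z) (f z)) ∂hypMeasure

/-- The bounded operator `A` on the Hilbert space is given on `C₀^∞` by the transformation `t`
of functions. As `C₀^∞` is dense, there is at most one such `A`. -/
def Extends (A : State D →L[ℂ] State D) (t : (Space → Spinor) → Space → Spinor) : Prop :=
  ∀ g : C0 ((⊤ : ℕ∞) : WithTop ℕ∞), (A (toState D g)).fn =ᵐ[hypMeasure] t g.toFun

open Classical in
variable (D) in
/-- `F_κ`: the extension to the Hilbert space, by continuity, of the transformation `fourierInt`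
of `C₀^∞`. That the extension exists is not presupposed (the value would be `0` if it did not). -/
def F (κ : ℝ) : State D →L[ℂ] State D :=
  if h : ∃ A : State D →L[ℂ] State D, Extends A (fourierInt D κ) then h.choose else 0

variable (D) in
/-- `T_κ = i G_{κ + π/4} F_κ`. -/
def T (κ : ℝ) : State D →L[ℂ] State D :=
  Complex.I • (G D (κ + Real.pi / 4) ∘L F D κ)

end HypDirac

end

/-!
The statement rests on two facts: `F_κ` is unitary, and the matrix elements of `T_κ^*`
vary by `O(1/κ)` beyond `κ` and have the limit `(g, f)` in the mean.

*Unitarity.* Since `(γ·z)² = 1`, the matrix exponentials split into the scalars `e^{±iκ u·z}` on the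
eigenspaces of `γ·z` (`act_exp`), and both transforms become combinations of plane waves
`∫ e^{-λ u·z} g(z) dμ(z)` (`wave`, `fourierInt_eq`, `fourierStarInt_eq`). Replacing `λ = ±iκ` by
`ε ± iκ` makes all integrals absolutely convergent. The squared norm of a damped transform is then a
double integral whose kernel is a moment of `e^{-w·u} dμ(u)` at the complex vector
`w = ε (z + z') + iκ (z' - z)`. By Lorentz invariance, in the infinitesimal form that the Laplace
transform of `μ` is constant along paths with `w·w` constant (`laplace_eq_of_path`), this moment is
`w` times an explicit real factor (`moment_pairVec`). As `ε → 0` the kernels concentrate on the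
diagonal (`tendsto_integral_kernel`, `tendsto_dampedForm`), and rapid decay of the waves
(`exists_norm_wave_le`) allows the limit on the other side. Hence both transforms are isometric on
test functions; by Fubini they are adjoint to each other, so that `F_κ`, and with it `T_κ`, is
unitary (`exists_extends`, `adjoint_F`, `norm_T_sub`).

*Variation in the frequency.* Integration by parts against a plane wave trades the factor `u·z γ·z`
for `γ·u` and `κ⁻¹ h` (`wave_mdot_gz`). Together with `h Γ = -Γ h` (`hFun_gz`) this makes the matrix
elements of `F_κ^*` between `g` and `f`, `Γ f`, `h f`, ... a system of differential equations in `κ`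
(`hasDerivAt_matrixElement`). In the matrix element of `T_κ^*` the rotation of the system is undone
by `G_{κ+π/4}`; what is left oscillates like `e^{±2iκ}/κ`, and one more integration by parts in `κ`
bounds the change beyond `κ` by `κ⁻¹ ‖g‖ (‖h f‖ + ‖h² f‖)` (`norm_sub_le_of_system`,
`norm_inner_adjoint_T_sub_le`).

*The limit.* As the variation is already under control, it suffices to identify the limit of the
matrix elements in the sense of Abel means, which avoids the method of stationary phase. The mean of
`κ^{3/2} e^{iκx}` with weight `R⁻¹ e^{-κ/R}` is a multiple of `R^{3/2} (1 - iRx)^{-5/2}`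
(`integral_abelWeight_coeff`). For `x = ±(u·z - 1)` this is again an approximate identity
(`tendsto_abel_oscInt`); for `x = ±(u·z + 1)` it tends to zero (`tendsto_abel_oscInt_zero`). The
phases collected on the diagonal cancel against those of `T_κ`, and the limit is `(g, f)`
(`abel_inner_adjoint_T`).
-/

noncomputable section

namespace HypDirac

open Filter Topology

section

/-! ### Exponentials of involutions -/

/-- The odd and the even part of the exponential series are summed separately. -/
lemma exp_smul_of_mul_self_eq_one {𝔸 : Type*} [Ring 𝔸] [Algebra ℂ 𝔸] [TopologicalSpace 𝔸]
    [IsTopologicalRing 𝔸] [ContinuousSMul ℂ 𝔸] [T2Space 𝔸] {A : 𝔸} (hA : A * A = 1) (c : ℂ) :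
    NormedSpace.exp (c • A) = Complex.cosh c • (1 : 𝔸) + Complex.sinh c • A := by
  have heven : ∀ n, A ^ (2 * n) = 1 := fun n => by rw [pow_mul, pow_two, hA, one_pow]
  have h1 : HasSum (fun n : ℕ => ((2 * n).factorial : ℂ)⁻¹ • (c • A) ^ (2 * n))
      (Complex.cosh c • (1 : 𝔸)) := by
    have h := (Complex.hasSum_cosh c).smul_const (1 : 𝔸)
    refine h.congr_fun fun n => ?_
    rw [smul_pow, heven, smul_smul, div_eq_inv_mul]
  have h2 : HasSum (fun n : ℕ => ((2 * n + 1).factorial : ℂ)⁻¹ • (c • A) ^ (2 * n + 1))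
      (Complex.sinh c • A) := by
    have h := (Complex.hasSum_sinh c).smul_const A
    refine h.congr_fun fun n => ?_
    rw [smul_pow, pow_succ A, heven, one_mul, smul_smul, div_eq_inv_mul]
  rw [congrFun (NormedSpace.exp_eq_tsum ℂ (𝔸 := 𝔸)) (c • A)]
  exact (HasSum.even_add_odd (f := fun n : ℕ => (n.factorial : ℂ)⁻¹ • (c • A) ^ n) h1 h2).tsum_eq

/-! ### Minkowski geometry of the hyperboloid -/

lemma time_sq (z : Space) : time z ^ 2 = 1 + ‖z‖ ^ 2 := Real.sq_sqrt (by positivity)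

lemma norm_lt_time (z : Space) : ‖z‖ < time z := by
  have h1 := time_sq z
  have h2 := time_pos z
  nlinarith [norm_nonneg z]

lemma time_le (z : Space) : time z ≤ 1 + ‖z‖ := by
  have h1 := time_sq z
  have h2 := time_pos z
  nlinarith [norm_nonneg z]

lemma continuous_time : Continuous time := (contDiff_time (n := 0)).continuous

lemma mdot_pt_eq (u z : Space) :
    mdot (pt u) (pt z) = time u * time z - inner ℝ u z := by
  simp [mdot, pt, sgn, Fin.sum_univ_four, EuclideanSpace.inner_eq_star_dotProduct,
    dotProduct, Fin.sum_univ_three]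
  ring

lemma le_mdot_pt (u z : Space) : (time z - ‖z‖) * time u ≤ mdot (pt u) (pt z) := by
  rw [mdot_pt_eq]
  have h1 := real_inner_le_norm u z
  have h2 := norm_lt_time u
  nlinarith [norm_nonneg z]

lemma mdot_comm (u v : Fin 4 → ℝ) : mdot u v = mdot v u :=
  Finset.sum_congr rfl fun _ _ => by ring

/-- The square `-(z - z')²` of the space-like Minkowski distance of two points of the
hyperboloid. -/
def distSq (z z' : Space) : ℝ := ‖z' - z‖ ^ 2 - (time z' - time z) ^ 2

/-- The product of two points exceeds `1` by half their squared distance, so that the phases of all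
double integrals are functions of `distSq`. -/
lemma mdot_pt_eq_distSq (z z' : Space) : mdot (pt z) (pt z') = 1 + distSq z z' / 2 := by
  rw [mdot_pt_eq, distSq, norm_sub_sq_real, real_inner_comm]
  have h1 := time_sq z
  have h2 := time_sq z'
  linarith

lemma time_sub_time (z z' : Space) :
    time z' - time z = inner ℝ (z + z') (z' - z) / (time z + time z') := by
  have h1 := time_sq z
  have h2 := time_sq z'
  have h3 := time_pos z
  have h4 := time_pos z'
  rw [eq_div_iff (by positivity)]
  have : (inner ℝ (z + z') (z' - z) : ℝ) = ‖z'‖ ^ 2 - ‖z‖ ^ 2 := by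
    rw [inner_sub_right, inner_add_left, inner_add_left, real_inner_self_eq_norm_sq,
      real_inner_self_eq_norm_sq, real_inner_comm]
    ring
  rw [this]; linarith

/-- On bounded sets the hyperbolic distance dominates the euclidean one. -/
lemma norm_sq_le_distSq (z z' : Space) :
    ‖z' - z‖ ^ 2 ≤ (time z + time z') ^ 2 / 4 * distSq z z' := by
  have h3 := one_le_time z
  have h4 := one_le_time z'
  have hs : 0 < time z + time z' := by linarith
  have h5 : (time z' - time z) * (time z + time z') = inner ℝ (z + z') (z' - z) := by
    rw [time_sub_time]; field_simp
  have h6 : (inner ℝ (z + z') (z' - z) : ℝ) ^ 2 ≤ ‖z + z'‖ ^ 2 * ‖z' - z‖ ^ 2 := by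
    rw [← mul_pow]
    exact sq_le_sq' (neg_le_of_abs_le (abs_real_inner_le_norm _ _)) (real_inner_le_norm _ _)
  have h7 : ‖z + z'‖ ^ 2 + 4 ≤ (time z + time z') ^ 2 := by
    have := le_mdot_pt z z'
    rw [norm_add_sq_real]
    have h1 := time_sq z
    have h2 := time_sq z'
    have h8 : 1 ≤ mdot (pt z) (pt z') := by
      rw [mdot_pt_eq]
      have h9 := real_inner_le_norm z z'
      have : (1 + ‖z‖ * ‖z'‖) ^ 2 ≤ (time z * time z') ^ 2 := by
        rw [mul_pow, h1, h2]; nlinarith [sq_nonneg (‖z‖ - ‖z'‖)]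
      have := abs_le_of_sq_le_sq' this (by positivity)
      linarith [this.2]
    rw [mdot_pt_eq] at h8
    nlinarith
  have h8 : (time z + time z') ^ 2 * distSq z z'
      = (time z + time z') ^ 2 * ‖z' - z‖ ^ 2 - inner ℝ (z + z') (z' - z) ^ 2 := by
    rw [distSq, ← h5]; ring
  have h9 := mul_le_mul_of_nonneg_right h7 (sq_nonneg ‖z' - z‖)
  nlinarith

lemma distSq_nonneg (z z' : Space) : 0 ≤ distSq z z' := by
  have h := norm_sq_le_distSq z z'
  have h3 := one_le_time z
  have h4 := one_le_time z'
  have : 0 < (time z + time z') ^ 2 / 4 := by positivity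
  by_contra hn
  nlinarith [sq_nonneg ‖z' - z‖, mul_neg_of_pos_of_neg this (not_le.mp hn)]

lemma one_le_mdot_pt (z z' : Space) : 1 ≤ mdot (pt z) (pt z') := by
  rw [mdot_pt_eq_distSq]; linarith [distSq_nonneg z z']

lemma continuous_distSq : Continuous fun p : Space × Space => distSq p.1 p.2 := by
  have := continuous_time
  unfold distSq; fun_prop

lemma continuous_mdot_pt : Continuous fun p : Space × Space => mdot (pt p.1) (pt p.2) := by
  simp only [mdot_pt_eq_distSq]
  exact continuous_const.add (continuous_distSq.div_const _)

/-! ### Spinor algebra -/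

lemma act_add (A B : Matrix (Fin 4) (Fin 4) ℂ) (x : Spinor) :
    act (A + B) x = act A x + act B x := by simp [act]

lemma act_sub (A B : Matrix (Fin 4) (Fin 4) ℂ) (x : Spinor) :
    act (A - B) x = act A x - act B x := by simp [act]

lemma act_neg (A : Matrix (Fin 4) (Fin 4) ℂ) (x : Spinor) : act (-A) x = -act A x := by
  simp [act]

lemma act_smul (c : ℂ) (A : Matrix (Fin 4) (Fin 4) ℂ) (x : Spinor) :
    act (c • A) x = c • act A x := by simp [act]

lemma act_sum {ι : Type*} (s : Finset ι) (A : ι → Matrix (Fin 4) (Fin 4) ℂ) (x : Spinor) :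
    act (∑ i ∈ s, A i) x = ∑ i ∈ s, act (A i) x := by
  simp [act]

variable (D : DiracMatrices)

lemma act_gz_gz (z : Space) (x : Spinor) : act (gz D z) (act (gz D z) x) = x := by
  rw [← act_mul, gz_sq, act_one]

lemma dbar_add_left (x y w : Spinor) : dbar D (x + y) w = dbar D x w + dbar D y w := by
  simp [dbar]

lemma dbar_sub_left (x y w : Spinor) : dbar D (x - y) w = dbar D x w - dbar D y w := by
  simp [dbar]

lemma dbar_add_right (x y w : Spinor) : dbar D x (y + w) = dbar D x y + dbar D x w := by
  simp [dbar]

lemma dbar_sub_right (x y w : Spinor) : dbar D x (y - w) = dbar D x y - dbar D x w := by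
  simp [dbar]

lemma dbar_smul_left (c : ℂ) (x y : Spinor) : dbar D (c • x) y = conj c * dbar D x y := by
  simp [dbar, mul_comm]

lemma dbar_smul_right (c : ℂ) (x y : Spinor) : dbar D x (c • y) = c * dbar D x y := by
  simp [dbar]

/-- `γ·z` is symmetric for the Dirac conjugate pairing. -/
lemma dbar_act_gz (z : Space) (x y : Spinor) :
    dbar D (act (gz D z) x) y = dbar D x (act (gz D z) y) := by
  rw [dbar, dbar, inner_act, gz_conjTranspose, ← act_mul, ← act_mul, mul_assoc, mat_zero_sq,
    mul_one]

/-- The Dirac conjugate pairing as a continuous sesquilinear map. -/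
def dbarL : Spinor →L⋆[ℂ] Spinor →L[ℂ] ℂ :=
  (ContinuousLinearMap.compL ℂ Spinor Spinor ℂ).flip (act (D.mat 0)) ∘SL innerSL ℂ

lemma norm_dbar_le (x y : Spinor) : ‖dbar D x y‖ ≤ ‖dbarL D‖ * ‖x‖ * ‖y‖ :=
  (dbarL D).le_opNorm₂ x y

lemma continuous_dbar {X : Type*} [TopologicalSpace X] {f g : X → Spinor} (hf : Continuous f)
    (hg : Continuous g) : Continuous fun x => dbar D (f x) (g x) :=
  hf.inner ((act (D.mat 0)).continuous.comp hg)

lemma integral_dbar_right {X : Type*} [MeasurableSpace X] {μ : Measure X} {f : X → Spinor}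
    (hf : Integrable f μ) (x : Spinor) : ∫ t, dbar D x (f t) ∂μ = dbar D x (∫ t, f t ∂μ) :=
  (dbarL D x).integral_comp_comm hf

lemma integral_dbar_left {X : Type*} [MeasurableSpace X] {μ : Measure X} {f : X → Spinor}
    (hf : Integrable f μ) (y : Spinor) : ∫ t, dbar D (f t) y ∂μ = dbar D (∫ t, f t ∂μ) y := by
  rw [dbar, ← inner_conj_symm, ← integral_inner hf, ← integral_conj]
  simp only [dbar, inner_conj_symm]

lemma norm_pt_le (z : Space) (a : Fin 4) : |pt z a| ≤ time z := by
  have h := (norm_lt_time z).le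
  have h3 : ∀ i : Fin 3, |z i| ≤ ‖z‖ := fun i => PiLp.norm_apply_le z i
  fin_cases a
  · exact (abs_of_pos (time_pos z)).le
  · exact (h3 0).trans h
  · exact (h3 1).trans h
  · exact (h3 2).trans h

lemma abs_sgn (a : Fin 4) : |sgn a| = 1 := by fin_cases a <;> simp [sgn]

lemma exists_norm_act_gz_le : ∃ C, 0 ≤ C ∧ ∀ z, ‖act (gz D z)‖ ≤ C * time z := by
  refine ⟨∑ a, ‖act (D.mat a)‖, by positivity, fun z => ?_⟩
  rw [Finset.sum_mul]
  simp only [act, gz, slash, map_sum, map_smul]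
  refine (norm_sum_le _ _).trans (Finset.sum_le_sum fun a _ => ?_)
  rw [norm_smul, mul_comm, Complex.norm_real, Real.norm_eq_abs, abs_mul, abs_sgn, one_mul]
  exact mul_le_mul_of_nonneg_left (norm_pt_le z a) (norm_nonneg _)

lemma continuous_act_gz : Continuous fun z => act (gz D z) :=
  (contDiff_act_gz (n := 0) D).continuous

lemma continuous_act_gz_apply {X : Type*} [TopologicalSpace X] {p : X → Space} {f : X → Spinor}
    (hp : Continuous p) (hf : Continuous f) : Continuous fun x => act (gz D (p x)) (f x) :=
  ((continuous_act_gz D).comp hp).clm_apply hf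

/-! ### The invariant measure -/

lemma measurable_inv_time : Measurable fun z => (1 / time z).toNNReal := by
  have := continuous_time.measurable
  fun_prop

lemma toNNReal_inv_time_smul {E : Type*} [NormedAddCommGroup E] [NormedSpace ℝ E] (z : Space)
    (x : E) : (1 / time z).toNNReal • x = (time z)⁻¹ • x := by
  rw [NNReal.smul_def, Real.coe_toNNReal _ (by have := time_pos z; positivity), one_div]

lemma integral_hyp {E : Type*} [NormedAddCommGroup E] [NormedSpace ℝ E] (f : Space → E) :
    ∫ z, f z ∂hypMeasure = ∫ z, (time z)⁻¹ • f z := by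
  have h := integral_withDensity_eq_integral_smul (μ := volume) measurable_inv_time f
  simp only [toNNReal_inv_time_smul] at h
  exact h

lemma integrable_hyp {E : Type*} [NormedAddCommGroup E] [NormedSpace ℝ E] {f : Space → E} :
    Integrable f hypMeasure ↔ Integrable (fun z => (time z)⁻¹ • f z) := by
  have h := integrable_withDensity_iff_integrable_smul (μ := volume) measurable_inv_time (g := f)
  simp only [toNNReal_inv_time_smul] at h
  exact h

instance : SFinite hypMeasure := by unfold hypMeasure; infer_instance

end

section

/-! ### Approximate identities on the hyperboloid -/

/-- The metric of the hyperboloid at `z`, in the coordinates of `ℝ³`. -/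
def quad (z y : Space) : ℝ := ‖y‖ ^ 2 - (inner ℝ z y / time z) ^ 2

/-- A linear map which turns `quad z` into the euclidean form; it has determinant `1 / z⁰`. -/
def flatten (z : Space) : Space →ₗ[ℝ] Space :=
  LinearMap.transvection (innerₛₗ ℝ z) (-(time z * (1 + time z))⁻¹ • z)

lemma norm_flatten_sq (z y : Space) : ‖flatten z y‖ ^ 2 = quad z y := by
  have h1 := time_sq z
  have h2 := time_pos z
  have h : flatten z y = y - (inner ℝ z y * (time z * (1 + time z))⁻¹) • z := by
    simp [flatten, LinearMap.transvection, smul_smul, sub_eq_add_neg]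
  rw [h, norm_sub_sq_real, norm_smul, mul_pow, Real.norm_eq_abs, sq_abs, inner_smul_right,
    real_inner_comm z y, quad, show ‖z‖ ^ 2 = time z ^ 2 - 1 by linarith]
  field_simp
  ring

lemma det_flatten (z : Space) : LinearMap.det (flatten z) = (time z)⁻¹ := by
  have h1 := time_sq z
  have h2 := time_pos z
  rw [flatten, LinearMap.transvection.det]
  simp only [innerₛₗ_apply_apply, inner_smul_right, real_inner_self_eq_norm_sq]
  rw [show ‖z‖ ^ 2 = time z ^ 2 - 1 by linarith]
  field_simp
  ring

/-- The density `z⁰` cancels the one of the invariant measure: the integral does not depend on `z`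
with respect to the measure `d³y / z⁰` of the tangent space. -/
lemma integral_comp_quad {E : Type*} [NormedAddCommGroup E] [NormedSpace ℝ E] (z : Space)
    (H : ℝ → E) : ∫ y, H (quad z y) = time z • ∫ y : Space, H (‖y‖ ^ 2) := by
  have hd : LinearMap.det (flatten z) ≠ 0 := by
    rw [det_flatten]; exact inv_ne_zero (time_pos z).ne'
  have h := Measure.map_linearMap_addHaar_eq_smul_addHaar (volume : Measure Space) hd
  have e : MeasurableEmbedding (flatten z) :=
    ((flatten z).equivOfDetNeZero hd).toContinuousLinearEquiv.toHomeomorph.measurableEmbedding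
  have h2 := e.integral_map (μ := volume) fun y => H (‖y‖ ^ 2)
  rw [h, integral_smul_measure, det_flatten, inv_inv, abs_of_pos (time_pos z),
    ENNReal.toReal_ofReal (time_pos z).le] at h2
  rw [h2]
  simp only [norm_flatten_sq]

/-- At the scale `R^{-1/2}` the squared distance becomes the metric of the tangent space. -/
lemma tendsto_distSq (z y : Space) : Tendsto (fun R : ℝ => R * distSq z (z + (√R)⁻¹ • y)) atTop
    (𝓝 (quad z y)) := by
  have hs : Tendsto (fun R : ℝ => (√R)⁻¹) atTop (𝓝 0) :=
    tendsto_inv_atTop_zero.comp Real.tendsto_sqrt_atTop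
  have hc : Continuous fun s : ℝ => ‖y‖ ^ 2
      - (inner ℝ (z + (z + s • y)) y / (time z + time (z + s • y))) ^ 2 := by
    have := continuous_time
    refine continuous_const.sub (Continuous.pow (Continuous.div (by fun_prop) (by fun_prop) ?_) 2)
    intro s
    have h1 := time_pos z
    have h2 := time_pos (z + s • y)
    positivity
  have h := (hc.tendsto 0).comp hs
  have h0 : quad z y = ‖y‖ ^ 2
      - (inner ℝ (z + (z + (0 : ℝ) • y)) y / (time z + time (z + (0 : ℝ) • y))) ^ 2 := by
    rw [zero_smul, add_zero, ← two_smul ℝ z, inner_smul_left, ← two_mul]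
    have h1 := time_pos z
    simp only [quad]
    congr 2
    simp
    field_simp
  rw [h0]
  refine h.congr' ?_
  filter_upwards [eventually_gt_atTop 0] with R hR
  have h1 := time_pos z
  have h2 := time_pos (z + (√R)⁻¹ • y)
  simp only [Function.comp]
  rw [distSq, time_sub_time, add_sub_cancel_left, norm_smul, inner_smul_right, norm_inv,
    Real.norm_eq_abs, abs_of_pos (Real.sqrt_pos.mpr hR)]
  have h3 : R * (√R)⁻¹ ^ 2 = 1 := by
    rw [inv_pow, Real.sq_sqrt hR.le, mul_inv_cancel₀ hR.ne']
  rw [mul_sub, mul_pow, ← mul_assoc, h3, one_mul, mul_div_assoc, mul_pow, ← mul_assoc, h3, one_mul]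

lemma tendsto_add_smul (z y : Space) :
    Tendsto (fun R : ℝ => z + (√R)⁻¹ • y) atTop (𝓝 z) := by
  have hs : Tendsto (fun R : ℝ => (√R)⁻¹) atTop (𝓝 0) :=
    tendsto_inv_atTop_zero.comp Real.tendsto_sqrt_atTop
  simpa using tendsto_const_nhds.add (hs.smul_const y)

/-- Translation to `z` and dilation by `R^{-1/2}`. -/
lemma integral_eq_integral_scaled {E : Type*} [NormedAddCommGroup E] [NormedSpace ℝ E]
    (f : Space → E) (z : Space) {R : ℝ} (hR : 0 < R) :
    √R ^ 3 • ∫ z', f z' = ∫ y, f (z + (√R)⁻¹ • y) := by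
  have hs := Real.sqrt_pos.mpr hR
  rw [Measure.integral_comp_smul volume (fun y => f (z + y)) (√R)⁻¹,
    integral_add_left_eq_self f z, finrank_euclideanSpace, Fintype.card_fin, inv_pow, inv_inv,
    abs_of_pos (by positivity)]

/-- Kernels concentrating on the diagonal at the scale `R^{-1/2}`: they are an approximate
identity for the invariant measure. -/
theorem tendsto_integral_kernel {a : Space → Space → ℂ} (ha : Continuous (Function.uncurry a))
    {K : Set Space} (hK : IsCompact K) (haK : ∀ z z', a z z' ≠ 0 → z ∈ K ∧ z' ∈ K)
    {k : ℝ → Space → Space → ℂ} (hk : ∀ᶠ R in atTop, Continuous (Function.uncurry (k R))) {C : ℝ}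
    (hC : ∀ᶠ R in atTop, ∀ z z', ‖k R z z'‖ ≤ C * ((1 + R * distSq z z') ^ 2)⁻¹) {H : ℝ → ℂ}
    (hH : ∀ z y, Tendsto (fun R => k R z (z + (√R)⁻¹ • y)) atTop (𝓝 (H (quad z y)))) :
    Tendsto (fun R : ℝ => ∫ z, √R ^ 3 • ∫ z', a z z' * k R z z' ∂hypMeasure ∂hypMeasure) atTop
      (𝓝 ((∫ z, a z z ∂hypMeasure) * ∫ y : Space, H (‖y‖ ^ 2))) := by
  obtain ⟨A, hA0, hA⟩ : ∃ A, 0 ≤ A ∧ ∀ z z', ‖a z z'‖ ≤ A := by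
    obtain ⟨A, hA⟩ := (hK.prod hK).exists_bound_of_continuousOn ha.continuousOn
    refine ⟨max A 0, le_max_right _ _, fun z z' => ?_⟩
    by_cases h : a z z' = 0
    · simp [h]
    · exact (hA (z, z') (haK z z' h)).trans (le_max_left _ _)
  obtain ⟨T, hT1, hT⟩ : ∃ T : ℝ, 1 ≤ T ∧ ∀ z ∈ K, time z ≤ T := by
    obtain ⟨T, hT⟩ := hK.exists_bound_of_continuousOn continuous_time.continuousOn
    exact ⟨max T 1, le_max_right _ _, fun z hz =>
      ((le_abs_self _).trans (hT z hz)).trans (le_max_left _ _)⟩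
  set B : Space → ℝ := fun y => A * C * T ^ 4 * (1 + ‖y‖ ^ 2) ^ (-(4 : ℝ) / 2) with hB
  have hBi : Integrable B := (integrable_rpow_neg_one_add_norm_sq (E := Space) (r := 4)
    (by rw [finrank_euclideanSpace, Fintype.card_fin]; norm_num)).const_mul _
  have hbound : ∀ᶠ R : ℝ in atTop, ∀ z y, ‖(time (z + (√R)⁻¹ • y))⁻¹ •
      (a z (z + (√R)⁻¹ • y) * k R z (z + (√R)⁻¹ • y))‖
        ≤ K.indicator (fun _ => (1 : ℝ)) z * B y := by
    filter_upwards [hC, eventually_gt_atTop 0] with R hR hR0 z y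
    set z' := z + (√R)⁻¹ • y with hz'
    have hC0 : 0 ≤ C := by
      have := (norm_nonneg _).trans (hR z z)
      simpa [distSq] using this
    have hB0 : ∀ y, 0 ≤ B y := fun y => by positivity
    by_cases h : a z z' = 0
    · rw [h]; simp only [zero_mul, smul_zero, norm_zero]
      exact mul_nonneg (Set.indicator_nonneg (fun _ _ => zero_le_one) _) (hB0 y)
    obtain ⟨h1, h2⟩ := haK z z' h
    rw [Set.indicator_of_mem h1, one_mul, norm_smul, norm_mul]
    have e1 : ‖(time z')⁻¹‖ ≤ 1 := by
      rw [norm_inv, Real.norm_eq_abs, abs_of_pos (time_pos _)]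
      exact inv_le_one_of_one_le₀ (one_le_time _)
    have e2 : ‖y‖ ^ 2 ≤ T ^ 2 * (R * distSq z z') := by
      have := norm_sq_le_distSq z z'
      have hy : ‖y‖ ^ 2 = R * ‖z' - z‖ ^ 2 := by
        rw [hz', add_sub_cancel_left, norm_smul, norm_inv, Real.norm_eq_abs,
          abs_of_pos (Real.sqrt_pos.mpr hR0), mul_pow, inv_pow, Real.sq_sqrt hR0.le]
        field_simp
      have h3 : (time z + time z') ^ 2 / 4 ≤ T ^ 2 := by
        have := hT z h1; have := hT z' h2
        have := time_pos z; have := time_pos z'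
        nlinarith
      rw [hy]
      have := mul_le_mul_of_nonneg_right h3 (distSq_nonneg z z')
      nlinarith
    have e3 : ((1 + R * distSq z z') ^ 2)⁻¹ ≤ T ^ 4 * (1 + ‖y‖ ^ 2) ^ (-(4 : ℝ) / 2) := by
      have h4 : (1 + ‖y‖ ^ 2) ^ (-(4 : ℝ) / 2) = ((1 + ‖y‖ ^ 2) ^ 2)⁻¹ := by
        rw [show (-(4 : ℝ) / 2) = -(2 : ℕ) by norm_num, Real.rpow_neg (by positivity),
          Real.rpow_natCast]
      have hd := distSq_nonneg z z'
      rw [h4, ← div_eq_mul_inv, le_div_iff₀ (by positivity), inv_mul_le_iff₀ (by positivity)]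
      have : 1 + ‖y‖ ^ 2 ≤ T ^ 2 * (1 + R * distSq z z') := by nlinarith
      calc (1 + ‖y‖ ^ 2) ^ 2 ≤ (T ^ 2 * (1 + R * distSq z z')) ^ 2 :=
            pow_le_pow_left₀ (by positivity) this 2
        _ = _ := by ring
    calc ‖(time z')⁻¹‖ * (‖a z z'‖ * ‖k R z z'‖)
        ≤ 1 * (A * (C * (T ^ 4 * (1 + ‖y‖ ^ 2) ^ (-(4 : ℝ) / 2)))) := by
          gcongr
          · exact hA z z'
          · exact (hR z z').trans (mul_le_mul_of_nonneg_left e3 hC0)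
      _ = B y := by rw [hB]; ring
  have hcont : ∀ᶠ R : ℝ in atTop, Continuous fun p : Space × Space =>
      (time (p.1 + (√R)⁻¹ • p.2))⁻¹ •
        (a p.1 (p.1 + (√R)⁻¹ • p.2) * k R p.1 (p.1 + (√R)⁻¹ • p.2)) := by
    filter_upwards [hk] with R hR
    have h1 : Continuous fun p : Space × Space => (p.1, p.1 + (√R)⁻¹ • p.2) := by fun_prop
    exact ((continuous_time.comp h1.snd).inv₀ fun p => (time_pos _).ne').smul
      ((ha.comp h1).mul (hR.comp h1))
  have hinner : ∀ z, Tendsto (fun R : ℝ => ∫ y, (time (z + (√R)⁻¹ • y))⁻¹ •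
      (a z (z + (√R)⁻¹ • y) * k R z (z + (√R)⁻¹ • y))) atTop
      (𝓝 (a z z * ∫ y : Space, H (‖y‖ ^ 2))) := by
    intro z
    have hlim : a z z * ∫ y : Space, H (‖y‖ ^ 2)
        = ∫ y, (time z)⁻¹ • (a z z * H (quad z y)) := by
      rw [integral_smul, integral_const_mul, integral_comp_quad, mul_smul_comm, smul_smul,
        inv_mul_cancel₀ (time_pos z).ne', one_smul]
    rw [hlim]
    refine tendsto_integral_filter_of_dominated_convergence
      (fun y => K.indicator (fun _ => (1 : ℝ)) z * B y) ?_ ?_ (hBi.const_mul _) ?_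
    · filter_upwards [hcont] with R hR
      exact (hR.comp (Continuous.prodMk_right z)).aestronglyMeasurable
    · filter_upwards [hbound] with R hR
      exact Eventually.of_forall (hR z)
    · refine Eventually.of_forall fun y => ?_
      have h1 := tendsto_add_smul z y
      have h2 := ((continuous_time.tendsto z).comp h1).inv₀ (time_pos z).ne'
      have h3 : Continuous (a z) := ha.comp (Continuous.prodMk_right z)
      exact h2.smul (((h3.tendsto z).comp h1).mul (hH z y))
  have heq : ∀ᶠ R : ℝ in atTop, ∀ z, √R ^ 3 • ∫ z', a z z' * k R z z' ∂hypMeasure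
      = ∫ y, (time (z + (√R)⁻¹ • y))⁻¹ •
        (a z (z + (√R)⁻¹ • y) * k R z (z + (√R)⁻¹ • y)) := by
    filter_upwards [eventually_gt_atTop 0] with R hR z
    rw [integral_hyp, integral_eq_integral_scaled _ z hR]
  rw [← integral_mul_const]
  have key : Tendsto (fun R : ℝ => ∫ z, ∫ y, (time (z + (√R)⁻¹ • y))⁻¹ •
      (a z (z + (√R)⁻¹ • y) * k R z (z + (√R)⁻¹ • y)) ∂volume ∂hypMeasure) atTop
      (𝓝 (∫ z, (a z z * ∫ y : Space, H (‖y‖ ^ 2)) ∂hypMeasure)) := by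
    refine tendsto_integral_filter_of_dominated_convergence
      (fun z => K.indicator (fun _ => (1 : ℝ)) z * ∫ y, B y) ?_ ?_ ?_
      (Eventually.of_forall hinner)
    · filter_upwards [hcont] with R hR
      exact (hR.stronglyMeasurable.integral_prod_right' (ν := volume)).aestronglyMeasurable
    · filter_upwards [hbound] with R hR
      refine Eventually.of_forall fun z => ?_
      rw [← integral_const_mul]
      exact norm_integral_le_of_norm_le (hBi.const_mul _) (Eventually.of_forall (hR z))
    · refine Integrable.mul_const ?_ _
      exact (integrable_indicator_iff hK.measurableSet).mpr
        (integrableOn_const hK.measure_lt_top.ne)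
  refine key.congr' ?_
  filter_upwards [heq] with R hR
  exact integral_congr_ae (Eventually.of_forall fun z => (hR z).symm)

/-! ### Radial integrals -/

lemma integral_radial {F : Type*} [NormedAddCommGroup F] [NormedSpace ℝ F] (f : ℝ → F) :
    ∫ y : Space, f ‖y‖ = (4 * Real.pi) • ∫ r in Set.Ioi (0 : ℝ), r ^ 2 • f r := by
  rw [integral_fun_norm_addHaar volume f, finrank_euclideanSpace, Fintype.card_fin, Measure.real,
    EuclideanSpace.volume_ball_fin_three, ← Nat.cast_smul_eq_nsmul ℝ, smul_smul]
  congr 1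
  rw [ENNReal.toReal_mul, ENNReal.toReal_ofReal (by positivity)]
  simp
  ring

end

section

lemma ofReal_mul_cpow {r : ℝ} (hr : 0 < r) {z : ℂ} (hz : z ≠ 0) (a : ℂ) :
    ((r : ℂ) * z) ^ a = (r : ℂ) ^ a * z ^ a := by
  have hr' : (r : ℂ) ≠ 0 := by exact_mod_cast hr.ne'
  rw [Complex.cpow_def_of_ne_zero (mul_ne_zero hr' hz), Complex.log_ofReal_mul hr hz,
    Complex.cpow_def_of_ne_zero hr', Complex.cpow_def_of_ne_zero hz, ← Complex.exp_add,
    ← Complex.ofReal_log hr.le, add_mul]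

/-- A primitive of the radial density is a combination of `arctan (κ r / 2)` and
`r / (4 + κ² r²)`. -/
lemma integral_rational {κ : ℝ} (hκ : 0 < κ) :
    ∫ y : Space, 8 * Real.pi / (4 + κ ^ 2 * ‖y‖ ^ 2) ^ 2 = 4 * Real.pi ^ 3 / κ ^ 3 := by
  rw [integral_radial fun r => 8 * Real.pi / (4 + κ ^ 2 * r ^ 2) ^ 2]
  have hd : ∀ r ∈ Set.Ici (0 : ℝ), HasDerivAt (fun r : ℝ => 8 * Real.pi * ((2 * κ ^ 2)⁻¹ *
      ((2 * κ)⁻¹ * Real.arctan (κ / 2 * r) - r / (4 + κ ^ 2 * r ^ 2))))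
      (r ^ 2 • (8 * Real.pi / (4 + κ ^ 2 * r ^ 2) ^ 2)) r := by
    intro r _
    have hp : 0 < 4 + κ ^ 2 * r ^ 2 := by positivity
    have h1 : HasDerivAt (fun r : ℝ => Real.arctan (κ / 2 * r))
        (1 / (1 + (κ / 2 * r) ^ 2) * (κ / 2 * 1)) r :=
      ((hasDerivAt_id r).const_mul (κ / 2)).arctan
    have h2 : HasDerivAt (fun r : ℝ => 4 + κ ^ 2 * r ^ 2) (κ ^ 2 * (2 * r)) r := by
      simpa using ((hasDerivAt_pow 2 r).const_mul (κ ^ 2)).const_add 4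
    have h3 := (hasDerivAt_id r).div h2 hp.ne'
    refine ((((h1.const_mul (2 * κ)⁻¹).sub h3).const_mul (2 * κ ^ 2)⁻¹).const_mul
      (8 * Real.pi)).congr_deriv ?_
    have h4 : 1 + (κ / 2 * r) ^ 2 = (4 + κ ^ 2 * r ^ 2) / 4 := by ring
    rw [h4, smul_eq_mul]
    simp only [id]
    field_simp
    ring
  have hl : Tendsto (fun r : ℝ => 8 * Real.pi * ((2 * κ ^ 2)⁻¹ *
      ((2 * κ)⁻¹ * Real.arctan (κ / 2 * r) - r / (4 + κ ^ 2 * r ^ 2)))) atTop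
      (𝓝 (8 * Real.pi * ((2 * κ ^ 2)⁻¹ * ((2 * κ)⁻¹ * (Real.pi / 2) - 0)))) := by
    have h1 : Tendsto (fun r : ℝ => Real.arctan (κ / 2 * r)) atTop (𝓝 (Real.pi / 2)) :=
      (tendsto_nhds_of_tendsto_nhdsWithin Real.tendsto_arctan_atTop).comp
        (tendsto_id.const_mul_atTop (by positivity))
    have h2 : Tendsto (fun r : ℝ => r / (4 + κ ^ 2 * r ^ 2)) atTop (𝓝 0) := by
      have h3 : Tendsto (fun r : ℝ => (κ ^ 2)⁻¹ * r⁻¹) atTop (𝓝 0) := by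
        simpa using tendsto_inv_atTop_zero.const_mul ((κ ^ 2)⁻¹)
      refine squeeze_zero' ?_ ?_ h3
      · filter_upwards [eventually_gt_atTop 0] with r hr
        positivity
      · filter_upwards [eventually_gt_atTop 0] with r hr
        rw [← mul_inv, div_le_iff₀ (by positivity), inv_mul_eq_div, le_div_iff₀ (by positivity)]
        nlinarith
    exact (((h1.const_mul _).sub h2).const_mul _).const_mul _
  rw [integral_Ioi_of_hasDerivAt_of_nonneg' hd (fun r _ => by positivity) hl]
  simp
  field_simp
  ring

lemma integrableOn_rpow_mul_exp {a d : ℝ} (ha : -1 < a) (hd : 0 < d) :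
    IntegrableOn (fun t : ℝ => t ^ a * Real.exp (-d * t)) (Set.Ioi 0) := by
  simpa using integrableOn_rpow_mul_exp_neg_mul_rpow ha one_pos hd

lemma norm_rpow_mul_cexp {a t : ℝ} (ht : 0 < t) (b : ℂ) :
    ‖((t ^ a : ℝ) : ℂ) * Complex.exp (-(b * t))‖ = t ^ a * Real.exp (-b.re * t) := by
  rw [norm_mul, Complex.norm_real, Complex.norm_exp, Real.norm_eq_abs,
    abs_of_pos (Real.rpow_pos_of_pos ht a)]
  simp

/-- Euler's integral for a complex rate: both sides are analytic in the right half plane and agree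
for real rates. -/
lemma integral_rpow_mul_cexp {a : ℝ} (ha : 0 < a) {b : ℂ} (hb : 0 < b.re) :
    ∫ t in Set.Ioi (0 : ℝ), ((t ^ (a - 1) : ℝ) : ℂ) * Complex.exp (-(b * t))
      = Complex.Gamma a * b ^ (-(a : ℂ)) := by
  have hopen : IsOpen {b : ℂ | 0 < b.re} := isOpen_lt continuous_const Complex.continuous_re
  have hmeas : ∀ (c : ℝ) (b : ℂ), AEStronglyMeasurable
      (fun t : ℝ => ((t ^ c : ℝ) : ℂ) * Complex.exp (-(b * t)))
      (volume.restrict (Set.Ioi 0)) := fun c b => by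
    refine Measurable.aestronglyMeasurable ?_
    fun_prop
  have h1 : DifferentiableOn ℂ (fun b : ℂ => ∫ t in Set.Ioi (0 : ℝ),
      ((t ^ (a - 1) : ℝ) : ℂ) * Complex.exp (-(b * t))) {b | 0 < b.re} := by
    intro b (hb : 0 < b.re)
    refine (HasDerivAt.differentiableAt (f' := ∫ t in Set.Ioi (0 : ℝ),
      -(((t ^ a : ℝ) : ℂ) * Complex.exp (-(b * t)))) ?_).differentiableWithinAt
    refine (hasDerivAt_integral_of_dominated_loc_of_deriv_le (μ := volume.restrict (Set.Ioi 0))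
      (s := {c | b.re / 2 < c.re})
      (F := fun (b : ℂ) (t : ℝ) => ((t ^ (a - 1) : ℝ) : ℂ) * Complex.exp (-(b * t)))
      (F' := fun b t => -(((t ^ a : ℝ) : ℂ) * Complex.exp (-(b * t))))
      (bound := fun t => t ^ a * Real.exp (-(b.re / 2) * t))
      ?_ (Eventually.of_forall fun c => hmeas _ c) ?_ (hmeas _ b).neg ?_ ?_ ?_).2
    · exact (isOpen_lt continuous_const Complex.continuous_re).mem_nhds (half_lt_self hb)
    · refine (integrableOn_rpow_mul_exp (a := a - 1) (by linarith) hb).mono' (hmeas _ b) ?_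
      filter_upwards [ae_restrict_mem measurableSet_Ioi] with t ht
      exact (norm_rpow_mul_cexp ht b).le
    · filter_upwards [ae_restrict_mem measurableSet_Ioi] with t ht c hc
      rw [norm_neg, norm_rpow_mul_cexp ht c]
      have hc' : b.re / 2 < c.re := hc
      have ht' : 0 < t := ht
      have : 0 ≤ t ^ a := (Real.rpow_pos_of_pos ht a).le
      gcongr
    · exact integrableOn_rpow_mul_exp (by linarith) (half_pos hb)
    · filter_upwards [ae_restrict_mem measurableSet_Ioi] with t ht c _
      have h0 : HasDerivAt (fun c : ℂ => -(c * (t : ℂ))) (-(1 * (t : ℂ))) c :=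
        ((hasDerivAt_id c).mul_const (t : ℂ)).neg
      have h := h0.cexp.const_mul ((t ^ (a - 1) : ℝ) : ℂ)
      refine h.congr_deriv ?_
      have ht' : t ^ a = t ^ (a - 1) * t := by
        rw [← Real.rpow_add_one (ne_of_gt ht), sub_add_cancel]
      rw [ht']
      push_cast
      ring
  have h2 : DifferentiableOn ℂ (fun b : ℂ => Complex.Gamma a * b ^ (-(a : ℂ))) {b | 0 < b.re} := by
    intro b hb
    exact ((differentiableAt_id.cpow_const (Or.inl hb)).const_mul _).differentiableWithinAt
  refine (h1.analyticOnNhd hopen).eqOn_of_preconnected_of_frequently_eq (h2.analyticOnNhd hopen)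
    (convex_halfSpace_re_gt 0).isPreconnected (z₀ := 1) (by simp) ?_ hb
  have hfr : ∀ r : ℝ, 0 < r → ∫ t in Set.Ioi (0 : ℝ), ((t ^ (a - 1) : ℝ) : ℂ)
      * Complex.exp (-((r : ℂ) * t)) = Complex.Gamma a * (r : ℂ) ^ (-(a : ℂ)) := by
    intro r hr
    have h := Complex.integral_cpow_mul_exp_neg_mul_Ioi (a := a) (by simpa using ha) hr
    rw [mul_comm, one_div, ← Complex.ofReal_inv, ← Complex.ofReal_cpow (by positivity),
      Real.inv_rpow hr.le, ← Real.rpow_neg hr.le, Complex.ofReal_cpow hr.le,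
      Complex.ofReal_neg] at h
    rw [← h]
    refine setIntegral_congr_fun measurableSet_Ioi fun t ht => ?_
    rw [Complex.ofReal_cpow (le_of_lt ht)]
    push_cast
    rfl
  have ht : Tendsto (fun n : ℕ => ((1 + 1 / ((n : ℝ) + 1) : ℝ) : ℂ)) atTop (𝓝[≠] 1) := by
    refine tendsto_nhdsWithin_iff.mpr ⟨?_, Eventually.of_forall fun n => ?_⟩
    · have := (tendsto_one_div_add_atTop_nhds_zero_nat (𝕜 := ℝ)).const_add 1
      rw [add_zero] at this
      have h := (Complex.continuous_ofReal.tendsto _).comp this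
      rwa [Complex.ofReal_one] at h
    · intro h
      have h' : (1 + 1 / ((n : ℝ) + 1) : ℝ) = 1 :=
        Complex.ofReal_injective (h.trans Complex.ofReal_one.symm)
      have : 0 < 1 / ((n : ℝ) + 1) := by positivity
      linarith
  exact ht.frequently (Frequently.of_forall fun n => hfr _ (by positivity))

/-- The profile `(1 - i s σ/2)^{-5/2}` for a sign `s`. -/
def profile (s σ : ℝ) : ℂ := (1 - Complex.I * s / 2 * σ) ^ ((-(5 / 2) : ℝ) : ℂ)

lemma profile_base_re (s σ : ℝ) : (1 - Complex.I * s / 2 * σ : ℂ).re = 1 := by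
  simp

lemma profile_base_mem (s σ : ℝ) : (1 - Complex.I * s / 2 * σ : ℂ) ∈ Complex.slitPlane :=
  Or.inl (by rw [profile_base_re]; exact one_pos)

lemma continuous_profile (s : ℝ) : Continuous (profile s) := by
  unfold profile
  exact Continuous.cpow (by fun_prop) continuous_const (profile_base_mem s)

lemma norm_profile_le {s : ℝ} (hs : s ^ 2 = 1) {σ : ℝ} (hσ : 0 ≤ σ) :
    ‖profile s σ‖ ≤ 8 * ((1 + σ) ^ 2)⁻¹ := by
  have h : ‖(1 - Complex.I * s / 2 * σ : ℂ)‖ ^ 2 = 1 + σ ^ 2 / 4 := by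
    rw [← Complex.normSq_eq_norm_sq, Complex.normSq_apply]
    simp
    linear_combination σ ^ 2 / 4 * hs
  have h1 : 1 ≤ ‖(1 - Complex.I * s / 2 * σ : ℂ)‖ := by
    refine le_of_sq_le_sq ?_ (norm_nonneg _)
    rw [h]; nlinarith [sq_nonneg σ]
  rw [profile, Complex.norm_cpow_real]
  calc _ ≤ ‖(1 - Complex.I * s / 2 * σ : ℂ)‖ ^ (-(2 : ℕ) : ℝ) :=
        Real.rpow_le_rpow_of_exponent_le h1 (by norm_num)
    _ = (1 + σ ^ 2 / 4)⁻¹ := by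
        rw [Real.rpow_neg (by positivity), Real.rpow_natCast, h]
    _ ≤ _ := by
        rw [← div_eq_mul_inv, le_div_iff₀ (by positivity), inv_mul_le_iff₀ (by positivity)]
        nlinarith [sq_nonneg (σ - 1)]

lemma integrable_profile {s : ℝ} (hs : s ^ 2 = 1) :
    Integrable fun y : Space => profile s (‖y‖ ^ 2) := by
  have h := (integrable_rpow_neg_one_add_norm_sq (E := Space) (r := 4) (μ := volume)
    (by rw [finrank_euclideanSpace, Fintype.card_fin]; norm_num)).const_mul 8
  refine h.mono' ((continuous_profile s).comp (by fun_prop)).aestronglyMeasurable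
    (Eventually.of_forall fun y => (norm_profile_le hs (by positivity)).trans_eq ?_)
  rw [show (-(4 : ℝ) / 2) = -(2 : ℕ) by norm_num, Real.rpow_neg (by positivity), Real.rpow_natCast]

/-- The function `r³/3 (1 - i s r²/2)^{-3/2}` is a primitive of the radial density; the value is its
limit at infinity. -/
lemma integral_profile {s : ℝ} (hs : s ^ 2 = 1) :
    ∫ y : Space, profile s (‖y‖ ^ 2)
      = (4 * Real.pi / 3 : ℝ) * (-(Complex.I * s / 2)) ^ ((-(3 / 2) : ℝ) : ℂ) := by
  have hs0 : s ≠ 0 := by rintro rfl; norm_num at hs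
  rw [integral_radial fun r => profile s (r ^ 2)]
  have hint : IntegrableOn (fun r : ℝ => r ^ 2 • profile s (r ^ 2)) (Set.Ioi 0) := by
    have h := (integrable_fun_norm_addHaar (volume : Measure Space)
      (f := fun r => profile s (r ^ 2))).mp (integrable_profile hs)
    simpa using h
  have hd : ∀ r ∈ Set.Ici (0 : ℝ), HasDerivAt (fun r : ℝ => ((r : ℂ) ^ 3 / 3) *
      (1 - Complex.I * s / 2 * (r ^ 2 : ℝ)) ^ ((-(3 / 2) : ℝ) : ℂ))
      (r ^ 2 • profile s (r ^ 2)) r := by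
    intro r _
    have hm := profile_base_mem s (r ^ 2)
    have h0 : (1 - Complex.I * s / 2 * (r ^ 2 : ℝ) : ℂ) ≠ 0 := Complex.slitPlane_ne_zero hm
    have h1 : HasDerivAt (fun r : ℂ => r ^ 3 / 3) ((3 * (r : ℂ) ^ 2) / 3) (r : ℂ) := by
      simpa using (hasDerivAt_pow 3 (r : ℂ)).div_const 3
    have h2 : HasDerivAt (fun r : ℂ => 1 - Complex.I * s / 2 * r ^ 2)
        (-(Complex.I * s / 2 * (2 * (r : ℂ)))) (r : ℂ) := by
      simpa using ((hasDerivAt_pow 2 (r : ℂ)).const_mul (Complex.I * s / 2)).const_sub 1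
    have h3 := h2.cpow_const (c := ((-(3 / 2) : ℝ) : ℂ)) (by push_cast at hm; exact hm)
    have h4 := (h1.mul h3).comp_ofReal
    push_cast at h4 ⊢
    refine h4.congr_deriv ?_
    have e : (1 - Complex.I * s / 2 * (r : ℂ) ^ 2) ^ (-(3 / 2) : ℂ)
        = (1 - Complex.I * s / 2 * (r : ℂ) ^ 2) ^ (-(5 / 2) : ℂ)
          * (1 - Complex.I * s / 2 * (r : ℂ) ^ 2) := by
      push_cast at h0
      nth_rewrite 3 [← Complex.cpow_one (1 - Complex.I * s / 2 * (r : ℂ) ^ 2)]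
      rw [← Complex.cpow_add _ _ h0]; norm_num
    have e2 : (-(3 / 2) - 1 : ℂ) = -(5 / 2) := by norm_num
    rw [e2, e, profile]
    push_cast
    rw [Complex.real_smul]
    push_cast
    ring
  have hl : Tendsto (fun r : ℝ => ((r : ℂ) ^ 3 / 3) *
      (1 - Complex.I * s / 2 * (r ^ 2 : ℝ)) ^ ((-(3 / 2) : ℝ) : ℂ)) atTop
      (𝓝 (1 / 3 * (0 - Complex.I * s / 2) ^ ((-(3 / 2) : ℝ) : ℂ))) := by
    have hc : (0 - Complex.I * s / 2 : ℂ) ∈ Complex.slitPlane := by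
      refine Or.inr ?_
      simp [hs0]
    have h1 : Tendsto (fun r : ℝ => (((r ^ 2)⁻¹ : ℝ) : ℂ) - Complex.I * s / 2) atTop
        (𝓝 (0 - Complex.I * s / 2)) := by
      refine Tendsto.sub_const ?_ _
      have : Tendsto (fun r : ℝ => (r ^ 2)⁻¹) atTop (𝓝 0) :=
        tendsto_inv_atTop_zero.comp (tendsto_pow_atTop two_ne_zero)
      exact (Complex.continuous_ofReal.tendsto 0).comp this
    have h2 := ((continuousAt_cpow_const (b := ((-(3 / 2) : ℝ) : ℂ)) hc).tendsto.comp
      h1).const_mul (1 / 3)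
    refine h2.congr' ?_
    filter_upwards [eventually_gt_atTop 0] with r hr
    have e : (1 - Complex.I * s / 2 * (r ^ 2 : ℝ) : ℂ)
        = (r ^ 2 : ℝ) * ((((r ^ 2)⁻¹ : ℝ) : ℂ) - Complex.I * s / 2) := by
      rw [mul_sub, ← Complex.ofReal_mul, mul_inv_cancel₀ (by positivity)]
      push_cast; ring
    have h0 : (((r ^ 2)⁻¹ : ℝ) : ℂ) - Complex.I * s / 2 ≠ 0 := by
      intro h
      rw [h, mul_zero] at e
      exact Complex.slitPlane_ne_zero (profile_base_mem s (r ^ 2)) e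
    have e2 : ((r ^ 2 : ℝ) : ℂ) ^ ((-(3 / 2) : ℝ) : ℂ) = ((r : ℂ) ^ 3)⁻¹ := by
      rw [← Complex.ofReal_cpow (by positivity), ← Complex.ofReal_pow, ← Complex.ofReal_inv]
      congr 1
      rw [← Real.rpow_natCast, ← Real.rpow_mul hr.le, ← Real.rpow_natCast, ← Real.rpow_neg hr.le]
      norm_num
    have hr' : (r : ℂ) ^ 3 ≠ 0 := by exact_mod_cast (pow_pos hr 3).ne'
    simp only [Function.comp]
    rw [e, ofReal_mul_cpow (by positivity) h0, e2, ← mul_assoc]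
    congr 1
    rw [div_mul_eq_mul_div, mul_inv_cancel₀ hr']
  rw [integral_Ioi_of_hasDerivAt_of_tendsto' hd hint hl, Complex.real_smul]
  push_cast
  ring_nf

/-- The phase `e^{3πis/4}` computed here is compensated by the prefactor `i G_{κ+π/4}` of `T`. -/
lemma integral_profile_eq {s : ℝ} (hs : s = 1 ∨ s = -1) :
    (Complex.Gamma (5 / 2)) * ∫ y : Space, profile s (‖y‖ ^ 2)
      = ((2 * Real.pi) ^ (3 / 2 : ℝ) : ℝ) * Complex.exp (Complex.I * s * (3 * Real.pi / 4)) := by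
  have hs2 : s ^ 2 = 1 := by rcases hs with rfl | rfl <;> norm_num
  have hG : Complex.Gamma (5 / 2) = ((3 / 4 * √Real.pi : ℝ) : ℂ) := by
    have h : Real.Gamma (5 / 2) = 3 / 4 * √Real.pi := by
      rw [show (5 / 2 : ℝ) = 1 / 2 + 1 + 1 by norm_num, Real.Gamma_add_one (by norm_num),
        Real.Gamma_add_one (by norm_num), Real.Gamma_one_half_eq]
      ring
    rw [← h, ← Complex.Gamma_ofReal]
    norm_num
  have hlog : (-(Complex.I * s / 2)) ^ ((-(3 / 2) : ℝ) : ℂ)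
      = (2 ^ (3 / 2 : ℝ) : ℝ) * Complex.exp (Complex.I * s * (3 * Real.pi / 4)) := by
    have e : -(Complex.I * s / 2) = ((1 / 2 : ℝ) : ℂ) * (-(s * Complex.I)) := by push_cast; ring
    have h0 : -(s * Complex.I) ≠ 0 := by
      rcases hs with rfl | rfl <;> simp
    rw [e, ofReal_mul_cpow (by norm_num) h0, ← Complex.ofReal_cpow (by norm_num)]
    congr 1
    · congr 1
      rw [one_div, Real.inv_rpow (by norm_num), Real.rpow_neg (by norm_num), inv_inv]
    · rw [Complex.cpow_def_of_ne_zero h0]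
      congr 1
      rcases hs with rfl | rfl
      · simp [Complex.log_neg_I]; ring
      · simp [Complex.log_I]; ring
  have hπ : (2 * Real.pi) ^ (3 / 2 : ℝ)
      = 3 / 4 * √Real.pi * (4 * Real.pi / 3) * 2 ^ (3 / 2 : ℝ) := by
    rw [Real.mul_rpow (by norm_num) Real.pi_pos.le,
      show (3 / 2 : ℝ) = 1 + 1 / 2 by norm_num, Real.rpow_add Real.pi_pos, Real.rpow_one,
      ← Real.sqrt_eq_rpow]
    ring
  rw [integral_profile hs2, hG, hlog, hπ]
  push_cast
  ring

end

section

/-! ### Plane waves with a complex wave vector -/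

/-- The product `w·u` of a complex four-vector with a point of the hyperboloid. -/
def cdot (w : Fin 4 → ℂ) (u : Space) : ℂ := ∑ a, (sgn a : ℂ) * w a * pt u a

/-- The complex Minkowski square `w·w`. -/
def csq (w : Fin 4 → ℂ) : ℂ := ∑ a, (sgn a : ℂ) * w a * w a

lemma cdot_eq (w : Fin 4 → ℂ) (u : Space) :
    cdot w u = w 0 * time u - ∑ j : Fin 3, w j.succ * u j := by
  simp [cdot, Fin.sum_univ_four, Fin.sum_univ_three, sgn, pt]
  ring

lemma cdot_ofReal (v : Fin 4 → ℝ) (u : Space) : cdot (fun a => (v a : ℂ)) u = mdot v (pt u) := by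
  simp [cdot, mdot]

lemma continuous_pt (a : Fin 4) : Continuous fun u => pt u a := (contDiff_pt (n := 0) a).continuous

lemma continuous_cdot (w : Fin 4 → ℂ) : Continuous (cdot w) := by
  have := continuous_pt
  unfold cdot; fun_prop

lemma hasFDerivAt_time (z : Space) :
    HasFDerivAt time ((time z)⁻¹ • innerSL ℝ z) z := by
  have h1 : HasFDerivAt (fun z : Space => 1 + ‖z‖ ^ 2) (2 • innerSL ℝ z) z :=
    (hasStrictFDerivAt_norm_sq z).hasFDerivAt.const_add 1
  have h2 := h1.sqrt (by positivity)
  refine h2.congr_fderiv ?_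
  ext v
  simp [time]
  field_simp

lemma hasFDerivAt_cexp_cdot (w : Fin 4 → ℂ) (z : Space) :
    ∃ L : Space →L[ℝ] ℂ, HasFDerivAt (fun z => Complex.exp (-cdot w z)) L z ∧
      ∀ j : Fin 3, L (EuclideanSpace.single j 1)
        = (w j.succ - w 0 * (z j / time z : ℝ)) * Complex.exp (-cdot w z) := by
  have hp : ∀ j : Fin 3, HasFDerivAt (fun z : Space => (z j : ℂ))
      (Complex.ofRealCLM ∘L (EuclideanSpace.proj j : Space →L[ℝ] ℝ)) z := fun j =>
    Complex.ofRealCLM.hasFDerivAt.comp z (EuclideanSpace.proj j : Space →L[ℝ] ℝ).hasFDerivAt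
  have ht : HasFDerivAt (fun z : Space => (time z : ℂ))
      (Complex.ofRealCLM ∘L ((time z)⁻¹ • innerSL ℝ z)) z :=
    Complex.ofRealCLM.hasFDerivAt.comp z (hasFDerivAt_time z)
  have h := ((ht.const_mul (w 0)).sub
    (HasFDerivAt.fun_sum fun j (_ : j ∈ Finset.univ) => (hp j).const_mul (w j.succ))).neg.cexp
  refine ⟨_, h.congr_of_eventuallyEq (Eventually.of_forall fun y => by simp [cdot_eq]), fun j => ?_⟩
  simp [cdot_eq, EuclideanSpace.inner_single_right, apply_ite Complex.ofReal]
  ring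

lemma differentiable_cexp_cdot (w : Fin 4 → ℂ) :
    Differentiable ℝ fun z => Complex.exp (-cdot w z) := fun z =>
  (hasFDerivAt_cexp_cdot w z).choose_spec.1.differentiableAt

lemma fderiv_cexp_cdot (w : Fin 4 → ℂ) (z : Space) (j : Fin 3) :
    fderiv ℝ (fun z => Complex.exp (-cdot w z)) z (EuclideanSpace.single j 1)
      = (w j.succ - w 0 * (z j / time z : ℝ)) * Complex.exp (-cdot w z) := by
  obtain ⟨L, h1, h2⟩ := hasFDerivAt_cexp_cdot w z
  rw [h1.fderiv, h2]

/-- `w` lies in the forward tube, with an explicit lower bound. -/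
def InTube (w : Fin 4 → ℂ) (c : ℝ) : Prop := 0 < c ∧ ∀ u, c * time u ≤ (cdot w u).re

lemma norm_cexp_cdot_le {w : Fin 4 → ℂ} {c : ℝ} (h : InTube w c) (u : Space) :
    ‖Complex.exp (-cdot w u)‖ ≤ Real.exp (-c * time u) := by
  rw [Complex.norm_exp, Real.exp_le_exp, Complex.neg_re]
  linarith [h.2 u]

lemma time_zero : time 0 = 1 := by simp [time]

lemma InTube.ne_zero {w : Fin 4 → ℂ} {c : ℝ} (h : InTube w c) : w 0 ≠ 0 := by
  intro h0
  have h1 := h.2 0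
  rw [cdot_eq, h0, time_zero] at h1
  simp at h1
  linarith [h.1]

lemma integrable_time_pow_mul_exp (n : ℕ) {c : ℝ} (hc : 0 < c) :
    Integrable fun u : Space => time u ^ n * Real.exp (-c * time u) := by
  have h := (integrable_rpow_neg_one_add_norm_sq (E := Space) (r := 4) (μ := volume)
    (by rw [finrank_euclideanSpace, Fintype.card_fin]; norm_num)).const_mul
    ((n + 4).factorial / c ^ (n + 4))
  have hcont : Continuous fun u : Space => time u ^ n * Real.exp (-c * time u) := by
    have := continuous_time
    fun_prop
  refine h.mono' hcont.aestronglyMeasurable (Eventually.of_forall fun u => ?_)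
  have ht := time_pos u
  rw [Real.norm_eq_abs, abs_of_pos (by positivity), ← time_sq,
    show (-(4 : ℝ) / 2) = -(2 : ℕ) by norm_num, Real.rpow_neg (by positivity), Real.rpow_natCast]
  have h1 := Real.pow_div_factorial_le_exp (x := c * time u) (by positivity) (n + 4)
  rw [neg_mul, Real.exp_neg, ← div_eq_mul_inv, div_le_iff₀ (Real.exp_pos _)]
  rw [div_le_iff₀ (by positivity)] at h1
  rw [← div_eq_mul_inv, div_div, div_mul_eq_mul_div, le_div_iff₀ (by positivity)]
  calc time u ^ n * (c ^ (n + 4) * (time u ^ 2) ^ 2) = (c * time u) ^ (n + 4) := by ring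
    _ ≤ _ := h1
    _ = _ := by ring

lemma integrable_hyp_of_integrable {E : Type*} [NormedAddCommGroup E] [NormedSpace ℝ E]
    {f : Space → E} (hf : Integrable f) : Integrable f hypMeasure := by
  rw [integrable_hyp]
  have hc : Continuous fun z => (time z)⁻¹ := continuous_time.inv₀ fun z => (time_pos z).ne'
  refine hf.norm.mono' (hc.aestronglyMeasurable.smul hf.1) (Eventually.of_forall fun z => ?_)
  rw [norm_smul, norm_inv, Real.norm_eq_abs, abs_of_pos (time_pos z)]
  exact mul_le_of_le_one_left (norm_nonneg _) (inv_le_one_of_one_le₀ (one_le_time z))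

/-- A continuous function dominated by `(u⁰)ⁿ e^{-c u⁰}` is integrable for both measures. -/
lemma integrable_of_le_exp {μ : Measure Space} (hμ : μ = volume ∨ μ = hypMeasure) {E : Type*}
    [NormedAddCommGroup E] {f : Space → E} (hf : Continuous f) {C c : ℝ} (n : ℕ) (hc : 0 < c)
    (h : ∀ u, ‖f u‖ ≤ C * (time u ^ n * Real.exp (-c * time u))) : Integrable f μ := by
  have hi := (integrable_time_pow_mul_exp n hc).const_mul C
  rcases hμ with rfl | rfl
  · exact hi.mono' hf.aestronglyMeasurable (Eventually.of_forall h)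
  · exact (integrable_hyp_of_integrable hi).mono' hf.aestronglyMeasurable (Eventually.of_forall h)

/-- The Laplace transform `∫ e^{-w·u} dμ(u)` of the invariant measure. -/
def laplace (w : Fin 4 → ℂ) : ℂ := ∫ u, Complex.exp (-cdot w u) ∂hypMeasure

/-- Its first moments `∫ uᵃ e^{-w·u} dμ(u)`. -/
def moment (w : Fin 4 → ℂ) (a : Fin 4) : ℂ := ∫ u, pt u a * Complex.exp (-cdot w u) ∂hypMeasure

lemma continuous_cexp_cdot (w : Fin 4 → ℂ) : Continuous fun u => Complex.exp (-cdot w u) :=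
  Complex.continuous_exp.comp (continuous_cdot w).neg

lemma integrable_cexp_cdot {w : Fin 4 → ℂ} {c : ℝ} (h : InTube w c) :
    Integrable (fun u => Complex.exp (-cdot w u)) :=
  integrable_of_le_exp (Or.inl rfl) (continuous_cexp_cdot w) (C := 1) 0 h.1 fun u => by
    simpa using norm_cexp_cdot_le h u

lemma integrable_pt_mul_cexp_cdot {w : Fin 4 → ℂ} {c : ℝ} (h : InTube w c) (a : Fin 4) :
    Integrable (fun u => (pt u a : ℂ) * Complex.exp (-cdot w u)) hypMeasure := by
  refine integrable_of_le_exp (Or.inr rfl)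
    ((Complex.continuous_ofReal.comp (continuous_pt a)).mul (continuous_cexp_cdot w))
    (C := 1) 1 h.1 fun u => ?_
  rw [norm_mul, one_mul, pow_one, Complex.norm_real]
  exact mul_le_mul (norm_pt_le u a) (norm_cexp_cdot_le h u) (norm_nonneg _) (time_pos u).le

lemma moment_zero_eq (w : Fin 4 → ℂ) : moment w 0 = ∫ u, Complex.exp (-cdot w u) := by
  rw [moment, integral_hyp]
  refine integral_congr_ae (Eventually.of_forall fun u => ?_)
  have : (time u : ℂ) ≠ 0 := by exact_mod_cast (time_pos u).ne'
  simp only [pt, Matrix.cons_val_zero, Complex.real_smul, Complex.ofReal_inv]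
  field_simp

/-- Lorentz invariance: the vector of first moments is proportional to `w`, because the integral of
the total derivative `∂_j e^{-w·u}` with respect to `d³u` vanishes. -/
lemma moment_eq {w : Fin 4 → ℂ} {c : ℝ} (h : InTube w c) (a : Fin 4) :
    moment w a = moment w 0 / w 0 * w a := by
  have h0 := h.ne_zero
  refine Fin.cases ?_ (fun j => ?_) a
  · field_simp
  have hi := integrable_cexp_cdot h
  have hj : Integrable fun u : Space => ((u j / time u : ℝ) : ℂ) * Complex.exp (-cdot w u) := by
    refine hi.bdd_mul (c := 1) ?_ (Eventually.of_forall fun u => ?_)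
    · have hc : Continuous fun u : Space => u j / time u :=
        Continuous.div (by fun_prop) continuous_time fun u => (time_pos u).ne'
      exact (Complex.continuous_ofReal.comp hc).aestronglyMeasurable
    · rw [Complex.norm_real, norm_div, Real.norm_eq_abs (time u), abs_of_pos (time_pos u)]
      exact div_le_one_of_le₀ ((PiLp.norm_apply_le u j).trans (norm_lt_time u).le)
        (time_pos u).le
  have hd : Integrable fun u : Space =>
      (w j.succ - w 0 * (u j / time u : ℝ)) * Complex.exp (-cdot w u) := by
    refine ((hi.const_mul (w j.succ)).sub (hj.const_mul (w 0))).congr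
      (Eventually.of_forall fun u => ?_)
    simp only [Pi.sub_apply]
    ring
  have key := integral_mul_fderiv_eq_neg_fderiv_mul_of_integrable (μ := (volume : Measure Space))
    (f := fun _ => (1 : ℂ)) (g := fun u => Complex.exp (-cdot w u))
    (v := EuclideanSpace.single j 1) (by simp) (by simpa only [fderiv_cexp_cdot, one_mul] using hd)
    (by simpa only [one_mul] using hi) (fun _ _ => differentiableAt_const _)
    (fun u _ => differentiable_cexp_cdot w u)
  simp only [fderiv_cexp_cdot, one_mul, fderiv_fun_const, Pi.zero_apply,
    zero_apply, zero_mul, integral_zero, neg_zero] at key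
  have e : ∀ u : Space, (w j.succ - w 0 * (u j / time u : ℝ)) * Complex.exp (-cdot w u)
      = w j.succ * Complex.exp (-cdot w u)
        - w 0 * (((u j / time u : ℝ) : ℂ) * Complex.exp (-cdot w u)) := fun u => by ring
  simp only [e] at key
  rw [integral_sub (hi.const_mul _) (hj.const_mul _), integral_const_mul, integral_const_mul,
    ← moment_zero_eq] at key
  have e2 : ∫ u : Space, ((u j / time u : ℝ) : ℂ) * Complex.exp (-cdot w u) = moment w j.succ := by
    rw [moment, integral_hyp]
    refine integral_congr_ae (Eventually.of_forall fun u => ?_)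
    have : pt u j.succ = u j := by fin_cases j <;> rfl
    simp only [this, Complex.real_smul]
    push_cast
    ring
  rw [e2] at key
  field_simp
  linear_combination -key

lemma norm_cdot_le (w : Fin 4 → ℂ) (u : Space) : ‖cdot w u‖ ≤ (∑ a, ‖w a‖) * time u := by
  rw [cdot, Finset.sum_mul]
  refine (norm_sum_le _ _).trans (Finset.sum_le_sum fun a _ => ?_)
  rw [norm_mul, norm_mul, Complex.norm_real, Complex.norm_real, Real.norm_eq_abs, abs_sgn, one_mul]
  exact mul_le_mul_of_nonneg_left (norm_pt_le u a) (norm_nonneg _)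

/-- Differentiation under the integral sign along a path in the tube. -/
lemma hasDerivAt_laplace {w : ℝ → Fin 4 → ℂ} (hw : ∀ a, ContDiff ℝ 1 fun t => w t a)
    {c : ℝ → ℝ} (hc : Continuous c) (ht : ∀ t, InTube (w t) (c t)) (t₀ : ℝ) :
    HasDerivAt (fun t => laplace (w t))
      (-(∑ a, (sgn a : ℂ) * deriv (fun t => w t a) t₀ * moment (w t₀) a)) t₀ := by
  set w' : ℝ → Fin 4 → ℂ := fun t a => deriv (fun t => w t a) t with hw'
  have hw'c : ∀ a, Continuous fun t => w' t a := fun a => (hw a).continuous_deriv le_rfl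
  have hwd : ∀ t a, HasDerivAt (fun t => w t a) (w' t a) t := fun t a =>
    (((hw a).differentiable one_ne_zero) t).hasDerivAt
  have hcd : ∀ t u, HasDerivAt (fun t => Complex.exp (-cdot (w t) u))
      (-(cdot (w' t) u * Complex.exp (-cdot (w t) u))) t := by
    intro t u
    have h1 : HasDerivAt (fun t => cdot (w t) u) (cdot (w' t) u) t := by
      unfold cdot
      exact HasDerivAt.fun_sum fun a _ => ((hwd t a).const_mul _).mul_const _
    exact h1.fun_neg.cexp.congr_deriv (by ring)
  have hsum : Continuous fun t => ∑ a, ‖w' t a‖ := by fun_prop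
  set B := ∑ a, ‖w' t₀ a‖ + 1 with hB
  have hs : {t | ∑ a, ‖w' t a‖ < B ∧ c t₀ / 2 < c t} ∈ 𝓝 t₀ := by
    refine ((isOpen_lt hsum continuous_const).inter
      (isOpen_lt continuous_const hc)).mem_nhds ⟨?_, half_lt_self (ht t₀).1⟩
    change ∑ a, ‖w' t₀ a‖ < B
    exact lt_add_one _
  have hmeas : ∀ t, Continuous fun u => cdot (w' t) u * Complex.exp (-cdot (w t) u) := fun t =>
    (continuous_cdot _).mul (continuous_cexp_cdot _)
  have key := (hasDerivAt_integral_of_dominated_loc_of_deriv_le (μ := hypMeasure) hs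
    (F := fun t u => Complex.exp (-cdot (w t) u))
    (F' := fun t u => -(cdot (w' t) u * Complex.exp (-cdot (w t) u)))
    (bound := fun u => B * (time u ^ 1 * Real.exp (-(c t₀ / 2) * time u)))
    (Eventually.of_forall fun t => (continuous_cexp_cdot _).aestronglyMeasurable)
    (integrable_hyp_of_integrable (integrable_cexp_cdot (ht t₀)))
    (hmeas t₀).neg.aestronglyMeasurable
    (Eventually.of_forall fun u t ht' => ?_)
    ((integrable_hyp_of_integrable
      (integrable_time_pow_mul_exp 1 (half_pos (ht t₀).1))).const_mul _)
    (Eventually.of_forall fun u t _ => hcd t u)).2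
  · refine key.congr_deriv ?_
    rw [integral_neg]
    congr 1
    simp only [cdot, Finset.sum_mul]
    rw [integral_finsetSum]
    · refine Finset.sum_congr rfl fun a _ => ?_
      rw [moment, ← integral_const_mul]
      refine integral_congr_ae (Eventually.of_forall fun u => ?_)
      simp only [hw', cdot]
      ring
    · intro a _
      refine ((integrable_pt_mul_cexp_cdot (ht t₀) a).const_mul
        ((sgn a : ℂ) * w' t₀ a)).congr (Eventually.of_forall fun u => ?_)
      simp only [cdot]
      ring
  · obtain ⟨h1, h2⟩ := ht'
    rw [norm_neg, norm_mul, pow_one, ← mul_assoc]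
    have hτ := time_pos u
    refine mul_le_mul ((norm_cdot_le _ u).trans ?_) ((norm_cexp_cdot_le (ht t) u).trans ?_)
      (norm_nonneg _) ?_
    · exact mul_le_mul_of_nonneg_right h1.le hτ.le
    · rw [Real.exp_le_exp]; nlinarith
    · have : 0 ≤ ∑ a, ‖w' t₀ a‖ := by positivity
      positivity

/-- The Laplace transform does not change along paths in the tube on which `w·w` is constant. -/
lemma laplace_eq_of_path {w : ℝ → Fin 4 → ℂ} (hw : ∀ a, ContDiff ℝ 1 fun t => w t a)
    {c : ℝ → ℝ} (hc : Continuous c) (ht : ∀ t, InTube (w t) (c t)) {q : ℂ}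
    (hq : ∀ t, csq (w t) = q) (s t : ℝ) : laplace (w s) = laplace (w t) := by
  refine is_const_of_deriv_eq_zero
    (fun t => (hasDerivAt_laplace hw hc ht t).differentiableAt) (fun t => ?_) s t
  rw [(hasDerivAt_laplace hw hc ht t).deriv, neg_eq_zero]
  have hd : ∀ a, HasDerivAt (fun t => w t a) (deriv (fun t => w t a) t) t := fun a =>
    (((hw a).differentiable one_ne_zero) t).hasDerivAt
  have h1 : HasDerivAt (fun t => csq (w t))
      (∑ a, ((sgn a : ℂ) * deriv (fun t => w t a) t * w t a
        + (sgn a : ℂ) * w t a * deriv (fun t => w t a) t)) t := by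
    unfold csq
    exact HasDerivAt.fun_sum fun a _ => ((hd a).const_mul _).mul (hd a)
  have h2 : HasDerivAt (fun t => csq (w t)) 0 t := by
    simp only [hq]; exact hasDerivAt_const _ _
  have h3 := h1.unique h2
  calc _ = ∑ a, (sgn a : ℂ) * deriv (fun t => w t a) t
          * (moment (w t) 0 / w t 0 * w t a) :=
        Finset.sum_congr rfl fun a _ => by rw [← moment_eq (ht t)]
    _ = moment (w t) 0 / w t 0 / 2 * ∑ a, ((sgn a : ℂ) * deriv (fun t => w t a) t * w t a
        + (sgn a : ℂ) * w t a * deriv (fun t => w t a) t) := by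
        rw [Finset.mul_sum]
        exact Finset.sum_congr rfl fun a _ => by ring
    _ = 0 := by rw [h3, mul_zero]

/-- The time-like vector `(r, 0, 0, 0)`. -/
def timeVec (r : ℝ) : Fin 4 → ℂ := fun a => (r * pt 0 a : ℝ)

lemma csq_ofReal_smul_pt (r : ℝ) (y : Space) : csq (fun a => (r * pt y a : ℝ)) = (r ^ 2 : ℝ) := by
  have h := mdot_pt y
  calc csq (fun a => (r * pt y a : ℝ)) = ((r ^ 2 * mdot (pt y) (pt y) : ℝ) : ℂ) := by
        simp only [csq, mdot]
        push_cast
        rw [Finset.mul_sum]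
        exact Finset.sum_congr rfl fun a _ => by ring
    _ = _ := by rw [h, mul_one]

lemma mdot_smul_left (r : ℝ) (v w : Fin 4 → ℝ) : mdot (fun a => r * v a) w = r * mdot v w := by
  simp only [mdot, Finset.mul_sum]
  exact Finset.sum_congr rfl fun a _ => by ring

lemma inTube_smul_pt {r : ℝ} (hr : 0 < r) (y : Space) :
    InTube (fun a => (r * pt y a : ℝ)) (r * (time y - ‖y‖)) := by
  refine ⟨mul_pos hr (sub_pos.mpr (norm_lt_time y)), fun u => ?_⟩
  rw [cdot_ofReal fun a => r * pt y a, Complex.ofReal_re, mdot_smul_left, mdot_comm, mul_assoc]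
  exact mul_le_mul_of_nonneg_left (le_mdot_pt u y) hr.le

/-- The path runs through the hyperboloid of radius `r`, from the direction of `y` to the axis. -/
lemma laplace_smul_pt {r : ℝ} (hr : 0 < r) (y : Space) :
    laplace (fun a => (r * pt y a : ℝ)) = laplace (timeVec r) := by
  have h := laplace_eq_of_path (w := fun t a => (r * pt (t • y) a : ℝ))
    (fun a => Complex.ofRealCLM.contDiff.comp (contDiff_const.mul
      ((contDiff_pt a).comp (contDiff_id.smul contDiff_const))))
    (c := fun t => r * (time (t • y) - ‖t • y‖))
    (by have := continuous_time; fun_prop) (fun t => inTube_smul_pt hr _)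
    (fun t => csq_ofReal_smul_pt r _) 1 0
  simp only [one_smul, zero_smul] at h
  exact h

end

section

/-! ### The Laplace transform for the sum of two points of the hyperboloid -/

/-- The complex four-vector `(A - iB) z + (A + iB) z'`. -/
def pairVec (A B : ℝ) (z z' : Space) : Fin 4 → ℂ := fun a =>
  A * (pt z a + pt z' a) + Complex.I * (B * (pt z' a - pt z a))

lemma cdot_pairVec (A B : ℝ) (z z' u : Space) : cdot (pairVec A B z z') u
    = A * (mdot (pt z) (pt u) + mdot (pt z') (pt u))
      + Complex.I * (B * (mdot (pt z') (pt u) - mdot (pt z) (pt u))) := by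
  simp only [cdot, pairVec, mdot, Fin.sum_univ_four]
  push_cast
  ring

lemma csq_pairVec (A B : ℝ) (z z' : Space) : csq (pairVec A B z z')
    = (A ^ 2 * (4 + distSq z z') + B ^ 2 * distSq z z' : ℝ) := by
  have h1 := mdot_pt z
  have h2 := mdot_pt z'
  have h3 := mdot_pt_eq_distSq z z'
  have e : csq (pairVec A B z z') = ((A ^ 2 * (mdot (pt z) (pt z) + 2 * mdot (pt z) (pt z')
      + mdot (pt z') (pt z')) - B ^ 2 * (mdot (pt z) (pt z) - 2 * mdot (pt z) (pt z')
      + mdot (pt z') (pt z')) : ℝ) : ℂ)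
      + Complex.I * (2 * A * B * ((mdot (pt z') (pt z') - mdot (pt z) (pt z) : ℝ) : ℂ)) := by
    simp only [csq, pairVec, mdot, Fin.sum_univ_four]
    push_cast
    linear_combination ((sgn 0 : ℂ) * (B * (pt z' 0 - pt z 0)) ^ 2
      + (sgn 1 : ℂ) * (B * (pt z' 1 - pt z 1)) ^ 2 + (sgn 2 : ℂ) * (B * (pt z' 2 - pt z 2)) ^ 2
      + (sgn 3 : ℂ) * (B * (pt z' 3 - pt z 3)) ^ 2) * Complex.I_sq
  rw [e, h1, h2, h3]
  push_cast
  ring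

lemma inTube_pairVec {A : ℝ} (hA : 0 < A) (B : ℝ) (z z' : Space) :
    InTube (pairVec A B z z') (A * ((time z - ‖z‖) + (time z' - ‖z'‖))) := by
  have h1 := norm_lt_time z
  have h2 := norm_lt_time z'
  refine ⟨mul_pos hA (by linarith), fun u => ?_⟩
  have e : (cdot (pairVec A B z z') u).re = A * (mdot (pt z) (pt u) + mdot (pt z') (pt u)) := by
    rw [cdot_pairVec]; simp [← Complex.ofReal_add, ← Complex.ofReal_sub]
  rw [e, mul_assoc]
  refine mul_le_mul_of_nonneg_left ?_ hA.le
  have h3 := le_mdot_pt u z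
  have h4 := le_mdot_pt u z'
  rw [mdot_comm (pt z), mdot_comm (pt z')]
  linarith

/-- The invariant length `√(w·w)` of `pairVec ε κ z z'`. -/
def pairLen (ε κ : ℝ) (z z' : Space) : ℝ :=
  √(ε ^ 2 * (4 + distSq z z') + κ ^ 2 * distSq z z')

lemma pairLen_sq (ε κ : ℝ) (z z' : Space) :
    pairLen ε κ z z' ^ 2 = ε ^ 2 * (4 + distSq z z') + κ ^ 2 * distSq z z' := by
  have := distSq_nonneg z z'
  exact Real.sq_sqrt (by positivity)

lemma pairLen_pos {ε : ℝ} (hε : 0 < ε) (κ : ℝ) (z z' : Space) : 0 < pairLen ε κ z z' := by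
  have := distSq_nonneg z z'
  exact Real.sqrt_pos.mpr (by positivity)

/-- The Laplace transform at `pairVec` is its value at the time-like vector of the same invariant
length. -/
lemma laplace_pairVec {ε : ℝ} (hε : 0 < ε) (κ : ℝ) (z z' : Space) :
    laplace (pairVec ε κ z z') = laplace (timeVec (pairLen ε κ z z')) := by
  have hρ := distSq_nonneg z z'
  set ρ := distSq z z' with hρ'
  have hz := norm_lt_time z
  have hz' := norm_lt_time z'
  have hpos : ∀ t, 0 < ε ^ 2 + κ ^ 2 * ρ * Real.cos t ^ 2 / (4 + ρ) := fun t => by positivity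
  set A : ℝ → ℝ := fun t => √(ε ^ 2 + κ ^ 2 * ρ * Real.cos t ^ 2 / (4 + ρ)) with hA
  have hAc : ContDiff ℝ 1 A := by
    refine ContDiff.sqrt ?_ fun t => (hpos t).ne'
    exact contDiff_const.add ((contDiff_const.mul (Real.contDiff_cos.pow 2)).div_const _)
  have hA0 : ∀ t, 0 < A t := fun t => Real.sqrt_pos.mpr (hpos t)
  have hAsq : ∀ t, A t ^ 2 = ε ^ 2 + κ ^ 2 * ρ * Real.cos t ^ 2 / (4 + ρ) := fun t =>
    Real.sq_sqrt (hpos t).le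
  -- a rotation in the plane of `z + z'` and `i (z' - z)` makes the vector real
  have h := laplace_eq_of_path (w := fun t => pairVec (A t) (κ * Real.sin t) z z')
    (fun a => by
      have h1 : ContDiff ℝ 1 fun t => ((A t : ℝ) : ℂ) := Complex.ofRealCLM.contDiff.comp hAc
      have h2 : ContDiff ℝ 1 fun t => ((κ * Real.sin t : ℝ) : ℂ) :=
        Complex.ofRealCLM.contDiff.comp (contDiff_const.mul Real.contDiff_sin)
      exact (h1.mul contDiff_const).add (contDiff_const.mul (h2.mul contDiff_const)))
    (c := fun t => A t * ((time z - ‖z‖) + (time z' - ‖z'‖)))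
    (hAc.continuous.mul continuous_const)
    (fun t => inTube_pairVec (hA0 t) _ z z')
    (q := ((ε ^ 2 * (4 + ρ) + κ ^ 2 * ρ : ℝ) : ℂ))
    (fun t => by
      rw [csq_pairVec, hAsq, ← hρ', Complex.ofReal_inj, mul_pow, Real.sin_sq]
      field_simp
      ring) (Real.pi / 2) 0
  have e1 : A (Real.pi / 2) = ε := by
    simp [hA, Real.sqrt_sq hε.le]
  rw [e1, Real.sin_pi_div_two, mul_one, Real.sin_zero, mul_zero] at h
  rw [h]
  have hlen : pairLen ε κ z z' = A 0 * √(4 + ρ) := by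
    rw [pairLen, hA, ← Real.sqrt_mul (hpos 0).le]
    congr 1
    rw [← hρ', Real.cos_zero]
    field_simp
  have hs : 0 < √(4 + ρ) := Real.sqrt_pos.mpr (by positivity)
  have hs2 : √(4 + ρ) ^ 2 = 4 + ρ := Real.sq_sqrt (by positivity)
  set y : Space := (√(4 + ρ))⁻¹ • (z + z') with hy
  have htime : time y = (√(4 + ρ))⁻¹ * (time z + time z') := by
    have h1 := time_pos z
    have h2 := time_pos z'
    rw [time, Real.sqrt_eq_iff_mul_self_eq (by positivity) (by positivity), hy, norm_smul,
      mul_pow, norm_inv, Real.norm_eq_abs, abs_of_pos hs]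
    have h3 := mdot_pt_eq_distSq z z'
    rw [mdot_pt_eq, ← hρ'] at h3
    have h4 := time_sq z
    have h5 := time_sq z'
    rw [norm_add_sq_real]
    field_simp
    rw [hs2]
    linear_combination (-1 : ℝ) * h4 - h5 - 2 * h3
  rw [← laplace_smul_pt (pairLen_pos hε κ z z') y]
  congr 1
  funext a
  have hpt : pt y a = (√(4 + ρ))⁻¹ * (pt z a + pt z' a) := by
    fin_cases a
    · exact htime
    all_goals simp [pt, hy, mul_add]
  rw [hpt, hlen, pairVec]
  have hsc : ((√(4 + ρ) : ℝ) : ℂ) ≠ 0 := by exact_mod_cast hs.ne'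
  push_cast
  rw [zero_mul, mul_zero, add_zero, mul_assoc (A 0 : ℂ), mul_inv_cancel_left₀ hsc]

/-- The function `∫ e^{-√(r² + |v|²)} d³v`. -/
def bessel (r : ℝ) : ℝ := ∫ v : Space, Real.exp (-√(r ^ 2 + ‖v‖ ^ 2))

lemma integrable_exp_neg_norm : Integrable fun v : Space => Real.exp (-‖v‖) := by
  have h := (integrable_time_pow_mul_exp 0 one_pos).const_mul (Real.exp 1)
  refine h.mono' (by fun_prop) (Eventually.of_forall fun v => ?_)
  rw [Real.norm_eq_abs, abs_of_pos (Real.exp_pos _), pow_zero, one_mul, ← Real.exp_add,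
    Real.exp_le_exp]
  linarith [time_le v]

lemma exp_neg_sqrt_le (r : ℝ) (v : Space) :
    Real.exp (-√(r ^ 2 + ‖v‖ ^ 2)) ≤ Real.exp (-‖v‖) := by
  rw [Real.exp_le_exp, neg_le_neg_iff]
  exact Real.le_sqrt_of_sq_le (by nlinarith [sq_nonneg r])

lemma bessel_zero : bessel 0 = 8 * Real.pi := by
  have h := integral_radial fun r => Real.exp (-r)
  have h2 := Real.Gamma_eq_integral (s := 3) (by norm_num)
  have e : ∫ v : Space, Real.exp (-‖v‖) = bessel 0 := by
    refine integral_congr_ae (Eventually.of_forall fun v => ?_)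
    simp
  have h3 : Real.Gamma 3 = 2 := by
    rw [show (3 : ℝ) = ((2 : ℕ) : ℝ) + 1 by norm_num, Real.Gamma_nat_eq_factorial]
    norm_num
  have h4 : ∫ r in Set.Ioi (0 : ℝ), r ^ 2 • Real.exp (-r) = Real.Gamma 3 := by
    rw [h2]
    refine setIntegral_congr_fun measurableSet_Ioi fun r _ => ?_
    norm_num [mul_comm]
  rw [← e, h, h4, h3, smul_eq_mul]
  ring

lemma bessel_nonneg (r : ℝ) : 0 ≤ bessel r := integral_nonneg fun _ => (Real.exp_pos _).le

lemma bessel_le (r : ℝ) : bessel r ≤ 8 * Real.pi := by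
  rw [← bessel_zero]
  refine integral_mono_of_nonneg (Eventually.of_forall fun _ => (Real.exp_pos _).le) ?_
    (Eventually.of_forall fun v => ?_)
  · simpa using integrable_exp_neg_norm
  · simpa using exp_neg_sqrt_le r v

lemma continuous_bessel : Continuous bessel := by
  refine continuous_of_dominated (bound := fun v : Space => Real.exp (-‖v‖)) (fun r => ?_)
    (fun r => Eventually.of_forall fun v => ?_) integrable_exp_neg_norm
    (Eventually.of_forall fun v => by fun_prop)
  · exact Continuous.aestronglyMeasurable (by fun_prop)
  · rw [Real.norm_eq_abs, abs_of_pos (Real.exp_pos _)]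
    exact exp_neg_sqrt_le r v

/-- The substitution `v = r u` in the integral. -/
lemma moment_timeVec {r : ℝ} (hr : 0 < r) :
    moment (timeVec r) 0 = ((bessel r / r ^ 3 : ℝ) : ℂ) := by
  rw [moment_zero_eq]
  have e : ∀ u : Space, Complex.exp (-cdot (timeVec r) u)
      = ((Real.exp (-√(r ^ 2 + ‖r • u‖ ^ 2)) : ℝ) : ℂ) := by
    intro u
    change Complex.exp (-cdot (fun a => ((r * pt 0 a : ℝ) : ℂ)) u) = _
    rw [cdot_ofReal fun a => r * pt 0 a, mdot_smul_left, mdot_pt_eq, time_zero,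
      inner_zero_left, ← Complex.ofReal_neg, ← Complex.ofReal_exp, norm_smul, Real.norm_eq_abs,
      abs_of_pos hr, mul_pow, ← mul_one_add, Real.sqrt_mul (sq_nonneg r), Real.sqrt_sq hr.le, time]
    ring_nf
  simp only [e]
  rw [integral_complex_ofReal, Measure.integral_comp_smul volume
    (fun v : Space => Real.exp (-√(r ^ 2 + ‖v‖ ^ 2))), finrank_euclideanSpace, Fintype.card_fin,
    abs_of_pos (by positivity), smul_eq_mul, div_eq_inv_mul]
  rfl

lemma timeVec_zero (r : ℝ) : timeVec r 0 = r := by simp [timeVec, pt, time_zero]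

/-- Euler scaling: the Laplace transforms at `eᵗ w` for `w = pairVec A B z z'` and for
`w = (r, 0, 0, 0)` agree for all `t`, hence so do their derivatives at `t = 0`. -/
lemma csq_eq_moment {A B r : ℝ} {z z' : Space} (hA : 0 < A) (hr : r = pairLen A B z z') :
    moment (pairVec A B z z') 0 / pairVec A B z z' 0 * csq (pairVec A B z z')
      = r * moment (timeVec r) 0 := by
  have hr0 : 0 < r := hr ▸ pairLen_pos hA B z z'
  have hexp : ContDiff ℝ 1 fun t => ((Real.exp t : ℝ) : ℂ) :=
    Complex.ofRealCLM.contDiff.comp Real.contDiff_exp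
  have hd : ∀ x : ℂ, deriv (fun t => ((Real.exp t : ℝ) : ℂ) * x) 0 = x := fun x => by
    have h := ((Real.hasDerivAt_exp 0).ofReal_comp.mul_const x).deriv
    simpa using h
  have e1 : ∀ t, pairVec (Real.exp t * A) (Real.exp t * B) z z'
      = fun a => ((Real.exp t : ℝ) : ℂ) * pairVec A B z z' a := fun t => by
    funext a; simp only [pairVec]; push_cast; ring
  have e2 : ∀ t, timeVec (Real.exp t * r) = fun a => ((Real.exp t : ℝ) : ℂ) * timeVec r a :=
    fun t => by funext a; simp only [timeVec]; push_cast; ring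
  have e3 : ∀ t, pairLen (Real.exp t * A) (Real.exp t * B) z z' = Real.exp t * r := fun t => by
    rw [hr, pairLen, pairLen, ← Real.sqrt_sq (Real.exp_pos t).le, ← Real.sqrt_mul (sq_nonneg _),
      Real.sqrt_sq (Real.exp_pos t).le]
    congr 1; ring
  have hz := norm_lt_time z
  have hz' := norm_lt_time z'
  have h1 := hasDerivAt_laplace (w := fun t => pairVec (Real.exp t * A) (Real.exp t * B) z z')
    (fun a => by simp only [e1]; exact hexp.mul contDiff_const)
    (c := fun t => Real.exp t * A * ((time z - ‖z‖) + (time z' - ‖z'‖))) (by fun_prop)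
    (fun t => inTube_pairVec (by positivity) _ z z') 0
  have h2 := hasDerivAt_laplace (w := fun t => timeVec (Real.exp t * r))
    (fun a => by simp only [e2]; exact hexp.mul contDiff_const)
    (c := fun t => Real.exp t * r * (time 0 - ‖(0 : Space)‖)) (by fun_prop)
    (fun t => inTube_smul_pt (by positivity) 0) 0
  have e4 : (fun t => laplace (pairVec (Real.exp t * A) (Real.exp t * B) z z'))
      = fun t => laplace (timeVec (Real.exp t * r)) := by
    funext t
    rw [laplace_pairVec (by positivity), e3]
  rw [e4] at h1
  have h3 := neg_injective (h1.unique h2)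
  simp only [e1, e2, hd] at h3
  simp only [Real.exp_zero, Complex.ofReal_one, one_mul] at h3
  have h4 : ∑ a, (sgn a : ℂ) * timeVec r a * moment (timeVec r) a
      = r * moment (timeVec r) 0 := by
    rw [← timeVec_zero r]
    simp [Fin.sum_univ_four, timeVec, pt, sgn]
  rw [h4] at h3
  rw [← h3, csq, Finset.mul_sum]
  refine Finset.sum_congr rfl fun a _ => ?_
  rw [moment_eq (inTube_pairVec hA B z z') a]
  ring

/-- The proportionality factor of the first moments. -/
def pairFactor (ε κ : ℝ) (z z' : Space) : ℝ :=
  bessel (pairLen ε κ z z') / pairLen ε κ z z' ^ 4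

/-- The first moments at a complex frequency vector in terms of the real function `bessel`: the
proportionality factor of `moment_eq` follows from `csq_eq_moment`. -/
lemma moment_pairVec {ε : ℝ} (hε : 0 < ε) (κ : ℝ) (z z' : Space) (a : Fin 4) :
    moment (pairVec ε κ z z') a = pairFactor ε κ z z' * pairVec ε κ z z' a := by
  rw [moment_eq (inTube_pairVec hε κ z z') a]
  congr 1
  have h := csq_eq_moment hε (B := κ) (z := z) (z' := z') rfl
  have hp := pairLen_pos hε κ z z'
  rw [csq_pairVec, ← pairLen_sq, moment_timeVec hp] at h
  have hp' : (pairLen ε κ z z' : ℂ) ≠ 0 := by exact_mod_cast hp.ne'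
  rw [pairFactor]
  push_cast at h ⊢
  rw [← eq_div_iff (pow_ne_zero 2 hp')] at h
  rw [h]
  field_simp

lemma pairLen_neg (ε κ : ℝ) (z z' : Space) : pairLen ε (-κ) z z' = pairLen ε κ z z' := by
  simp [pairLen]

lemma pairFactor_neg (ε κ : ℝ) (z z' : Space) : pairFactor ε (-κ) z z' = pairFactor ε κ z z' := by
  simp [pairFactor, pairLen_neg]

lemma laplace_pairVec_neg {ε : ℝ} (hε : 0 < ε) (κ : ℝ) (z z' : Space) :
    laplace (pairVec ε (-κ) z z') = laplace (pairVec ε κ z z') := by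
  rw [laplace_pairVec hε, laplace_pairVec hε, pairLen_neg]

end

section

/-! ### Superpositions of plane waves -/

attribute [local irreducible] mdot pt time

/-- The superposition `∫ e^{-λ u·z} g(z) dμ(z)` of plane waves, oscillating or damped according
to the complex frequency `λ`. -/
def wave (l : ℂ) (g : Space → Spinor) (u : Space) : Spinor :=
  ∫ z, Complex.exp (-(l * mdot (pt u) (pt z))) • g z ∂hypMeasure

lemma continuous_mdot_pt_comp {X : Type*} [TopologicalSpace X] {f g : X → Space}
    (hf : Continuous f) (hg : Continuous g) : Continuous fun x => mdot (pt (f x)) (pt (g x)) :=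
  continuous_mdot_pt.comp (hf.prodMk hg)

lemma contDiff_rsmul {n : WithTop ℕ∞} {c : Space → ℝ} {f : Space → Spinor}
    (hc : ContDiff ℝ n c) (hf : ContDiff ℝ n f) : ContDiff ℝ n fun z => c z • f z :=
  hc.smul hf

lemma hasCompactSupport_rsmul {f : Space → Spinor} (hf : HasCompactSupport f) (c : Space → ℝ) :
    HasCompactSupport fun z => c z • f z :=
  hf.mono fun z hz h => hz (by simp [h])

lemma continuous_wave_integrand {g : Space → Spinor} (hg : Continuous g) :
    Continuous fun p : (ℂ × Space) × Space =>
      Complex.exp (-(p.1.1 * mdot (pt p.1.2) (pt p.2))) • g p.2 := by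
  have h : Continuous fun p : (ℂ × Space) × Space => mdot (pt p.1.2) (pt p.2) :=
    continuous_mdot_pt_comp (continuous_snd.comp continuous_fst) continuous_snd
  have h' := Complex.continuous_ofReal.comp h
  exact (Complex.continuous_exp.comp ((continuous_fst.fst.mul h').neg)).smul
    (hg.comp continuous_snd)

lemma integrable_wave {g : Space → Spinor} (hg : Continuous g) (hc : HasCompactSupport g) (l : ℂ)
    (u : Space) : Integrable (fun z => Complex.exp (-(l * mdot (pt u) (pt z))) • g z)
      hypMeasure := by
  have h : Continuous fun z => mdot (pt u) (pt z) :=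
    continuous_mdot_pt_comp continuous_const continuous_id
  have h' := Complex.continuous_ofReal.comp h
  have h'' : Continuous fun z => Complex.exp (-(l * mdot (pt u) (pt z))) :=
    Complex.continuous_exp.comp (continuous_const.mul h').neg
  exact (h''.smul hg).integrable_of_hasCompactSupport hc.smul_left

lemma continuous_wave {g : Space → Spinor} (hg : Continuous g) (hc : HasCompactSupport g) :
    Continuous fun p : ℂ × Space => wave p.1 g p.2 := by
  have h := continuous_parametric_integral_of_continuous (μ := hypMeasure)
    (f := fun (p : ℂ × Space) z => Complex.exp (-(p.1 * mdot (pt p.2) (pt z))) • g z)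
    (continuous_wave_integrand hg) (s := tsupport g) hc
  refine h.congr fun p => ?_
  refine setIntegral_eq_integral_of_forall_compl_eq_zero fun z hz => ?_
  rw [image_eq_zero_of_notMem_tsupport hz, smul_zero]

lemma norm_cexp_le {l : ℂ} (hl : 0 ≤ l.re) (u z : Space) :
    ‖Complex.exp (-(l * mdot (pt u) (pt z)))‖ ≤ 1 := by
  rw [Complex.norm_exp, Real.exp_le_one_iff]
  simp only [Complex.neg_re, Complex.mul_re, Complex.ofReal_re, Complex.ofReal_im, mul_zero,
    sub_zero, Left.neg_nonpos_iff]
  exact mul_nonneg hl (zero_le_one.trans (one_le_mdot_pt u z))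

lemma norm_wave_le {l : ℂ} (hl : 0 ≤ l.re) {g : Space → Spinor} (hg : Continuous g)
    (hc : HasCompactSupport g) (u : Space) : ‖wave l g u‖ ≤ ∫ z, ‖g z‖ ∂hypMeasure := by
  refine norm_integral_le_of_norm_le (hg.integrable_of_hasCompactSupport hc).norm
    (Eventually.of_forall fun z => ?_)
  rw [norm_smul]
  exact mul_le_of_le_one_left (norm_nonneg _) (norm_cexp_le hl u z)

lemma wave_add (l : ℂ) {g g' : Space → Spinor} (hg : Continuous g) (hc : HasCompactSupport g)
    (hg' : Continuous g') (hc' : HasCompactSupport g') (u : Space) :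
    wave l (fun z => g z + g' z) u = wave l g u + wave l g' u := by
  simp only [wave, smul_add]
  exact integral_add (integrable_wave hg hc l u) (integrable_wave hg' hc' l u)

lemma wave_sum (l : ℂ) {ι : Type*} (s : Finset ι) {g : ι → Space → Spinor}
    (hg : ∀ i, Continuous (g i)) (hc : ∀ i, HasCompactSupport (g i)) (u : Space) :
    wave l (fun z => ∑ i ∈ s, g i z) u = ∑ i ∈ s, wave l (g i) u := by
  simp only [wave, Finset.smul_sum]
  exact integral_finsetSum _ fun i _ => integrable_wave (hg i) (hc i) l u

lemma wave_smul (l c : ℂ) (g : Space → Spinor) (u : Space) :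
    wave l (fun z => c • g z) u = c • wave l g u := by
  simp only [wave, smul_comm _ c]
  exact integral_smul c _

lemma wave_clm (l : ℂ) (A : Spinor →L[ℂ] Spinor) {g : Space → Spinor} (hg : Continuous g)
    (hc : HasCompactSupport g) (u : Space) : wave l (fun z => A (g z)) u = A (wave l g u) := by
  simp only [wave]
  rw [← A.integral_comp_comm (integrable_wave hg hc l u)]
  simp

lemma wave_time_smul (l : ℂ) (g : Space → Spinor) (u : Space) :
    wave l (fun z => time z • g z) u
      = ∫ z, Complex.exp (-cdot (fun a => l * pt u a) z) • g z := by
  rw [wave, integral_hyp]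
  refine integral_congr_ae (Eventually.of_forall fun z => ?_)
  have h : cdot (fun a => l * pt u a) z = l * mdot (pt u) (pt z) := by
    rw [← cdot_ofReal, cdot, cdot, Finset.mul_sum]
    exact Finset.sum_congr rfl fun a _ => by ring
  simp only []
  rw [h, smul_comm, smul_comm _ (time z), smul_smul, mul_inv_cancel₀ (time_pos z).ne', one_smul]

/-- Partial derivative in a spatial direction. -/
abbrev pderiv (j : Fin 3) (g : Space → Spinor) (z : Space) : Spinor :=
  fderiv ℝ g z (EuclideanSpace.single j 1)

lemma hasCompactSupport_pderiv (j : Fin 3) {g : Space → Spinor} (hc : HasCompactSupport g) :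
    HasCompactSupport (pderiv j g) :=
  (hc.fderiv (𝕜 := ℝ)).mono fun z hz h => hz (by simp [pderiv, h])

lemma continuous_pderiv (j : Fin 3) {g : Space → Spinor} (hg : ContDiff ℝ 1 g) :
    Continuous (pderiv j g) :=
  (hg.continuous_fderiv one_ne_zero).clm_apply continuous_const

/-- Integration by parts against a plane wave: multiplication by the spatial component `u_j`
amounts to multiplication by `u⁰ z_j / z⁰` and a derivative. -/
lemma smul_wave_eq {l : ℂ} (hl : l ≠ 0) {g : Space → Spinor} (hg : ContDiff ℝ 1 g)
    (hc : HasCompactSupport g) (u : Space) (j : Fin 3) :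
    u j • wave l (fun z => time z • g z) u = time u • wave l (fun z => z j • g z) u
      - l⁻¹ • wave l (fun z => time z • pderiv j g z) u := by
  set w : Fin 4 → ℂ := fun a => l * pt u a with hw
  have hj : w j.succ = l * u j := by
    fin_cases j <;> simp [hw, pt]
  have h0 : w 0 = l * time u := by simp [hw, pt]
  have he : Continuous fun z => Complex.exp (-cdot w z) := continuous_cexp_cdot w
  have hv : Continuous fun z : Space => z j / time z :=
    (by fun_prop : Continuous fun z : Space => z j).div continuous_time fun z => (time_pos z).ne'
  have hzj : wave l (fun z => z j • g z) u
      = ∫ z, Complex.exp (-cdot w z) • (z j / time z) • g z := by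
    rw [← wave_time_smul]
    congr 1; funext z
    rw [smul_smul, mul_div_cancel₀ _ (time_pos z).ne']
  have hd : ∀ z, fderiv ℝ (fun z => Complex.exp (-cdot w z)) z (EuclideanSpace.single j 1)
      = (l * u j - l * time u * (z j / time z : ℝ)) * Complex.exp (-cdot w z) := fun z => by
    rw [fderiv_cexp_cdot, hj, h0]
  have hci : ∀ {e : Space → ℂ} {k : Space → Spinor}, Continuous e → Continuous k →
      HasCompactSupport k → Integrable fun z => e z • k z := fun h1 h2 h3 =>
    (h1.smul h2).integrable_of_hasCompactSupport h3.smul_left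
  have hde : Continuous fun z => fderiv ℝ (fun z => Complex.exp (-cdot w z)) z
      (EuclideanSpace.single j 1) := by
    simp only [hd]
    exact (continuous_const.sub (continuous_const.mul (Complex.continuous_ofReal.comp hv))).mul he
  have hvg : Continuous fun z => (z j / time z) • g z := hv.smul hg.continuous
  have hvc := hasCompactSupport_rsmul hc fun z => z j / time z
  have key := integral_smul_fderiv_eq_neg_fderiv_smul_of_integrable (μ := volume)
    (f := fun z => Complex.exp (-cdot w z)) (g := g) (v := EuclideanSpace.single j 1)
    (hci hde hg.continuous hc)
    (hci he (continuous_pderiv j hg) (hasCompactSupport_pderiv j hc))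
    (hci he hg.continuous hc) (fun z _ => differentiable_cexp_cdot w z)
    (fun z _ => hg.differentiable one_ne_zero z)
  have hsplit : ∫ z, fderiv ℝ (fun z => Complex.exp (-cdot w z)) z
      (EuclideanSpace.single j 1) • g z = (l * u j) • (∫ z, Complex.exp (-cdot w z) • g z)
      - (l * time u) • ∫ z, Complex.exp (-cdot w z) • (z j / time z) • g z := by
    rw [← integral_smul, ← integral_smul, ← integral_sub]
    · refine integral_congr_ae (Eventually.of_forall fun z => ?_)
      simp only [hd, ← Complex.coe_smul (z j / time z), smul_smul, ← sub_smul]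
      congr 1; ring
    · exact (hci he hg.continuous hc).smul (l * u j : ℂ)
    · exact (hci he hvg hvc).smul (l * time u : ℂ)
  rw [hsplit] at key
  rw [hzj, wave_time_smul, wave_time_smul]
  change _ = _ - l⁻¹ • ∫ z, Complex.exp (-cdot w z) • pderiv j g z
  rw [key, ← Complex.coe_smul (u j), ← Complex.coe_smul (time u)]
  simp only [smul_neg, smul_sub, smul_smul, ← mul_assoc, inv_mul_cancel₀ hl, one_mul]
  abel

/-- Superpositions of plane waves with smooth amplitude decay rapidly on the hyperboloid,
uniformly in the frequency. -/
lemma exists_norm_wave_le {κ : ℝ} (hκ : 0 < κ) (N : ℕ) :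
    ∀ g : Space → Spinor, ContDiff ℝ (⊤ : ℕ∞) g → HasCompactSupport g →
      ∃ C, ∀ l : ℂ, 0 ≤ l.re → κ ≤ ‖l‖ → ∀ u, ‖wave l g u‖ ≤ C * ((time u)⁻¹) ^ N := by
  induction N with
  | zero =>
    intro g hg hc
    exact ⟨_, fun l hl _ u => by simpa using norm_wave_le hl hg.continuous hc u⟩
  | succ N ih =>
    intro f hf hc
    -- the amplitude `z⁰ f` is used, since two integrations by parts produce `(z⁰)⁻¹`
    set g : Space → Spinor := fun z => time z • f z with hg'
    have htime : ContDiff ℝ (⊤ : ℕ∞) time := contDiff_time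
    have hz : ∀ j : Fin 3, ContDiff ℝ (⊤ : ℕ∞) fun z : Space => z j := fun j =>
      (EuclideanSpace.proj (𝕜 := ℝ) j : Space →L[ℝ] ℝ).contDiff
    have hg : ContDiff ℝ (⊤ : ℕ∞) g := contDiff_rsmul htime hf
    have hgc : HasCompactSupport g := hasCompactSupport_rsmul hc time
    have hvg : ∀ j : Fin 3, ContDiff ℝ (⊤ : ℕ∞) fun z => z j • f z := fun j =>
      contDiff_rsmul (hz j) hf
    have hvc : ∀ j : Fin 3, HasCompactSupport fun z => z j • f z := fun j =>
      hasCompactSupport_rsmul hc fun z => z j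
    have hp : ∀ {k : Space → Spinor} (j : Fin 3), ContDiff ℝ (⊤ : ℕ∞) k →
        ContDiff ℝ (⊤ : ℕ∞) fun z => time z • pderiv j k z := fun j hk =>
      contDiff_rsmul htime (((contDiff_infty_iff_fderiv.mp hk).2).clm_apply contDiff_const)
    have hpc : ∀ {k : Space → Spinor} (j : Fin 3), HasCompactSupport k →
        HasCompactSupport fun z => time z • pderiv j k z := fun j hk =>
      hasCompactSupport_rsmul (hasCompactSupport_pderiv j hk) time
    obtain ⟨C0, h0⟩ := ih (fun z => time z • g z) (contDiff_rsmul htime hg)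
      (hasCompactSupport_rsmul hgc time)
    choose C1 h1 using fun j => ih _ (hp j hg) (hpc j hgc)
    choose C2 h2 using fun j => ih _ (hp j (hvg j)) (hpc j (hvc j))
    refine ⟨|C0| + κ⁻¹ * ∑ j, (|C1 j| + |C2 j|), fun l hl hκl u => ?_⟩
    have hl0 : l ≠ 0 := norm_pos_iff.mp (hκ.trans_le hκl)
    have e1 := fun j => smul_wave_eq hl0 (hg.of_le (by norm_cast)) hgc u j
    have e2 := fun j => smul_wave_eq hl0 ((hvg j).of_le (by norm_cast)) (hvc j) u j
    have hnsq : ∀ z : Space, ∑ j, z j * z j = time z ^ 2 - 1 := fun z => by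
      rw [time_sq, EuclideanSpace.norm_sq_eq]; simp [pow_two]
    have hsum : time u ^ 2 • wave l f u = wave l (fun z => time z • g z) u
        + ∑ j, (-(l⁻¹ • u j • wave l (fun z => time z • pderiv j g z) u)
          - l⁻¹ • time u • wave l (fun z => time z • pderiv j (fun z => z j • f z) z) u) := by
      have hA : wave l f u = wave l (fun z => time z • g z) u
          - ∑ j, wave l (fun z => z j • z j • f z) u := by
        rw [← wave_sum l _ (fun j => (contDiff_rsmul (hz j) (hvg j)).continuous)
          fun j => hasCompactSupport_rsmul (hvc j) fun z => z j]
        rw [eq_sub_iff_add_eq, ← wave_add l hf.continuous hc]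
        · congr 1; funext z
          simp only [hg', smul_smul, ← Finset.sum_smul, hnsq]
          rw [sub_smul, one_smul, pow_two]; abel
        · exact continuous_finsetSum _ fun j _ => (contDiff_rsmul (hz j) (hvg j)).continuous
        · refine hc.mono fun z hz' h => hz' ?_
          simp [h]
      have hB : ∀ j, (time u * time u) • wave l (fun z => z j • z j • f z) u
          = (u j * u j) • wave l (fun z => time z • g z) u
            + (l⁻¹ • u j • wave l (fun z => time z • pderiv j g z) u
            + l⁻¹ • time u • wave l (fun z => time z • pderiv j (fun z => z j • f z) z) u) := by
        intro j
        have hs : (fun z => z j • g z) = fun z => time z • z j • f z := by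
          funext z; simp only [hg', smul_smul, mul_comm]
        have e1' := e1 j
        rw [hs] at e1'
        rw [mul_smul, mul_smul, e1', smul_sub, smul_comm (u j) (time u), e2 j]
        rw [smul_sub, smul_comm (u j) l⁻¹, smul_comm (time u) l⁻¹]
        abel
      rw [hA, smul_sub, pow_two, Finset.smul_sum, Finset.sum_congr rfl fun j _ => hB j,
        Finset.sum_add_distrib, ← Finset.sum_smul, hnsq]
      simp only [sub_eq_add_neg, ← neg_add, Finset.sum_neg_distrib]
      rw [add_smul, neg_smul, one_smul, pow_two]
      abel
    have ht := time_pos u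
    set T := (time u)⁻¹ with hT
    have hT1 : T ≤ 1 := inv_le_one_of_one_le₀ (one_le_time u)
    have hT0 : 0 < T := inv_pos.mpr ht
    have hTN : 0 < T ^ N := pow_pos hT0 N
    have huj : ∀ j, |u j| ≤ time u := fun j => by
      refine le_trans ?_ (norm_pt_le u j.succ)
      fin_cases j <;> simp [pt]
    have hli : ‖l⁻¹‖ ≤ κ⁻¹ := by
      rw [norm_inv]; exact inv_anti₀ hκ hκl
    have hnorm : time u ^ 2 * ‖wave l f u‖
        ≤ time u * ((|C0| + κ⁻¹ * ∑ j, (|C1 j| + |C2 j|)) * T ^ N) := by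
      rw [← abs_of_pos (pow_pos ht 2), ← Real.norm_eq_abs, ← norm_smul, hsum]
      refine (norm_add_le _ _).trans ?_
      have hb0 : ‖wave l (fun z => time z • g z) u‖ ≤ time u * (|C0| * T ^ N) := by
        refine (h0 l hl hκl u).trans ?_
        refine le_trans ?_ (le_mul_of_one_le_left (by positivity) (one_le_time u))
        gcongr; exact le_abs_self _
      have hbj : ∀ j, ‖(-(l⁻¹ • u j • wave l (fun z => time z • pderiv j g z) u)
          - l⁻¹ • time u • wave l (fun z => time z • pderiv j (fun z => z j • f z) z) u)‖
          ≤ time u * (κ⁻¹ * (|C1 j| + |C2 j|) * T ^ N) := by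
        intro j
        refine (norm_sub_le _ _).trans ?_
        rw [norm_neg, norm_smul, norm_smul, norm_smul, norm_smul, Real.norm_eq_abs,
          Real.norm_eq_abs, abs_of_pos ht]
        have h1' : ‖wave l (fun z => time z • pderiv j g z) u‖ ≤ |C1 j| * T ^ N :=
          (h1 j l hl hκl u).trans (by gcongr; exact le_abs_self _)
        have h2' : ‖wave l (fun z => time z • pderiv j (fun z => z j • f z) z) u‖
            ≤ |C2 j| * T ^ N := (h2 j l hl hκl u).trans (by gcongr; exact le_abs_self _)
        calc _ ≤ κ⁻¹ * (time u * (|C1 j| * T ^ N)) + κ⁻¹ * (time u * (|C2 j| * T ^ N)) := by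
              gcongr; exact huj j
          _ = _ := by ring
      calc _ ≤ time u * (|C0| * T ^ N) + ∑ j, time u * (κ⁻¹ * (|C1 j| + |C2 j|) * T ^ N) :=
            add_le_add hb0 ((norm_sum_le _ _).trans (Finset.sum_le_sum fun j _ => hbj j))
        _ = _ := by
            rw [← Finset.mul_sum, ← Finset.sum_mul, ← Finset.mul_sum]; ring
    have : ‖wave l f u‖ = T * T * (time u ^ 2 * ‖wave l f u‖) := by
      rw [hT]; field_simp
    rw [this]
    calc _ ≤ T * T * (time u * ((|C0| + κ⁻¹ * ∑ j, (|C1 j| + |C2 j|)) * T ^ N)) := by gcongr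
      _ = _ := by rw [pow_succ, hT]; field_simp

end

section

attribute [local irreducible] mdot pt time

/-! ### The scalar product of two damped superpositions -/

/-- The complex four-vector `l z + l' z'`. -/
def freqVec (l l' : ℂ) (z z' : Space) : Fin 4 → ℂ := fun a => l * pt z a + l' * pt z' a

lemma cdot_freqVec (l l' : ℂ) (z z' u : Space) : cdot (freqVec l l' z z') u
    = l * mdot (pt u) (pt z) + l' * mdot (pt u) (pt z') := by
  rw [mdot_comm (pt u), mdot_comm (pt u), ← cdot_ofReal, ← cdot_ofReal]
  simp only [cdot, freqVec, Finset.mul_sum, ← Finset.sum_add_distrib]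
  exact Finset.sum_congr rfl fun a _ => by ring

lemma time_sub_norm_pos (z : Space) : 0 < time z - ‖z‖ := sub_pos.mpr (norm_lt_time z)

lemma inTube_freqVec {l l' : ℂ} (hl : 0 < l.re) (hl' : 0 < l'.re) (z z' : Space) :
    InTube (freqVec l l' z z') (l.re * (time z - ‖z‖)) := by
  refine ⟨mul_pos hl (time_sub_norm_pos z), fun u => ?_⟩
  rw [cdot_freqVec]
  simp only [Complex.add_re, Complex.mul_re, Complex.ofReal_re, Complex.ofReal_im, mul_zero,
    sub_zero]
  have h1 := le_mdot_pt u z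
  have h2 := one_le_mdot_pt u z'
  nlinarith

variable (D : DiracMatrices)

lemma exists_le_mdot_pt {K : Set Space} (hK : IsCompact K) :
    ∃ c, 0 < c ∧ ∀ z ∈ K, ∀ u, c * time u ≤ mdot (pt u) (pt z) := by
  have hcont : Continuous fun z : Space => time z - ‖z‖ := continuous_time.sub continuous_norm
  obtain ⟨c, hc, h⟩ := hK.exists_forall_le' hcont.continuousOn fun z _ => time_sub_norm_pos z
  exact ⟨c, hc, fun z hz u =>
    (mul_le_mul_of_nonneg_right (h z hz) (time_pos u).le).trans (le_mdot_pt u z)⟩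

lemma conj_cexp_neg_mul (l : ℂ) (t : ℝ) :
    conj (Complex.exp (-(l * t))) = Complex.exp (-(conj l * t)) := by
  rw [← Complex.exp_conj]; simp

/-- Absolute convergence which allows the interchange of the integrals: a frequency of positive real
part gives exponential decay in the common argument of the two waves. -/
lemma integrable_pair {l l' : ℂ} (hl : 0 < l.re) (hl' : 0 < l'.re) {g g' : Space → Spinor}
    (hg : Continuous g) (hc : HasCompactSupport g) (hg' : Continuous g')
    (hc' : HasCompactSupport g') {B : Space → Spinor →L[ℂ] Spinor} (hB : Continuous B)
    {b : ℝ} (hb : ∀ u, ‖B u‖ ≤ b * time u) :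
    Integrable (fun q : Space × (Space × Space) =>
      Complex.exp (-cdot (freqVec (conj l) l' q.2.1 q.2.2) q.1)
        * dbar D (g q.2.1) (B q.1 (g' q.2.2)))
      (hypMeasure.prod (hypMeasure.prod hypMeasure)) := by
  obtain ⟨c, hc0, hcK⟩ := exists_le_mdot_pt hc
  have hlc : 0 < l.re * c := mul_pos hl hc0
  have h1 := integrable_hyp_of_integrable ((integrable_time_pow_mul_exp 1 hlc).const_mul b)
  have h2 : Integrable (fun p : Space × Space => ‖g p.1‖ * ‖g' p.2‖)
      (hypMeasure.prod hypMeasure) :=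
    (hg.integrable_of_hasCompactSupport hc).norm.mul_prod
      (hg'.integrable_of_hasCompactSupport hc').norm
  have hm : Continuous fun q : Space × (Space × Space) =>
      Complex.exp (-cdot (freqVec (conj l) l' q.2.1 q.2.2) q.1)
        * dbar D (g q.2.1) (B q.1 (g' q.2.2)) := by
    simp only [cdot_freqVec]
    have e1 := continuous_mdot_pt_comp (X := Space × (Space × Space)) continuous_fst
      (continuous_fst.comp continuous_snd)
    have e2 := continuous_mdot_pt_comp (X := Space × (Space × Space)) continuous_fst
      (continuous_snd.comp continuous_snd)
    refine Continuous.mul (Complex.continuous_exp.comp (Continuous.neg ?_))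
      (continuous_dbar D ?_ ?_)
    · exact (continuous_const.mul (Complex.continuous_ofReal.comp e1)).add
        (continuous_const.mul (Complex.continuous_ofReal.comp e2))
    · exact hg.comp (continuous_fst.comp continuous_snd)
    · exact (hB.comp continuous_fst).clm_apply (hg'.comp (continuous_snd.comp continuous_snd))
  refine ((h1.mul_prod h2).const_mul ‖dbarL D‖).mono' hm.aestronglyMeasurable
    (Eventually.of_forall fun q => ?_)
  obtain ⟨u, z, z'⟩ := q
  have hb0 : 0 ≤ b := by
    have := (norm_nonneg _).trans (hb 0)
    rw [time_zero, mul_one] at this; exact this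
  have ht := time_pos u
  by_cases h : g z = 0
  · simp [h, dbar]
  · have hz : z ∈ tsupport g := subset_tsupport g h
    have he : ‖Complex.exp (-cdot (freqVec (conj l) l' z z') u)‖
        ≤ Real.exp (-(l.re * c) * time u) := by
      rw [Complex.norm_exp, Real.exp_le_exp, cdot_freqVec]
      simp only [Complex.neg_re, Complex.add_re, Complex.mul_re, Complex.ofReal_re,
        Complex.ofReal_im, mul_zero, sub_zero, Complex.conj_re]
      have h1 := mul_le_mul_of_nonneg_left (hcK z hz u) hl.le
      have h2 := mul_nonneg hl'.le (zero_le_one.trans (one_le_mdot_pt u z'))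
      linarith
    have hd : ‖dbar D (g z) (B u (g' z'))‖ ≤ ‖dbarL D‖ * ‖g z‖ * (b * time u * ‖g' z'‖) :=
      (norm_dbar_le D _ _).trans (by
        gcongr; exact ((B u).le_opNorm _).trans (by gcongr; exact hb u))
    simp only [norm_mul]
    calc _ ≤ Real.exp (-(l.re * c) * time u) * (‖dbarL D‖ * ‖g z‖ * (b * time u * ‖g' z'‖)) := by
          gcongr
      _ = _ := by ring

/-- The pairing of two superpositions as an integral over pairs of points. -/
lemma dbar_wave_wave (l l' : ℂ) {g g' : Space → Spinor}
    (hg : Continuous g) (hc : HasCompactSupport g) (hg' : Continuous g')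
    (hc' : HasCompactSupport g') (B : Spinor →L[ℂ] Spinor) (u : Space) :
    dbar D (wave l g u) (B (wave l' g' u)) = ∫ p : Space × Space,
      Complex.exp (-cdot (freqVec (conj l) l' p.1 p.2) u) * dbar D (g p.1) (B (g' p.2))
        ∂(hypMeasure.prod hypMeasure) := by
  have hi := integrable_wave hg hc l u
  have hi' := integrable_wave hg' hc' l' u
  have e : ∀ z z', Complex.exp (-cdot (freqVec (conj l) l' z z') u) * dbar D (g z) (B (g' z'))
      = dbar D (Complex.exp (-(l * mdot (pt u) (pt z))) • g z)
        (B (Complex.exp (-(l' * mdot (pt u) (pt z'))) • g' z')) := fun z z' => by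
    rw [map_smul, dbar_smul_left, dbar_smul_right, conj_cexp_neg_mul, cdot_freqVec, neg_add,
      Complex.exp_add]
    ring
  simp only [e]
  rw [integral_prod, wave, ← integral_dbar_left D hi]
  · refine integral_congr_ae (Eventually.of_forall fun z => ?_)
    simp only [wave]
    rw [← B.integral_comp_comm hi', ← integral_dbar_right D (B.integrable_comp hi')]
  · have hb := (hi.norm.mul_prod hi'.norm).const_mul (‖dbarL D‖ * ‖B‖)
    refine hb.mono' ?_ (Eventually.of_forall fun p => ?_)
    · have h1 := hi.1.comp_fst (ν := hypMeasure)
      have h2 := hi'.1.comp_snd (μ := hypMeasure)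
      exact h1.inner (((act (D.mat 0)).comp B).continuous.comp_aestronglyMeasurable h2)
    · refine (norm_dbar_le D _ _).trans ?_
      calc _ ≤ ‖dbarL D‖ * ‖Complex.exp (-(l * mdot (pt u) (pt p.1))) • g p.1‖
            * (‖B‖ * ‖Complex.exp (-(l' * mdot (pt u) (pt p.2))) • g' p.2‖) := by
            gcongr; exact B.le_opNorm _
        _ = _ := by ring

/-- The scalar product of two damped superpositions, integrated first over their common
argument. -/
lemma integral_dbar_wave {l l' : ℂ} (hl : 0 < l.re) (hl' : 0 < l'.re) {g g' : Space → Spinor}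
    (hg : Continuous g) (hc : HasCompactSupport g) (hg' : Continuous g')
    (hc' : HasCompactSupport g') {B : Space → Spinor →L[ℂ] Spinor} (hB : Continuous B)
    {b : ℝ} (hb : ∀ u, ‖B u‖ ≤ b * time u) {J : Space → Space → ℂ}
    (hJ : ∀ z z', ∫ u, Complex.exp (-cdot (freqVec (conj l) l' z z') u)
        * dbar D (g z) (B u (g' z')) ∂hypMeasure = J z z') :
    Integrable (fun u => dbar D (wave l g u) (B u (wave l' g' u))) hypMeasure ∧
    Integrable (fun p : Space × Space => J p.1 p.2) (hypMeasure.prod hypMeasure) ∧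
    ∫ u, dbar D (wave l g u) (B u (wave l' g' u)) ∂hypMeasure
      = ∫ p : Space × Space, J p.1 p.2 ∂(hypMeasure.prod hypMeasure) := by
  have hi := integrable_pair D hl hl' hg hc hg' hc' hB hb
  simp only [dbar_wave_wave D l l' hg hc hg' hc', ← hJ]
  exact ⟨hi.integral_prod_left, hi.integral_prod_right, integral_integral_swap hi⟩

lemma integral_cexp_mul_dbar (w : Fin 4 → ℂ) (x y : Spinor) :
    ∫ u, Complex.exp (-cdot w u) * dbar D x y ∂hypMeasure = laplace w * dbar D x y := by
  rw [integral_mul_const, laplace]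

lemma dbar_sum_right {ι : Type*} (s : Finset ι) (x : Spinor) (y : ι → Spinor) :
    dbar D x (∑ i ∈ s, y i) = ∑ i ∈ s, dbar D x (y i) := by
  simp only [dbar, map_sum, inner_sum]

lemma dbar_act_gz_eq_sum (z : Space) (x y : Spinor) :
    dbar D x (act (gz D z) y) = ∑ a, (sgn a * pt z a : ℝ) * dbar D x (act (D.mat a) y) := by
  rw [gz, slash, act_sum, dbar_sum_right]
  simp only [act_smul, dbar_smul_right]

/-- The first moments are proportional to the frequency vector, so that `γ·u` is replaced by
`l γ·z + l' γ·z'`, up to a factor. -/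
lemma integral_cexp_mul_dbar_gz {l l' : ℂ} (hl : 0 < l.re) (hl' : 0 < l'.re) (z z' : Space)
    (x y : Spinor) :
    ∫ u, Complex.exp (-cdot (freqVec l l' z z') u) * dbar D x (act (gz D u) y) ∂hypMeasure
      = moment (freqVec l l' z z') 0 / freqVec l l' z z' 0
        * (l * dbar D (act (gz D z) x) y + l' * dbar D x (act (gz D z') y)) := by
  have ht := inTube_freqVec hl hl' z z'
  set w := freqVec l l' z z' with hw
  have e : ∀ u, Complex.exp (-cdot w u) * dbar D x (act (gz D u) y)
      = ∑ a, (sgn a * dbar D x (act (D.mat a) y)) * (pt u a * Complex.exp (-cdot w u)) :=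
    fun u => by
      rw [dbar_act_gz_eq_sum, Finset.mul_sum]
      exact Finset.sum_congr rfl fun a _ => by push_cast; ring
  simp only [e]
  rw [integral_finsetSum _ fun a _ => (integrable_pt_mul_cexp_cdot ht a).const_mul _]
  simp only [integral_const_mul]
  rw [dbar_act_gz, dbar_act_gz_eq_sum, dbar_act_gz_eq_sum, Finset.mul_sum, Finset.mul_sum,
    ← Finset.sum_add_distrib, Finset.mul_sum]
  refine Finset.sum_congr rfl fun a _ => ?_
  change _ * moment w a = _
  rw [moment_eq ht a]
  simp only [hw, freqVec]
  push_cast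
  ring

end

section

attribute [local irreducible] mdot pt time

variable (D : DiracMatrices)

/-! ### The limit of vanishing damping -/

/-- The double integral to which the squared norm of a damped transform reduces. -/
def dampedForm (ε κ : ℝ) (f : Space → Spinor) : ℂ :=
  ∫ p : Space × Space, (ε * pairFactor ε κ p.1 p.2 : ℝ)
    * (dbar D (act (gz D p.1) (f p.1)) (f p.2) + dbar D (f p.1) (act (gz D p.2) (f p.2)))
      ∂(hypMeasure.prod hypMeasure)

lemma freqVec_conj_self (ε κ : ℝ) (z z' : Space) :
    freqVec (conj (ε + Complex.I * κ)) (ε + Complex.I * κ) z z' = pairVec ε κ z z' := by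
  funext a
  simp only [freqVec, pairVec, map_add, map_mul, Complex.conj_I, Complex.conj_ofReal]
  ring

lemma moment_freqVec_div {ε : ℝ} (hε : 0 < ε) (κ : ℝ) (z z' : Space) :
    moment (pairVec ε κ z z') 0 / pairVec ε κ z z' 0 = pairFactor ε κ z z' := by
  rw [moment_pairVec hε, mul_div_cancel_right₀ _ (inTube_pairVec hε κ z z').ne_zero]

lemma continuous_pairLen (ε κ : ℝ) : Continuous fun p : Space × Space =>
    pairLen ε κ p.1 p.2 := by
  unfold pairLen
  have := continuous_distSq
  fun_prop

lemma continuous_pairFactor {ε : ℝ} (hε : 0 < ε) (κ : ℝ) :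
    Continuous fun p : Space × Space => pairFactor ε κ p.1 p.2 := by
  unfold pairFactor
  exact (continuous_bessel.comp (continuous_pairLen ε κ)).div
    ((continuous_pairLen ε κ).pow 4) fun p => (pow_pos (pairLen_pos hε κ _ _) 4).ne'

/-- At the damping `ε = R^{-1/2}` the factor `ε⁴ pairFactor` is a function of `R · distSq`, up to
terms which converge as `R → ∞`. -/
lemma inv_sqrt_pow_mul_pairFactor {R : ℝ} (hR : 0 < R) (κ : ℝ) (z z' : Space) :
    (√R)⁻¹ ^ 4 * pairFactor (√R)⁻¹ κ z z'
      = bessel (pairLen (√R)⁻¹ κ z z')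
        / (4 + distSq z z' + κ ^ 2 * (R * distSq z z')) ^ 2 := by
  have hs : 0 < √R := Real.sqrt_pos.mpr hR
  have h2 : (√R) ^ 2 = R := Real.sq_sqrt hR.le
  have h := pairLen_sq (√R)⁻¹ κ z z'
  have hp := pairLen_pos (inv_pos.mpr hs) κ z z'
  have e : (4 + distSq z z' + κ ^ 2 * (R * distSq z z'))
      = R * pairLen (√R)⁻¹ κ z z' ^ 2 := by
    rw [h, inv_pow, h2]; field_simp
  rw [pairFactor, e, inv_pow, show (√R) ^ 4 = (√R ^ 2) ^ 2 by ring, h2]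
  field_simp

/-- The double integral concentrates on the diagonal as the damping tends to zero. -/
lemma tendsto_dampedForm {κ : ℝ} (hκ : 0 < κ) {f : Space → Spinor} (hf : Continuous f)
    (hc : HasCompactSupport f) :
    Tendsto (fun R : ℝ => dampedForm D (√R)⁻¹ κ f) atTop
      (𝓝 ((8 * Real.pi ^ 3 / κ ^ 3 : ℝ) * ∫ z, dbar D (f z) (act (gz D z) (f z))
        ∂hypMeasure)) := by
  set a : Space → Space → ℂ := fun z z' =>
    dbar D (act (gz D z) (f z)) (f z') + dbar D (f z) (act (gz D z') (f z')) with ha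
  have hgf : Continuous fun z => act (gz D z) (f z) :=
    continuous_act_gz_apply D continuous_id hf
  have hac : Continuous (Function.uncurry a) :=
    (continuous_dbar D (hgf.comp continuous_fst) (hf.comp continuous_snd)).add
      (continuous_dbar D (hf.comp continuous_fst) (hgf.comp continuous_snd))
  set k : ℝ → Space → Space → ℂ := fun R z z' =>
    ((√R)⁻¹ ^ 4 * pairFactor (√R)⁻¹ κ z z' : ℝ) with hk
  have haK : ∀ z z', a z z' ≠ 0 → z ∈ tsupport f ∧ z' ∈ tsupport f := by
    intro z z' h
    refine ⟨subset_tsupport f fun h' => h ?_, subset_tsupport f fun h' => h ?_⟩ <;>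
      simp [ha, h', dbar]
  set m := min 4 (κ ^ 2) with hm
  have hm0 : 0 < m := lt_min (by norm_num) (by positivity)
  have key := tendsto_integral_kernel (a := a) hac hc haK (k := k) (C := 8 * Real.pi / m ^ 2)
    (H := fun s => ((8 * Real.pi / (4 + κ ^ 2 * s) ^ 2 : ℝ) : ℂ)) ?_ ?_ ?_
  · have hv : (∫ z, a z z ∂hypMeasure) * ∫ y : Space,
        ((8 * Real.pi / (4 + κ ^ 2 * ‖y‖ ^ 2) ^ 2 : ℝ) : ℂ)
        = (8 * Real.pi ^ 3 / κ ^ 3 : ℝ) * ∫ z, dbar D (f z) (act (gz D z) (f z))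
        ∂hypMeasure := by
      rw [integral_complex_ofReal, integral_rational hκ]
      have : ∀ z, a z z = 2 * dbar D (f z) (act (gz D z) (f z)) := fun z => by
        simp only [ha]
        rw [dbar_act_gz]; ring
      simp only [this]
      rw [integral_const_mul]
      push_cast; ring
    rw [hv] at key
    refine key.congr' ?_
    filter_upwards [eventually_gt_atTop 0] with R hR
    have hs : 0 < √R := Real.sqrt_pos.mpr hR
    have hpc := continuous_pairFactor (inv_pos.mpr hs) κ
    rw [integral_smul, dampedForm, integral_prod]
    · rw [← integral_smul]
      refine integral_congr_ae (Eventually.of_forall fun z => ?_)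
      simp only []
      rw [← integral_smul]
      refine integral_congr_ae (Eventually.of_forall fun z' => ?_)
      simp only [hk, Complex.real_smul]
      rw [mul_comm (a z z'), ← mul_assoc, ← Complex.ofReal_mul]
      congr 2
      field_simp
    · refine Continuous.integrable_of_hasCompactSupport
        ((Complex.continuous_ofReal.comp (continuous_const.mul hpc)).mul hac) ?_
      refine HasCompactSupport.intro (hc.isCompact.prod hc.isCompact) fun p hp => ?_
      by_contra h
      exact hp (haK p.1 p.2 (right_ne_zero_of_mul h))
  · filter_upwards [eventually_gt_atTop 0] with R hR
    have hs : 0 < √R := Real.sqrt_pos.mpr hR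
    exact Complex.continuous_ofReal.comp
      (continuous_const.mul (continuous_pairFactor (inv_pos.mpr hs) κ))
  · filter_upwards [eventually_gt_atTop 0] with R hR z z'
    have hd := distSq_nonneg z z'
    have hRd := mul_nonneg hR.le hd
    simp only [hk]
    rw [Complex.norm_real, inv_sqrt_pow_mul_pairFactor hR, Real.norm_eq_abs,
      abs_of_nonneg (div_nonneg (bessel_nonneg _) (sq_nonneg _)), ← div_eq_mul_inv, div_div,
      ← mul_pow]
    have h1 : m * (1 + R * distSq z z') ≤ 4 + distSq z z' + κ ^ 2 * (R * distSq z z') := by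
      have h4 : m ≤ 4 := min_le_left _ _
      have h5 := mul_le_mul_of_nonneg_right (min_le_right 4 (κ ^ 2)) hRd
      rw [mul_add, mul_one]; linarith
    gcongr
    exact bessel_le _
  · intro z y
    have h1 := tendsto_distSq z y
    have hinv : Tendsto (fun R : ℝ => (√R)⁻¹) atTop (𝓝 0) :=
      tendsto_inv_atTop_zero.comp Real.tendsto_sqrt_atTop
    have h2 : Tendsto (fun R : ℝ => distSq z (z + (√R)⁻¹ • y)) atTop (𝓝 0) := by
      have hcz : Continuous fun x => distSq z x := by
        unfold distSq
        have := continuous_time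
        fun_prop
      have := (hcz.tendsto z).comp (tendsto_add_smul z y)
      have h0 : distSq z z = 0 := by simp [distSq]
      rw [h0] at this
      exact this
    have h3 : Tendsto (fun R : ℝ => bessel (pairLen (√R)⁻¹ κ z (z + (√R)⁻¹ • y))) atTop
        (𝓝 (8 * Real.pi)) := by
      rw [← bessel_zero]
      refine (continuous_bessel.tendsto 0).comp ?_
      have := (((hinv.pow 2).mul (h2.const_add 4)).add (h2.const_mul (κ ^ 2))).sqrt
      simpa [pairLen] using this
    have hq : 0 ≤ quad z y := ge_of_tendsto h1 (by
      filter_upwards [eventually_ge_atTop 0] with R hR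
      exact mul_nonneg hR (distSq_nonneg _ _))
    have h4 := h3.div (((h2.const_add 4).add (h1.const_mul (κ ^ 2))).pow 2) (by positivity)
    rw [add_zero] at h4
    refine ((Complex.continuous_ofReal.tendsto _).comp h4).congr' ?_
    filter_upwards [eventually_gt_atTop 0] with R hR
    simp only [hk, Function.comp_apply]
    rw [inv_sqrt_pow_mul_pairFactor hR]
    rfl

/-- The function which dominates the integrands of the squared norms. -/
lemma integrable_time_inv_pow : Integrable (fun u : Space => (time u)⁻¹ ^ 3) hypMeasure := by
  rw [integrable_hyp]
  have h := (integrable_rpow_neg_one_add_norm_sq (E := Space) (r := 4) (μ := volume)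
    (by rw [finrank_euclideanSpace, Fintype.card_fin]; norm_num))
  refine h.congr (Eventually.of_forall fun u => ?_)
  have ht := time_pos u
  simp only []
  rw [← time_sq, show (-(4 : ℝ) / 2) = -(2 : ℕ) by norm_num, Real.rpow_neg (by positivity),
    Real.rpow_natCast, smul_eq_mul]
  field_simp

/-- A family of damped functions whose squared norms are given by `dampedForm` converges to a
function with the norm of `f`. -/
lemma integral_limit_damped {κ : ℝ} (hκ : 0 < κ) {f : Space → Spinor} (hf : Continuous f)
    (hc : HasCompactSupport f) {A : ℝ → Space → Spinor} {C : ℝ}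
    (hA : Continuous fun p : ℝ × Space => A p.1 p.2)
    (hC : ∀ ε, 0 ≤ ε → ∀ u, ‖A ε u‖ ≤ C * ((time u)⁻¹) ^ 2)
    (hint : ∀ ε, 0 < ε → ∫ u, dbar D (A ε u) (act (gz D u) (A ε u)) ∂hypMeasure
      = dampedForm D ε κ f) :
    Integrable (fun u => dbar D (A 0 u) (act (gz D u) (A 0 u))) hypMeasure ∧
    ∫ u, dbar D (A 0 u) (act (gz D u) (A 0 u)) ∂hypMeasure
      = (8 * Real.pi ^ 3 / κ ^ 3 : ℝ) * ∫ z, dbar D (f z) (act (gz D z) (f z)) ∂hypMeasure := by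
  obtain ⟨M, hM0, hM⟩ := exists_norm_act_gz_le D
  have hC0 : 0 ≤ C := by
    have h := (norm_nonneg _).trans (hC 0 le_rfl 0)
    rw [time_zero] at h; simpa using h
  have hb : ∀ ε, 0 ≤ ε → ∀ u, ‖dbar D (A ε u) (act (gz D u) (A ε u))‖
      ≤ ‖dbarL D‖ * C * (M * C) * (time u)⁻¹ ^ 3 := by
    intro ε hε u
    have ht := time_pos u
    have h1 : ‖act (gz D u) (A ε u)‖ ≤ M * time u * (C * ((time u)⁻¹) ^ 2) :=
      ((act (gz D u)).le_opNorm _).trans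
        (mul_le_mul (hM u) (hC ε hε u) (norm_nonneg _) (by positivity))
    calc _ ≤ ‖dbarL D‖ * (C * ((time u)⁻¹) ^ 2) * (M * time u * (C * ((time u)⁻¹) ^ 2)) :=
          (norm_dbar_le D _ _).trans (by gcongr; exact hC ε hε u)
      _ = _ := by field_simp
  have hbi := integrable_time_inv_pow.const_mul (‖dbarL D‖ * C * (M * C))
  have hme : ∀ ε, AEStronglyMeasurable (fun u => dbar D (A ε u) (act (gz D u) (A ε u)))
      hypMeasure := fun ε => by
    have h : Continuous (A ε) := hA.comp (continuous_const.prodMk continuous_id)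
    exact (continuous_dbar D h (continuous_act_gz_apply D continuous_id h)).aestronglyMeasurable
  refine ⟨hbi.mono' (hme 0) (Eventually.of_forall (hb 0 le_rfl)), ?_⟩
  have hinv : Tendsto (fun R : ℝ => (√R)⁻¹) atTop (𝓝 0) :=
    tendsto_inv_atTop_zero.comp Real.tendsto_sqrt_atTop
  have hlim : Tendsto (fun R : ℝ => ∫ u, dbar D (A (√R)⁻¹ u) (act (gz D u) (A (√R)⁻¹ u))
      ∂hypMeasure) atTop (𝓝 (∫ u, dbar D (A 0 u) (act (gz D u) (A 0 u)) ∂hypMeasure)) := by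
    refine tendsto_integral_filter_of_dominated_convergence _
      (Eventually.of_forall fun R => hme _)
      (Eventually.of_forall fun R => Eventually.of_forall (hb _ (by positivity))) hbi
      (Eventually.of_forall fun u => ?_)
    have : Continuous fun ε : ℝ => dbar D (A ε u) (act (gz D u) (A ε u)) := by
      have h : Continuous fun ε => A ε u := hA.comp (continuous_id.prodMk continuous_const)
      exact continuous_dbar D h ((act (gz D u)).continuous.comp h)
    exact (this.tendsto 0).comp hinv
  refine tendsto_nhds_unique hlim ((tendsto_dampedForm D hκ hf hc).congr' ?_)
  filter_upwards [eventually_gt_atTop 0] with R hR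
  exact (hint _ (inv_pos.mpr (Real.sqrt_pos.mpr hR))).symm

end

section

attribute [local irreducible] mdot pt time

variable (D : DiracMatrices)

/-! ### The norms of the transforms of a test function -/

/-- `½ (γ·z + 1) f`. -/
def posPart (f : Space → Spinor) (z : Space) : Spinor := (1 / 2 : ℂ) • (act (gz D z) (f z) + f z)

/-- `½ (γ·z - 1) f`. -/
def negPart (f : Space → Spinor) (z : Space) : Spinor := (1 / 2 : ℂ) • (act (gz D z) (f z) - f z)

/-- The complex frequency `ε + iκ`. -/
def freq (ε κ : ℝ) : ℂ := ε + Complex.I * κ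

lemma freq_re (ε κ : ℝ) : (freq ε κ).re = ε := by simp [freq]

lemma conj_freq (ε κ : ℝ) : conj (freq ε κ) = freq ε (-κ) := by simp [freq]

lemma le_norm_freq (ε κ : ℝ) : |κ| ≤ ‖freq ε κ‖ := by
  have h := Complex.abs_im_le_norm (freq ε κ)
  simpa [freq] using h

lemma continuous_freq (κ : ℝ) : Continuous fun ε => freq ε κ :=
  Complex.continuous_ofReal.add continuous_const

lemma act_gz_posPart (f : Space → Spinor) (z : Space) :
    act (gz D z) (posPart D f z) = posPart D f z := by
  rw [posPart, map_smul, map_add, act_gz_gz, add_comm]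

lemma act_gz_negPart (f : Space → Spinor) (z : Space) :
    act (gz D z) (negPart D f z) = -negPart D f z := by
  rw [negPart, map_smul, map_sub, act_gz_gz, ← smul_neg, neg_sub]

variable {D} in
lemma contDiff_gz_apply {n : WithTop ℕ∞} {f : Space → Spinor} (hf : ContDiff ℝ n f) :
    ContDiff ℝ n fun z => act (gz D z) (f z) := contDiff_apply (contDiff_act_gz D) hf

lemma contDiff_posPart {n : WithTop ℕ∞} {f : Space → Spinor} (hf : ContDiff ℝ n f) :
    ContDiff ℝ n (posPart D f) := ((contDiff_gz_apply hf).add hf).const_smul _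

lemma contDiff_negPart {n : WithTop ℕ∞} {f : Space → Spinor} (hf : ContDiff ℝ n f) :
    ContDiff ℝ n (negPart D f) := ((contDiff_gz_apply hf).sub hf).const_smul _

lemma dbar_neg_left (x y : Spinor) : dbar D (-x) y = -dbar D x y := by simp [dbar]

lemma dbar_neg_right (x y : Spinor) : dbar D x (-y) = -dbar D x y := by simp [dbar]

lemma integral_add_add {X : Type*} [MeasurableSpace X] {μ : Measure X} {p q r s : X → ℂ}
    (hp : Integrable p μ) (hq : Integrable q μ) (hr : Integrable r μ) (hs : Integrable s μ) :
    ∫ x, p x + q x + (r x + s x) ∂μ = ∫ x, p x ∂μ + ∫ x, q x ∂μ + (∫ x, r x ∂μ + ∫ x, s x ∂μ) := by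
  have h1 : Integrable (fun x => p x + q x) μ := hp.add hq
  have h2 : Integrable (fun x => r x + s x) μ := hr.add hs
  rw [integral_add h1 h2, integral_add hp hq, integral_add hr hs]

variable {f : Space → Spinor}

lemma hasCompactSupport_of_zero (hc : HasCompactSupport f) {g : Space → Spinor}
    (h : ∀ z, f z = 0 → g z = 0) : HasCompactSupport g :=
  hc.mono fun z hz h' => hz (h z h')

lemma hasCompactSupport_gz (hc : HasCompactSupport f) :
    HasCompactSupport fun z => act (gz D z) (f z) :=
  hasCompactSupport_of_zero hc fun z h => by simp [h]

lemma hasCompactSupport_posPart (hc : HasCompactSupport f) : HasCompactSupport (posPart D f) :=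
  hasCompactSupport_of_zero hc fun z h => by simp [posPart, h]

lemma hasCompactSupport_negPart (hc : HasCompactSupport f) : HasCompactSupport (negPart D f) :=
  hasCompactSupport_of_zero hc fun z h => by simp [negPart, h]

/-- Continuity and compactness of the support. -/
def ContinuousCompact (φ : Space → Spinor) : Prop := Continuous φ ∧ HasCompactSupport φ

lemma ContinuousCompact.posPart (h : ContinuousCompact f) : ContinuousCompact (posPart D f) :=
  ⟨(contDiff_posPart D (n := 0) (contDiff_zero.mpr h.1)).continuous,
    hasCompactSupport_posPart D h.2⟩

lemma ContinuousCompact.negPart (h : ContinuousCompact f) : ContinuousCompact (negPart D f) :=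
  ⟨(contDiff_negPart D (n := 0) (contDiff_zero.mpr h.1)).continuous,
    hasCompactSupport_negPart D h.2⟩

lemma continuous_wave_freq {g : Space → Spinor} (hg : Continuous g) (hc : HasCompactSupport g)
    (κ : ℝ) : Continuous fun p : ℝ × Space => wave (freq p.1 κ) g p.2 :=
  (continuous_wave hg hc).comp
    (((continuous_freq κ).comp continuous_fst).prodMk continuous_snd)

lemma freqVec_freq (ε κ : ℝ) (z z' : Space) :
    freqVec (freq ε (-κ)) (freq ε κ) z z' = pairVec ε κ z z' := by
  rw [← conj_freq]; exact freqVec_conj_self ε κ z z'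

lemma freqVec_freq' (ε κ : ℝ) (z z' : Space) :
    freqVec (freq ε κ) (freq ε (-κ)) z z' = pairVec ε (-κ) z z' := by
  simpa using freqVec_freq ε (-κ) z z'

/-- The damped form of the transform `F`. -/
def dampedF (κ : ℝ) (f : Space → Spinor) (ε : ℝ) (u : Space) : Spinor :=
  wave (freq ε κ) (posPart D f) u + wave (freq ε (-κ)) (negPart D f) u

/-- The damped form of the transform `F*`. -/
def dampedFStar (κ : ℝ) (f : Space → Spinor) (ε : ℝ) (u : Space) : Spinor :=
  posPart D (wave (freq ε (-κ)) fun z => act (gz D z) (f z)) u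
    - negPart D (wave (freq ε κ) fun z => act (gz D z) (f z)) u

variable {D} in
/-- The pairings of the positive with the negative part vanish, since the eigenvalues of `γ·z`
and `γ·z'` enter with opposite signs and equal frequencies; the other two sum up to `dampedForm`. -/
lemma integral_dampedF {ε : ℝ} (hε : 0 < ε) (κ : ℝ) (hf : Continuous f)
    (hc : HasCompactSupport f) :
    ∫ u, dbar D (dampedF D κ f ε u) (act (gz D u) (dampedF D κ f ε u)) ∂hypMeasure
      = dampedForm D ε κ f := by
  obtain ⟨b, -, hb⟩ := exists_norm_act_gz_le D
  have hl : ∀ κ, 0 < (freq ε κ).re := fun κ => by rwa [freq_re]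
  have hp := (contDiff_posPart D (n := 0) (contDiff_zero.mpr hf)).continuous
  have hn := (contDiff_negPart D (n := 0) (contDiff_zero.mpr hf)).continuous
  have hpc := hasCompactSupport_posPart D hc
  have hnc := hasCompactSupport_negPart D hc
  have hB := continuous_act_gz D
  obtain ⟨i1, j1, e1⟩ := integral_dbar_wave D (hl κ) (hl κ) hp hpc hp hpc hB hb
    (J := fun z z' => pairFactor ε κ z z' * (2 * ε * dbar D (posPart D f z) (posPart D f z')))
    fun z z' => by
      rw [conj_freq, integral_cexp_mul_dbar_gz D (hl _) (hl _), freqVec_freq,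
        moment_freqVec_div hε, act_gz_posPart, act_gz_posPart]
      simp only [freq]; push_cast; ring
  obtain ⟨i2, j2, e2⟩ := integral_dbar_wave D (hl κ) (hl (-κ)) hp hpc hn hnc hB hb
    (J := fun z z' => 0)
    fun z z' => by
      rw [conj_freq, integral_cexp_mul_dbar_gz D (hl _) (hl _), act_gz_posPart, act_gz_negPart,
        dbar_neg_right]
      ring
  obtain ⟨i3, j3, e3⟩ := integral_dbar_wave D (hl (-κ)) (hl κ) hn hnc hp hpc hB hb
    (J := fun z z' => 0)
    fun z z' => by
      rw [conj_freq, integral_cexp_mul_dbar_gz D (hl _) (hl _), act_gz_posPart, act_gz_negPart,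
        dbar_neg_left, neg_neg]
      ring
  obtain ⟨i4, j4, e4⟩ := integral_dbar_wave D (hl (-κ)) (hl (-κ)) hn hnc hn hnc hB hb
    (J := fun z z' => pairFactor ε κ z z' * (-2 * ε * dbar D (negPart D f z) (negPart D f z')))
    fun z z' => by
      rw [conj_freq, neg_neg, integral_cexp_mul_dbar_gz D (hl _) (hl _), freqVec_freq',
        moment_freqVec_div hε, pairFactor_neg, act_gz_negPart, act_gz_negPart,
        dbar_neg_right, dbar_neg_left]
      simp only [freq]; push_cast; ring
  simp only [dampedF, map_add, dbar_add_left, dbar_add_right]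
  rw [integral_add_add i1 i3 i2 i4, e1, e2, e3, e4,
    integral_zero, add_zero, zero_add, ← integral_add j1 j4, dampedForm]
  refine integral_congr_ae (Eventually.of_forall fun p => ?_)
  simp only [posPart, negPart, dbar_smul_left, dbar_smul_right, dbar_add_left, dbar_add_right,
    dbar_sub_left, dbar_sub_right, map_div₀, map_one, map_ofNat]
  push_cast
  ring

variable {D} in
/-- Expanding the projections at `u`, the pairings without `γ·u` reduce to Laplace transforms
and cancel, by `laplace_pairVec_neg`; those with `γ·u` give `dampedForm`. -/
lemma integral_dampedFStar {ε : ℝ} (hε : 0 < ε) (κ : ℝ) (hf : Continuous f)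
    (hc : HasCompactSupport f) :
    ∫ u, dbar D (dampedFStar D κ f ε u) (act (gz D u) (dampedFStar D κ f ε u)) ∂hypMeasure
      = dampedForm D ε κ f := by
  obtain ⟨b, -, hb⟩ := exists_norm_act_gz_le D
  have hl : ∀ κ, 0 < (freq ε κ).re := fun κ => by rwa [freq_re]
  set g : Space → Spinor := fun z => act (gz D z) (f z) with hgdef
  have hgz : ∀ z, act (gz D z) (g z) = f z := fun z => act_gz_gz D z _
  have hg : Continuous g := (contDiff_gz_apply (n := 0) (contDiff_zero.mpr hf)).continuous
  have hgc : HasCompactSupport g := hasCompactSupport_gz D hc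
  have hB := continuous_act_gz D
  have hB1 : Continuous fun _ : Space => ContinuousLinearMap.id ℂ Spinor := continuous_const
  have hb1 : ∀ u : Space, ‖ContinuousLinearMap.id ℂ Spinor‖ ≤ 1 * time u := fun u => by
    rw [one_mul]; exact ContinuousLinearMap.norm_id_le.trans (one_le_time u)
  obtain ⟨i1, j1, e1⟩ := integral_dbar_wave D (hl κ) (hl κ) hg hgc hg hgc hB hb
    (J := fun z z' => pairFactor ε κ z z' * (freq ε (-κ) * dbar D (f z) (g z')
      + freq ε κ * dbar D (g z) (f z')))
    fun z z' => by
      rw [conj_freq, integral_cexp_mul_dbar_gz D (hl _) (hl _), freqVec_freq,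
        moment_freqVec_div hε, hgz, hgz]
  obtain ⟨i2, j2, e2⟩ := integral_dbar_wave D (hl (-κ)) (hl (-κ)) hg hgc hg hgc hB hb
    (J := fun z z' => pairFactor ε κ z z' * (freq ε κ * dbar D (f z) (g z')
      + freq ε (-κ) * dbar D (g z) (f z')))
    fun z z' => by
      rw [conj_freq, neg_neg, integral_cexp_mul_dbar_gz D (hl _) (hl _), freqVec_freq',
        moment_freqVec_div hε, pairFactor_neg, hgz, hgz]
  obtain ⟨i3, j3, e3⟩ := integral_dbar_wave D (hl κ) (hl κ) hg hgc hg hgc hB1 hb1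
    (J := fun z z' => laplace (pairVec ε κ z z') * dbar D (g z) (g z'))
    fun z z' => by
      simp only [ContinuousLinearMap.id_apply]
      rw [conj_freq, integral_cexp_mul_dbar, freqVec_freq]
  obtain ⟨i4, j4, e4⟩ := integral_dbar_wave D (hl (-κ)) (hl (-κ)) hg hgc hg hgc hB1 hb1
    (J := fun z z' => laplace (pairVec ε κ z z') * dbar D (g z) (g z'))
    fun z z' => by
      simp only [ContinuousLinearMap.id_apply]
      rw [conj_freq, neg_neg, integral_cexp_mul_dbar, freqVec_freq', laplace_pairVec_neg hε]
  -- `γ·u` is eliminated on the left, so that the plain pairing survives with opposite signs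
  have e : ∀ u, dbar D (dampedFStar D κ f ε u) (act (gz D u) (dampedFStar D κ f ε u))
      = (1 / 2 : ℂ) * ((dbar D (wave (freq ε (-κ)) g u) (act (gz D u) (wave (freq ε (-κ)) g u))
        + dbar D (wave (freq ε κ) g u) (act (gz D u) (wave (freq ε κ) g u)))
        + (dbar D (wave (freq ε (-κ)) g u) (wave (freq ε (-κ)) g u)
        - dbar D (wave (freq ε κ) g u) (wave (freq ε κ) g u))) := by
    intro u
    simp only [dampedFStar]
    rw [map_sub, act_gz_posPart, act_gz_negPart]
    simp only [posPart, negPart, dbar_smul_left, dbar_smul_right, dbar_add_left, dbar_add_right,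
      dbar_sub_left, dbar_sub_right, map_div₀, map_one, map_ofNat, ← smul_neg, neg_sub,
      dbar_act_gz, act_gz_gz]
    ring
  simp only [ContinuousLinearMap.id_apply] at i3 i4 e3 e4
  simp only [e, sub_eq_add_neg]
  rw [integral_const_mul, integral_add_add i2 i1 i4 i3.fun_neg, integral_neg, e1, e2, e3, e4,
    ← sub_eq_add_neg, sub_self, add_zero, ← integral_add j2 j1,
    ← integral_const_mul, dampedForm]
  refine integral_congr_ae (Eventually.of_forall fun p => ?_)
  simp only [freq, hgdef]
  push_cast
  ring

/-! ### Explicit form of the two transforms -/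

/-- The normalisation `(κ/2π)^{3/2}`. -/
def coeff (κ : ℝ) : ℝ := (κ / (2 * Real.pi)) ^ (3 / 2 : ℝ)

/-- The normalisation compensates the constant in the limit of `dampedForm`. -/
lemma coeff_sq {κ : ℝ} (hκ : 0 < κ) : coeff κ ^ 2 * (8 * Real.pi ^ 3 / κ ^ 3) = 1 := by
  have hp := Real.pi_pos
  rw [coeff, ← Real.rpow_natCast, ← Real.rpow_mul (by positivity),
    show (3 / 2 : ℝ) * (2 : ℕ) = (3 : ℕ) by norm_num, Real.rpow_natCast]
  field_simp
  ring

/-- The exponential of the involution `γ·z` acts by `e^c` and `e^{-c}` on its eigenspaces. -/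
lemma act_exp (c : ℂ) (z : Space) (x : Spinor) :
    act (NormedSpace.exp (c • gz D z)) x
      = (1 / 2 : ℂ) • (Complex.exp c • (x + act (gz D z) x)
        + Complex.exp (-c) • (x - act (gz D z) x)) := by
  rw [exp_smul_of_mul_self_eq_one (gz_sq D z), act_add, act_smul, act_smul, act_one,
    Complex.cosh, Complex.sinh]
  module

/-- Splitting `γ·z f` by the eigenvalues of `γ·z` turns the transform into two superpositions of
scalar plane waves of opposite frequencies. -/
lemma fourierInt_eq (κ : ℝ) (hf : Continuous f) (hc : HasCompactSupport f) (u : Space) :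
    fourierInt D κ f u = (coeff κ : ℂ) • dampedF D κ f 0 u := by
  rw [fourierInt, dampedF, coeff]
  congr 1
  have hp := (contDiff_posPart D (n := 0) (contDiff_zero.mpr hf)).continuous
  have hn := (contDiff_negPart D (n := 0) (contDiff_zero.mpr hf)).continuous
  rw [wave, wave, ← integral_add (integrable_wave hp (hasCompactSupport_posPart D hc) _ u)
    (integrable_wave hn (hasCompactSupport_negPart D hc) _ u)]
  refine integral_congr_ae (Eventually.of_forall fun z => ?_)
  simp only [freq, posPart, negPart]
  rw [act_exp, act_gz_gz, Complex.ofReal_neg, Complex.ofReal_zero]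
  rw [show -Complex.I * κ * mdot (pt u) (pt z) = -((0 + Complex.I * κ) * mdot (pt u) (pt z)) by
    ring, show -((0 + Complex.I * -(κ : ℂ)) * mdot (pt u) (pt z))
      = - -((0 + Complex.I * κ) * mdot (pt u) (pt z)) by ring]
  module

/-- Here the projections to the eigenspaces of `γ·u` stand outside of the integral. -/
lemma fourierStarInt_eq (κ : ℝ) (hf : Continuous f) (hc : HasCompactSupport f) (u : Space) :
    fourierStarInt D κ f u = (coeff κ : ℂ) • dampedFStar D κ f 0 u := by
  rw [fourierStarInt, dampedFStar, coeff]
  congr 1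
  have hg : Continuous fun z => act (gz D z) (f z) :=
    (contDiff_gz_apply (n := 0) (contDiff_zero.mpr hf)).continuous
  have hgc := hasCompactSupport_gz D hc
  have hi := fun l => integrable_wave hg hgc l u
  have hA : ∀ A : Spinor →L[ℂ] Spinor, ∀ l : ℂ,
      A (wave l (fun z => act (gz D z) (f z)) u) = ∫ z,
        A (Complex.exp (-(l * mdot (pt u) (pt z))) • act (gz D z) (f z)) ∂hypMeasure :=
    fun A l => (A.integral_comp_comm (hi l)).symm
  have h1 : ∀ x : Spinor, (1 / 2 : ℂ) • (act (gz D u) x + x)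
      = ((1 / 2 : ℂ) • (act (gz D u) + ContinuousLinearMap.id ℂ Spinor)) x := fun x => by simp
  have h2 : ∀ x : Spinor, (1 / 2 : ℂ) • (act (gz D u) x - x)
      = ((1 / 2 : ℂ) • (act (gz D u) - ContinuousLinearMap.id ℂ Spinor)) x := fun x => by simp
  rw [posPart, negPart, h1, h2, hA, hA, ← integral_sub
    (ContinuousLinearMap.integrable_comp _ (hi _)) (ContinuousLinearMap.integrable_comp _ (hi _))]
  refine integral_congr_ae (Eventually.of_forall fun z => ?_)
  simp only [freq]
  rw [act_exp, ← h1, ← h2, map_smul, map_smul, Complex.ofReal_neg, Complex.ofReal_zero]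
  rw [show -((0 + Complex.I * -(κ : ℂ)) * mdot (pt u) (pt z))
      = Complex.I * κ * mdot (pt u) (pt z) by ring,
    show -((0 + Complex.I * (κ : ℂ)) * mdot (pt u) (pt z))
      = -(Complex.I * κ * mdot (pt u) (pt z)) by ring]
  module

/-! ### Both transforms preserve the norm of test functions -/

/-- A bound uniform in the damping, which dominates the limit `ε → 0`. -/
lemma exists_norm_wave_freq_le {κ : ℝ} (hκ : κ ≠ 0) (N : ℕ) {g : Space → Spinor}
    (hg : ContDiff ℝ (⊤ : ℕ∞) g) (hc : HasCompactSupport g) :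
    ∃ C, 0 ≤ C ∧ ∀ ε, 0 ≤ ε → ∀ u, ‖wave (freq ε κ) g u‖ ≤ C * ((time u)⁻¹) ^ N := by
  obtain ⟨C, hC⟩ := exists_norm_wave_le (abs_pos.mpr hκ) N g hg hc
  refine ⟨|C|, abs_nonneg C, fun ε hε u =>
    (hC _ (by rwa [freq_re]) (le_norm_freq ε κ) u).trans ?_⟩
  have := time_pos u
  gcongr
  exact le_abs_self C

lemma continuous_section {A : ℝ → Space → Spinor} (h : Continuous fun p : ℝ × Space => A p.1 p.2)
    (ε : ℝ) : Continuous (A ε) := h.comp (continuous_const.prodMk continuous_id)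

/-- The normalisation `coeff κ` makes the limit isometric. -/
lemma norm_smul_limit {κ : ℝ} (hκ : 0 < κ) {A : Space → Spinor}
    (h : Integrable (fun u => dbar D (A u) (act (gz D u) (A u))) hypMeasure ∧
    ∫ u, dbar D (A u) (act (gz D u) (A u)) ∂hypMeasure
      = (8 * Real.pi ^ 3 / κ ^ 3 : ℝ) * ∫ z, dbar D (f z) (act (gz D z) (f z)) ∂hypMeasure) :
    Integrable (fun u => dbar D ((coeff κ : ℂ) • A u) (act (gz D u) ((coeff κ : ℂ) • A u)))
      hypMeasure ∧
    ∫ u, dbar D ((coeff κ : ℂ) • A u) (act (gz D u) ((coeff κ : ℂ) • A u)) ∂hypMeasure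
      = ∫ z, dbar D (f z) (act (gz D z) (f z)) ∂hypMeasure := by
  have e : ∀ u, dbar D ((coeff κ : ℂ) • A u) (act (gz D u) ((coeff κ : ℂ) • A u))
      = (coeff κ ^ 2 : ℝ) * dbar D (A u) (act (gz D u) (A u)) := fun u => by
    rw [map_smul, dbar_smul_left, dbar_smul_right, Complex.conj_ofReal]; push_cast; ring
  simp only [e]
  refine ⟨h.1.const_mul _, ?_⟩
  rw [integral_const_mul, h.2, ← mul_assoc, ← Complex.ofReal_mul, coeff_sq hκ, Complex.ofReal_one,
    one_mul]

variable {D} in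
lemma fourierInt_isometric {κ : ℝ} (hκ : 0 < κ) (hf : ContDiff ℝ (⊤ : ℕ∞) f)
    (hc : HasCompactSupport f) : Continuous (fourierInt D κ f) ∧
    Integrable (fun u => dbar D (fourierInt D κ f u) (act (gz D u) (fourierInt D κ f u)))
      hypMeasure ∧
    ∫ u, dbar D (fourierInt D κ f u) (act (gz D u) (fourierInt D κ f u)) ∂hypMeasure
      = ∫ z, dbar D (f z) (act (gz D z) (f z)) ∂hypMeasure := by
  have hp := contDiff_posPart D hf
  have hn := contDiff_negPart D hf
  have hpc := hasCompactSupport_posPart D hc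
  have hnc := hasCompactSupport_negPart D hc
  obtain ⟨C1, -, h1⟩ := exists_norm_wave_freq_le hκ.ne' 2 hp hpc
  obtain ⟨C2, -, h2⟩ := exists_norm_wave_freq_le (neg_ne_zero.mpr hκ.ne') 2 hn hnc
  have hA : Continuous fun p : ℝ × Space => dampedF D κ f p.1 p.2 := by
    simp only [dampedF]
    exact (continuous_wave_freq hp.continuous hpc κ).add
      (continuous_wave_freq hn.continuous hnc (-κ))
  have hA0 := continuous_section hA 0
  have e : fourierInt D κ f = fun u => (coeff κ : ℂ) • dampedF D κ f 0 u :=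
    funext fun u => fourierInt_eq D κ hf.continuous hc u
  rw [e]
  refine ⟨hA0.const_smul (coeff κ : ℂ), ?_⟩
  refine norm_smul_limit D (A := dampedF D κ f 0) hκ
    (integral_limit_damped D hκ hf.continuous hc (C := C1 + C2) hA (fun ε hε u => ?_)
      fun ε hε => integral_dampedF hε κ hf.continuous hc)
  rw [add_mul]
  exact (norm_add_le _ _).trans (add_le_add (h1 ε hε u) (h2 ε hε u))

variable {D} in
lemma fourierStarInt_isometric {κ : ℝ} (hκ : 0 < κ) (hf : ContDiff ℝ (⊤ : ℕ∞) f)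
    (hc : HasCompactSupport f) : Continuous (fourierStarInt D κ f) ∧
    Integrable (fun u => dbar D (fourierStarInt D κ f u)
      (act (gz D u) (fourierStarInt D κ f u))) hypMeasure ∧
    ∫ u, dbar D (fourierStarInt D κ f u) (act (gz D u) (fourierStarInt D κ f u)) ∂hypMeasure
      = ∫ z, dbar D (f z) (act (gz D z) (f z)) ∂hypMeasure := by
  obtain ⟨M, hM0, hM⟩ := exists_norm_act_gz_le D
  have hg : ContDiff ℝ (⊤ : ℕ∞) fun z => act (gz D z) (f z) := contDiff_gz_apply hf
  have hgc := hasCompactSupport_gz D hc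
  obtain ⟨C1, hC1, h1⟩ := exists_norm_wave_freq_le hκ.ne' 3 hg hgc
  obtain ⟨C2, hC2, h2⟩ := exists_norm_wave_freq_le (neg_ne_zero.mpr hκ.ne') 3 hg hgc
  have hw := continuous_wave_freq hg.continuous hgc κ
  have hw' := continuous_wave_freq hg.continuous hgc (-κ)
  have hA : Continuous fun p : ℝ × Space => dampedFStar D κ f p.1 p.2 := by
    simp only [dampedFStar, posPart, negPart]
    exact (((continuous_act_gz_apply D continuous_snd hw').add hw').const_smul (1 / 2 : ℂ)).sub
      (((continuous_act_gz_apply D continuous_snd hw).sub hw).const_smul (1 / 2 : ℂ))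
  have hA0 := continuous_section hA 0
  have e : fourierStarInt D κ f = fun u => (coeff κ : ℂ) • dampedFStar D κ f 0 u :=
    funext fun u => fourierStarInt_eq D κ hf.continuous hc u
  rw [e]
  refine ⟨hA0.const_smul (coeff κ : ℂ), ?_⟩
  refine norm_smul_limit D (A := dampedFStar D κ f 0) hκ
    (integral_limit_damped D hκ hf.continuous hc (C := (M + 1) * (C1 + C2)) hA (fun ε hε u => ?_)
    fun ε hε => integral_dampedFStar hε κ hf.continuous hc)
  have ht := time_pos u
  have h3 : ∀ {C : ℝ} {x : Spinor}, 0 ≤ C → ‖x‖ ≤ C * (time u)⁻¹ ^ 3 →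
      ‖act (gz D u) x‖ + ‖x‖ ≤ (M + 1) * C * (time u)⁻¹ ^ 2 := by
    intro C x hC hx
    have ha : ‖act (gz D u) x‖ ≤ M * time u * ‖x‖ :=
      ((act (gz D u)).le_opNorm _).trans (by gcongr; exact hM u)
    have hb : ‖x‖ ≤ time u * ‖x‖ := le_mul_of_one_le_left (norm_nonneg _) (one_le_time u)
    calc _ ≤ (M + 1) * time u * ‖x‖ := by linarith
      _ ≤ (M + 1) * time u * (C * (time u)⁻¹ ^ 3) := by gcongr
      _ = _ := by field_simp
  have hhalf : ∀ x : Spinor, ‖(1 / 2 : ℂ) • x‖ ≤ ‖x‖ := fun x => by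
    rw [norm_smul]; refine mul_le_of_le_one_left (norm_nonneg _) (by norm_num)
  have h4 := h3 hC2 (h2 ε hε u)
  have h5 := h3 hC1 (h1 ε hε u)
  calc _ ≤ _ := norm_sub_le _ _
    _ ≤ _ := add_le_add ((hhalf _).trans (norm_add_le _ _)) ((hhalf _).trans (norm_sub_le _ _))
    _ ≤ _ := add_le_add h4 h5
    _ = _ := by ring

end

section

attribute [local irreducible] mdot pt time

variable (D : DiracMatrices)

/-! ### Test functions in the Hilbert space -/

/-- The space of smooth spinor functions of compact support. -/
def testSubmodule : Submodule ℂ (Space → Spinor) where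
  carrier := {f | ContDiff ℝ (⊤ : ℕ∞) f ∧ HasCompactSupport f}
  zero_mem' := ⟨contDiff_const, HasCompactSupport.zero⟩
  add_mem' := fun hf hg => ⟨hf.1.add hg.1, hf.2.add hg.2⟩
  smul_mem' := fun c _ hf => ⟨hf.1.const_smul c,
    hasCompactSupport_of_zero hf.2 fun z h => by simp [h]⟩

/-- An element of `testSubmodule` as a function of class `C₀^∞`. -/
def toTest (f : testSubmodule) : C0 ((⊤ : ℕ∞) : WithTop ℕ∞) := ⟨f.1, f.2.1, f.2.2⟩

lemma toState_fn {k : WithTop ℕ∞} (f : C0 k) : (toState D f).fn =ᵐ[hypMeasure] f.toFun :=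
  State.mk_fn _ _ _

/-- The embedding of the test functions as a linear map. -/
def testState : testSubmodule →ₗ[ℂ] State D where
  toFun f := toState D (toTest f)
  map_add' f g := by
    refine State.ext' ?_
    filter_upwards [toState_fn D (toTest (f + g)), toState_fn D (toTest f),
      toState_fn D (toTest g), State.add_fn (toState D (toTest f)) (toState D (toTest g))]
      with z h1 h2 h3 h4
    rw [h1, h4, h2, h3]; rfl
  map_smul' c f := by
    refine State.ext' ?_
    filter_upwards [toState_fn D (toTest (c • f)), toState_fn D (toTest f),
      State.smul_fn c (toState D (toTest f))] with z h1 h2 h3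
    rw [h1, RingHom.id_apply, h3, h2]; rfl

variable {D} in
/-- The integrand of the scalar product with a constant spinor is locally integrable, so that it
vanishes almost everywhere if it is orthogonal to all test functions. -/
lemma State.locallyIntegrable_dbar (h : State D) (x : Spinor) :
    LocallyIntegrable (fun z => dbar D x (act (gz D z) (h.fn z))) hypMeasure := by
  have hm : AEStronglyMeasurable (fun z => dbar D x (act (gz D z) (h.fn z))) hypMeasure :=
    (dbarL D x).continuous.comp_aestronglyMeasurable (aesm_act (continuous_act_gz D) h.aesm)
  have hL : LocallyIntegrable (fun z => act (root D z) (h.fn z)) hypMeasure :=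
    h.memLp.locallyIntegrable one_le_two
  rw [locallyIntegrable_iff] at hL ⊢
  intro K hK
  have hc : Continuous fun z => act (root D z) x :=
    (continuous_act_root D).clm_apply continuous_const
  obtain ⟨M, hM⟩ := hK.exists_bound_of_continuousOn hc.continuousOn
  refine ((hL K hK).norm.const_mul M).mono' hm.restrict ?_
  refine (ae_restrict_iff' hK.measurableSet).mpr (Eventually.of_forall fun z hz => ?_)
  rw [dbar_gz]
  exact (norm_inner_le_norm _ _).trans (by gcongr; exact hM z hz)

lemma denseRange_testState : DenseRange (testState D) := by
  have h : (LinearMap.range (testState D)).topologicalClosure = ⊤ := by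
    rw [Submodule.topologicalClosure_eq_top_iff, Submodule.eq_bot_iff]
    intro k hk
    rw [Submodule.mem_orthogonal] at hk
    have hx : ∀ x : Spinor, ∀ᵐ z ∂hypMeasure, dbar D x (act (gz D z) (k.fn z)) = 0 := by
      intro x
      refine ae_eq_zero_of_integral_contDiff_smul_eq_zero (k.locallyIntegrable_dbar x)
        fun φ hφ hφc => ?_
      have hmem : (fun z => (φ z : ℂ) • x) ∈ testSubmodule :=
        ⟨contDiff_csmul (contDiff_ofReal hφ) contDiff_const,
          hφc.mono fun z hz h => hz (by simp [h])⟩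
      have h0 := hk _ ⟨⟨_, hmem⟩, rfl⟩
      rw [State.inner_def] at h0
      rw [← h0]
      refine integral_congr_ae ?_
      filter_upwards [toState_fn D (toTest ⟨_, hmem⟩)] with z hz
      change _ = dbar D ((toState D (toTest ⟨_, hmem⟩)).fn z) _
      rw [hz]
      simp only [toTest]
      rw [dbar_smul_left, Complex.conj_ofReal, Complex.real_smul]
    refine State.ext' ?_
    have hall : ∀ᵐ z ∂hypMeasure, ∀ i : Fin 4,
        dbar D (EuclideanSpace.single i 1) (act (gz D z) (k.fn z)) = 0 :=
      ae_all_iff.mpr fun i => hx _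
    filter_upwards [hall, State.zero_fn (D := D)] with z hz h0
    rw [h0]
    have h1 : act (D.mat 0) (act (gz D z) (k.fn z)) = 0 := by
      ext i
      have := hz i
      rw [dbar, EuclideanSpace.inner_single_left] at this
      simpa using this
    have h2 : act (gz D z) (k.fn z) = 0 := by
      rw [← act_one (act (gz D z) (k.fn z)), ← mat_zero_sq D, act_mul, h1, map_zero]
    rw [← act_gz_gz D z (k.fn z), h2, map_zero]
  intro x
  have : x ∈ (LinearMap.range (testState D)).topologicalClosure := by rw [h]; trivial
  exact this

variable {D}

lemma denseRange_toState :
    DenseRange fun f : C0 ((⊤ : ℕ∞) : WithTop ℕ∞) => toState D f := by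
  refine (denseRange_testState D).mono ?_
  rintro _ ⟨f, rfl⟩
  exact ⟨toTest f, rfl⟩

lemma norm_eq_of_inner_self {g k : State D} (h : (inner ℂ g g : ℂ) = inner ℂ k k) :
    ‖g‖ = ‖k‖ := by
  rw [inner_self_eq_norm_sq_to_K, inner_self_eq_norm_sq_to_K] at h
  have h' : ‖g‖ ^ 2 = ‖k‖ ^ 2 := by exact_mod_cast h
  exact (sq_eq_sq₀ (norm_nonneg _) (norm_nonneg _)).mp h'

/-- A transformation of test functions which is linear and preserves the norm extends to an
isometric operator on the Hilbert space. -/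
lemma exists_extends {t : (Space → Spinor) → Space → Spinor}
    (hadd : ∀ f ∈ testSubmodule, ∀ g ∈ testSubmodule, t (f + g) = t f + t g)
    (hsmul : ∀ (c : ℂ), ∀ f ∈ testSubmodule, t (c • f) = c • t f)
    (ht : ∀ f ∈ testSubmodule, Continuous (t f) ∧
      Integrable (fun u => dbar D (t f u) (act (gz D u) (t f u))) hypMeasure ∧
      ∫ u, dbar D (t f u) (act (gz D u) (t f u)) ∂hypMeasure
        = ∫ z, dbar D (f z) (act (gz D z) (f z)) ∂hypMeasure) :
    ∃ A : State D →L[ℂ] State D, Extends A t ∧ ∀ x, ‖A x‖ = ‖x‖ := by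
  set L : testSubmodule →ₗ[ℂ] State D :=
    { toFun := fun f => State.mk D (t f) (ht f f.2).1.aestronglyMeasurable (ht f f.2).2.1
      map_add' := fun f g => by
        refine State.ext' ?_
        filter_upwards [State.mk_fn (D := D) _ (ht _ (f + g).2).1.aestronglyMeasurable
            (ht _ (f + g).2).2.1,
          State.mk_fn (D := D) _ (ht f f.2).1.aestronglyMeasurable (ht f f.2).2.1,
          State.mk_fn (D := D) _ (ht g g.2).1.aestronglyMeasurable (ht g g.2).2.1,
          State.add_fn (State.mk D (t f) (ht f f.2).1.aestronglyMeasurable (ht f f.2).2.1)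
            (State.mk D (t g) (ht g g.2).1.aestronglyMeasurable (ht g g.2).2.1)]
          with z h1 h2 h3 h4
        rw [h1, h4, h2, h3]
        exact congrFun (hadd f f.2 g g.2) z
      map_smul' := fun c f => by
        refine State.ext' ?_
        filter_upwards [State.mk_fn (D := D) _ (ht _ (c • f).2).1.aestronglyMeasurable
            (ht _ (c • f).2).2.1,
          State.mk_fn (D := D) _ (ht f f.2).1.aestronglyMeasurable (ht f f.2).2.1,
          State.smul_fn c (State.mk D (t f) (ht f f.2).1.aestronglyMeasurable (ht f f.2).2.1)]
          with z h1 h2 h3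
        rw [h1, RingHom.id_apply, h3, h2]
        exact congrFun (hsmul c f f.2) z } with hL
  have hLfn : ∀ f, (L f).fn =ᵐ[hypMeasure] t f := fun f =>
    State.mk_fn _ (ht f f.2).1.aestronglyMeasurable (ht f f.2).2.1
  have hn : ∀ f, ‖L f‖ = ‖testState D f‖ := by
    intro f
    refine norm_eq_of_inner_self ?_
    rw [State.inner_def, State.inner_def]
    have e1 : ∫ z, dbar D ((L f).fn z) (act (gz D z) ((L f).fn z)) ∂hypMeasure
        = ∫ z, dbar D (t f z) (act (gz D z) (t f z)) ∂hypMeasure := by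
      refine integral_congr_ae ?_
      filter_upwards [hLfn f] with z hz
      rw [hz]
    rw [e1, (ht f f.2).2.2]
    refine integral_congr_ae ?_
    filter_upwards [toState_fn D (toTest f)] with z hz
    change _ = dbar D ((toState D (toTest f)).fn z) (act (gz D z) ((toState D (toTest f)).fn z))
    rw [hz]; rfl
  have hd := denseRange_testState D
  have hb : ∀ f, ‖L f‖ ≤ 1 * ‖testState D f‖ := fun f => by rw [hn, one_mul]
  have hA := fun f => LinearMap.extendOfNorm_eq hd ⟨1, hb⟩ f
  refine ⟨L.extendOfNorm (testState D), fun g => ?_, fun x => ?_⟩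
  · have h := hA ⟨g.toFun, g.contDiff, g.compact⟩
    change (L.extendOfNorm (testState D)) (toState D g) = _ at h
    rw [h]
    exact hLfn _
  · refine hd.induction (P := fun x => ‖(L.extendOfNorm (testState D)) x‖ = ‖x‖) ?_
      (isClosed_eq (by fun_prop) (by fun_prop)) x
    rintro _ ⟨f, rfl⟩
    rw [hA, hn]

lemma Extends.unique {A B : State D →L[ℂ] State D} {t : (Space → Spinor) → Space → Spinor}
    (hA : Extends A t) (hB : Extends B t) : A = B := by
  refine ContinuousLinearMap.ext fun x => ?_
  refine denseRange_toState.induction (P := fun x => A x = B x) ?_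
    (isClosed_eq A.continuous B.continuous) x
  rintro _ ⟨f, rfl⟩
  exact State.ext' ((hA f).trans (hB f).symm)

/-! ### Unitarity -/

lemma continuous_act_exp {X : Type*} [TopologicalSpace X] {c : X → ℂ} {p : X → Space}
    {x : X → Spinor} (hc : Continuous c) (hp : Continuous p) (hx : Continuous x) :
    Continuous fun q => act (NormedSpace.exp (c q • gz D (p q))) (x q) := by
  simp only [act_exp]
  have h := continuous_act_gz_apply D hp hx
  have h1 : Continuous fun q => Complex.exp (c q) := Complex.continuous_exp.comp hc
  have h2 : Continuous fun q => Complex.exp (-c q) := Complex.continuous_exp.comp hc.neg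
  exact ((h1.smul (hx.add h)).add (h2.smul (hx.sub h))).const_smul (1 / 2 : ℂ)

lemma integrable_fourierInt (κ : ℝ) {f : Space → Spinor} (hf : ContinuousCompact f) (u : Space) :
    Integrable (fun z => act (NormedSpace.exp ((-Complex.I * κ * mdot (pt u) (pt z)) • gz D z))
      (act (gz D z) (f z))) hypMeasure := by
  refine (continuous_act_exp ?_ continuous_id (continuous_act_gz_apply D continuous_id
    hf.1)).integrable_of_hasCompactSupport
    (hasCompactSupport_of_zero hf.2 fun z h => by simp [h])
  exact continuous_const.mul (Complex.continuous_ofReal.comp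
    (continuous_mdot_pt_comp continuous_const continuous_id))

lemma integrable_fourierStarInt (κ : ℝ) {f : Space → Spinor} (hf : ContinuousCompact f)
    (u : Space) :
    Integrable (fun z => act (NormedSpace.exp ((Complex.I * κ * mdot (pt u) (pt z)) • gz D u))
      (act (gz D z) (f z))) hypMeasure := by
  refine (continuous_act_exp ?_ continuous_const (continuous_act_gz_apply D continuous_id
    hf.1)).integrable_of_hasCompactSupport
    (hasCompactSupport_of_zero hf.2 fun z h => by simp [h])
  exact continuous_const.mul (Complex.continuous_ofReal.comp
    (continuous_mdot_pt_comp continuous_const continuous_id))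

lemma exists_extends_fourierInt {κ : ℝ} (hκ : 0 < κ) :
    ∃ A : State D →L[ℂ] State D, Extends A (fourierInt D κ) ∧ ∀ x, ‖A x‖ = ‖x‖ := by
  refine exists_extends (fun f hf g hg => ?_) (fun c f hf => ?_)
    fun f hf => fourierInt_isometric hκ hf.1 hf.2
  · funext u
    simp only [fourierInt, Pi.add_apply, map_add]
    rw [integral_add (integrable_fourierInt κ ⟨hf.1.continuous, hf.2⟩ u)
      (integrable_fourierInt κ ⟨hg.1.continuous, hg.2⟩ u), smul_add]
  · funext u
    simp only [fourierInt, Pi.smul_apply, map_smul]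
    rw [integral_smul, smul_comm]

lemma exists_extends_fourierStarInt {κ : ℝ} (hκ : 0 < κ) :
    ∃ A : State D →L[ℂ] State D, Extends A (fourierStarInt D κ) ∧ ∀ x, ‖A x‖ = ‖x‖ := by
  refine exists_extends (fun f hf g hg => ?_) (fun c f hf => ?_)
    fun f hf => fourierStarInt_isometric hκ hf.1 hf.2
  · funext u
    simp only [fourierStarInt, Pi.add_apply, map_add]
    rw [integral_add (integrable_fourierStarInt κ ⟨hf.1.continuous, hf.2⟩ u)
      (integrable_fourierStarInt κ ⟨hg.1.continuous, hg.2⟩ u), smul_add]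
  · funext u
    simp only [fourierStarInt, Pi.smul_apply, map_smul]
    rw [integral_smul, smul_comm]

lemma F_extends {κ : ℝ} (hκ : 0 < κ) : Extends (F D κ) (fourierInt D κ) := by
  have h : ∃ A : State D →L[ℂ] State D, Extends A (fourierInt D κ) :=
    (exists_extends_fourierInt hκ).imp fun _ h => h.1
  rw [F, dif_pos h]
  exact h.choose_spec

lemma norm_F {κ : ℝ} (hκ : 0 < κ) (x : State D) : ‖F D κ x‖ = ‖x‖ := by
  obtain ⟨A, hA, hn⟩ := exists_extends_fourierInt (D := D) hκ
  rw [(F_extends hκ).unique hA, hn]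

lemma dbar_act_exp_left (t : ℝ) (z : Space) (x y : Spinor) :
    dbar D (act (NormedSpace.exp ((-Complex.I * t) • gz D z)) x) y
      = dbar D x (act (NormedSpace.exp ((Complex.I * t) • gz D z)) y) := by
  have h1 : conj (Complex.exp (-(Complex.I * t))) = Complex.exp (Complex.I * t) := by
    rw [← Complex.exp_conj]; simp
  have h2 : conj (Complex.exp (Complex.I * t)) = Complex.exp (-(Complex.I * t)) := by
    rw [← Complex.exp_conj]; simp
  simp only [act_exp, neg_mul, neg_neg, dbar_smul_left, dbar_smul_right, dbar_add_left,
    dbar_add_right, dbar_sub_left, dbar_sub_right, dbar_act_gz, map_div₀, map_one, map_ofNat, h1,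
    h2]

/-- The two integral transformations are adjoint to each other. -/
lemma integral_dbar_fourierInt (κ : ℝ) {f g : Space → Spinor} (hf : ContinuousCompact f)
    (hg : ContinuousCompact g) :
    ∫ u, dbar D (fourierInt D κ f u) (act (gz D u) (g u)) ∂hypMeasure
      = ∫ z, dbar D (f z) (act (gz D z) (fourierStarInt D κ g z)) ∂hypMeasure := by
  set k : Space → Space → ℂ := fun u z =>
    dbar D (act (NormedSpace.exp ((-Complex.I * κ * mdot (pt u) (pt z)) • gz D z))
      (act (gz D z) (f z))) (act (gz D u) (g u)) with hk
  have hk' : ∀ u z, k u z = dbar D (f z) (act (gz D z)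
      (act (NormedSpace.exp ((Complex.I * κ * mdot (pt z) (pt u)) • gz D z))
        (act (gz D u) (g u)))) := by
    intro u z
    have h := dbar_act_exp_left (D := D) (κ * mdot (pt z) (pt u)) z (act (gz D z) (f z))
      (act (gz D u) (g u))
    push_cast at h
    simp only [hk]
    rw [mdot_comm (pt u), mul_assoc, h, dbar_act_gz, mul_assoc]
  have hcont : Continuous (Function.uncurry k) := by
    refine continuous_dbar D (continuous_act_exp (X := Space × Space) ?_ continuous_snd
      (continuous_act_gz_apply D continuous_snd (hf.1.comp continuous_snd)))
      (continuous_act_gz_apply D continuous_fst (hg.1.comp continuous_fst))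
    exact continuous_const.mul (Complex.continuous_ofReal.comp
      (continuous_mdot_pt_comp continuous_fst continuous_snd))
  have hcs : HasCompactSupport (Function.uncurry k) := by
    refine HasCompactSupport.intro (hg.2.isCompact.prod hf.2.isCompact) fun p hp => ?_
    rw [Set.mem_prod, not_and_or] at hp
    rcases hp with hp | hp
    · simp [Function.uncurry, hk, image_eq_zero_of_notMem_tsupport hp, dbar]
    · simp [Function.uncurry, hk, image_eq_zero_of_notMem_tsupport hp, dbar]
  have e1 : ∀ u, dbar D (fourierInt D κ f u) (act (gz D u) (g u))
      = (coeff κ : ℂ) * ∫ z, k u z ∂hypMeasure := fun u => by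
    rw [fourierInt, dbar_smul_left, Complex.conj_ofReal,
      integral_dbar_left D (integrable_fourierInt κ hf u)]
    rfl
  have e2 : ∀ z, dbar D (f z) (act (gz D z) (fourierStarInt D κ g z))
      = (coeff κ : ℂ) * ∫ u, k u z ∂hypMeasure := fun z => by
    have hi := integrable_fourierStarInt (D := D) κ hg z
    rw [fourierStarInt, map_smul, dbar_smul_right]
    simp only [hk']
    rw [integral_dbar_right D ((act (gz D z)).integrable_comp hi),
      (act (gz D z)).integral_comp_comm hi]
    rfl
  simp only [e1, e2]
  rw [integral_const_mul, integral_const_mul,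
    integral_integral_swap_of_hasCompactSupport hcont hcs]

/-- Both transforms extend to isometric operators, and `integral_dbar_fourierInt` identifies the
second extension with the adjoint of the first. -/
lemma adjoint_F {κ : ℝ} (hκ : 0 < κ) :
    Extends (ContinuousLinearMap.adjoint (F D κ)) (fourierStarInt D κ) ∧
      ∀ x, ‖ContinuousLinearMap.adjoint (F D κ) x‖ = ‖x‖ := by
  obtain ⟨B, hB, hn⟩ := exists_extends_fourierStarInt (D := D) hκ
  have h : ContinuousLinearMap.adjoint (F D κ) = B := by
    refine ContinuousLinearMap.ext fun x => ?_
    refine denseRange_toState.induction (P := fun x => ContinuousLinearMap.adjoint (F D κ) x = B x)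
      ?_ (isClosed_eq (ContinuousLinearMap.continuous _) B.continuous) x
    rintro _ ⟨g, rfl⟩
    refine denseRange_toState.eq_of_inner_right ℂ fun f => ?_
    rw [ContinuousLinearMap.adjoint_inner_right, State.inner_def, State.inner_def]
    have h1 := integral_dbar_fourierInt (D := D) κ (f := f.toFun) (g := g.toFun)
      ⟨f.contDiff.continuous, f.compact⟩ ⟨g.contDiff.continuous, g.compact⟩
    refine Eq.trans (integral_congr_ae ?_) (h1.trans (integral_congr_ae ?_))
    · filter_upwards [F_extends hκ f, toState_fn D g] with z h2 h3
      rw [h2, h3]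
    · filter_upwards [hB g, toState_fn D f] with z h2 h3
      rw [h2, h3]
  rw [h]
  exact ⟨hB, hn⟩

lemma Gam_fn (f : State D) : (Gam D f).fn =ᵐ[hypMeasure] fun z => act (gz D z) (f.fn z) :=
  State.mk_fn _ (aesm_act (continuous_act_gz D) f.aesm)
    (by simp only [dbar_gz_gz]; exact f.integrable f)

lemma inner_Gam_left (f g : State D) : (inner ℂ (Gam D f) g : ℂ) = inner ℂ f (Gam D g) := by
  rw [State.inner_def, State.inner_def]
  refine integral_congr_ae ?_
  filter_upwards [Gam_fn f, Gam_fn g] with z h1 h2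
  rw [h1, h2, dbar_act_gz]

lemma Gam_Gam : Gam D * Gam D = 1 := by
  refine ContinuousLinearMap.ext fun f => State.ext' ?_
  filter_upwards [Gam_fn f, Gam_fn (Gam D f)] with z h1 h2
  change (Gam D (Gam D f)).fn z = f.fn z
  rw [h2, h1, act_gz_gz]

lemma G_apply (θ : ℝ) (f : State D) :
    G D θ f = (Real.cos θ : ℂ) • f + (Complex.I * Real.sin θ) • Gam D f := by
  rw [G, exp_smul_of_mul_self_eq_one Gam_Gam, mul_comm, Complex.cosh_mul_I, Complex.sinh_mul_I,
    mul_comm (Complex.sin _)]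
  simp

lemma Gam_apply_Gam (f : State D) : Gam D (Gam D f) = f :=
  congrArg (fun A : State D →L[ℂ] State D => A f) Gam_Gam

lemma inner_G_left (θ : ℝ) (f g : State D) :
    (inner ℂ (G D θ f) g : ℂ) = inner ℂ f (G D (-θ) g) := by
  rw [G_apply, G_apply, inner_add_left, inner_add_right, inner_smul_left, inner_smul_left,
    inner_smul_right, inner_smul_right, inner_Gam_left, Real.cos_neg, Real.sin_neg, map_mul,
    Complex.conj_I, Complex.conj_ofReal, Complex.conj_ofReal]
  push_cast
  ring

lemma G_neg_apply (θ : ℝ) (f : State D) : G D (-θ) (G D θ f) = f := by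
  simp only [G_apply, map_add, map_smul, Gam_apply_Gam, Real.cos_neg, Real.sin_neg]
  have h : (Real.cos θ : ℂ) ^ 2 + (Real.sin θ : ℂ) ^ 2 = 1 := by
    exact_mod_cast Real.cos_sq_add_sin_sq θ
  have e : ∀ x y : State D, (Real.cos θ : ℂ) • ((Real.cos θ : ℂ) • x
      + (Complex.I * (-Real.sin θ : ℝ)) • y) + (Complex.I * Real.sin θ) •
        ((Real.cos θ : ℂ) • y + (Complex.I * (-Real.sin θ : ℝ)) • x)
      = ((Real.cos θ : ℂ) ^ 2 + (Real.sin θ : ℂ) ^ 2) • x := fun x y => by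
    have : (Real.cos θ : ℂ) ^ 2 + (Real.sin θ : ℂ) ^ 2
      = (Real.cos θ : ℂ) ^ 2 - Complex.I ^ 2 * (Real.sin θ : ℂ) ^ 2 := by
        rw [Complex.I_sq]; ring
    rw [this]
    push_cast
    module
  rw [e, h, one_smul]

lemma norm_G (θ : ℝ) (f : State D) : ‖G D θ f‖ = ‖f‖ :=
  norm_eq_of_inner_self (by rw [inner_G_left, G_neg_apply])

lemma adjoint_T_apply (κ : ℝ) (f : State D) : ContinuousLinearMap.adjoint (T D κ) f
    = -Complex.I • ContinuousLinearMap.adjoint (F D κ) (G D (-(κ + Real.pi / 4)) f) := by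
  refine ext_inner_left ℂ fun v => ?_
  rw [ContinuousLinearMap.adjoint_inner_right, inner_smul_right,
    ContinuousLinearMap.adjoint_inner_right, ← inner_G_left, T]
  simp [inner_smul_left]

lemma norm_T {κ : ℝ} (hκ : 0 < κ) (f : State D) : ‖T D κ f‖ = ‖f‖ := by
  rw [T]
  simp [norm_smul, norm_G, norm_F hκ]

lemma norm_adjoint_T {κ : ℝ} (hκ : 0 < κ) (f : State D) :
    ‖ContinuousLinearMap.adjoint (T D κ) f‖ = ‖f‖ := by
  rw [adjoint_T_apply, norm_smul, (adjoint_F hκ).2, norm_G]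
  simp

/-- Since `T` and `T*` are isometric, `‖T f - f‖ = ‖T*(T f - f)‖ = ‖f - T* f‖`. -/
lemma norm_T_sub {κ : ℝ} (hκ : 0 < κ) (f : State D) :
    ‖T D κ f - f‖ = ‖ContinuousLinearMap.adjoint (T D κ) f - f‖ := by
  have h := (ContinuousLinearMap.norm_map_iff_adjoint_comp_self _).mp (norm_T (D := D) hκ)
  have h' : ContinuousLinearMap.adjoint (T D κ) (T D κ f) = f :=
    congrArg (fun A : State D →L[ℂ] State D => A f) h
  rw [← norm_adjoint_T hκ (T D κ f - f), map_sub, h', norm_sub_rev]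

end

section

attribute [local irreducible] mdot pt time

variable (D : DiracMatrices)

/-! ### The operator `h` -/

lemma pt_zero_eq (z : Space) : pt z 0 = time z := by simp [pt]

lemma pt_succ_eq (z : Space) (j : Fin 3) : pt z j.succ = z j := by
  fin_cases j <;> simp [pt]

lemma sgn_zero : sgn 0 = 1 := by simp [sgn]

lemma sgn_succ (j : Fin 3) : sgn j.succ = -1 := by fin_cases j <;> simp [sgn]

lemma sum_sq_eq (z : Space) : ∑ j, z j ^ 2 = time z ^ 2 - 1 := by
  rw [time_sq, EuclideanSpace.norm_sq_eq]; simp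

lemma act_gz_eq (z : Space) (x : Spinor) : act (gz D z) x
    = (time z : ℂ) • act (D.mat 0) x - ∑ j : Fin 3, (z j : ℂ) • act (D.mat j.succ) x := by
  rw [gz, slash, act_sum, Fin.sum_univ_succ]
  simp only [pt_zero_eq, pt_succ_eq, sgn_zero, sgn_succ, act_smul, act_neg, one_mul, neg_mul,
    Complex.ofReal_neg, neg_smul, Finset.sum_neg_distrib, sub_eq_add_neg]

lemma act_gT (a : Fin 4) (z : Space) (x : Spinor) :
    act (gT D a z) x = act (D.mat a) x - (pt z a : ℂ) • act (gz D z) x := by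
  rw [gT, act_sub, act_smul]

/-- The matrices `γ_T` are tangent to the hyperboloid: `z_a γ_T^a = 0`. -/
lemma sum_low_mul_gT (z : Space) : ∑ a, (low a z : ℂ) • gT D a z = 0 := by
  have h : ∑ a, low a z * pt z a = 1 := by
    have := mdot_pt z
    rwa [mdot] at this
  simp only [gT, smul_sub, Finset.sum_sub_distrib, smul_smul, ← Finset.sum_smul]
  rw [sub_eq_zero]
  have : ∑ a, (low a z : ℂ) * (pt z a : ℂ) = 1 := by exact_mod_cast h
  rw [this, one_smul, gz, slash]
  rfl

lemma mat_mul_gz (a : Fin 4) (z : Space) : D.mat a * gz D z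
    = ((2 * pt z a : ℝ) : ℂ) • (1 : Matrix (Fin 4) (Fin 4) ℂ) - gz D z * D.mat a := by
  have h := slash_anticomm D (fun b => if b = a then sgn a else 0) (pt z)
  have h0 : slash D (fun b => if b = a then sgn a else 0) = D.mat a := by
    have h1 : sgn a * sgn a = 1 := by fin_cases a <;> simp [sgn]
    simp only [slash, mul_ite, mul_zero, apply_ite Complex.ofReal, Complex.ofReal_zero, ite_smul,
      zero_smul, Finset.sum_ite_eq', Finset.mem_univ, if_true, h1, Complex.ofReal_one, one_smul]
  have h1 : mdot (fun b => if b = a then sgn a else 0) (pt z) = pt z a := by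
    have h1 : sgn a * sgn a = 1 := by fin_cases a <;> simp [sgn]
    simp [mdot, h1]
  rw [h0, h1] at h
  rw [← h]; simp [gz]

lemma gT_mul_gz (a : Fin 4) (z : Space) : gT D a z * gz D z = -(gz D z * gT D a z) := by
  rw [gT, sub_mul, mul_sub, mat_mul_gz, smul_mul_assoc, mul_smul_comm, gz_sq]
  push_cast
  module

/-- The contraction `γ_T^a γ_a = 3`. -/
lemma sum_sgn_smul_mul_mat (z : Space) : ∑ a, (sgn a : ℂ) • (gT D a z * D.mat a)
    = (3 : ℂ) • (1 : Matrix (Fin 4) (Fin 4) ℂ) := by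
  have h1 : ∀ a, (sgn a : ℂ) • (D.mat a * D.mat a) = 1 := by
    intro a
    have h := D.anticomm a a
    rw [← two_smul ℂ (D.mat a * D.mat a)] at h
    have h2 : D.mat a * D.mat a = (sgn a : ℂ) • (1 : Matrix (Fin 4) (Fin 4) ℂ) := by
      refine smul_right_injective _ (two_ne_zero : (2 : ℂ) ≠ 0) ?_
      simp only [h, metric, if_true, smul_smul]
      push_cast; rfl
    have h3 : (sgn a : ℂ) * sgn a = 1 := by fin_cases a <;> simp [sgn]
    rw [h2, smul_smul, h3, one_smul]
  have h2 : ∑ a, (sgn a : ℂ) • ((pt z a : ℂ) • (gz D z * D.mat a)) = 1 := by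
    rw [← gz_sq D z]
    conv_rhs => enter [2]; rw [gz, slash]
    rw [Finset.mul_sum]
    refine Finset.sum_congr rfl fun a _ => ?_
    rw [mul_smul_comm, smul_smul]; push_cast; rfl
  simp only [gT, sub_mul, smul_sub, smul_mul_assoc, h1, Finset.sum_sub_distrib, h2]
  simp only [Finset.sum_const, Finset.card_univ, Fintype.card_fin]
  module

/-- The contraction `γ_T^a γ_{T a} = 3`, the dimension of the hyperboloid. -/
lemma sum_sgn_smul_gT_mul_gT (z : Space) : ∑ a, (sgn a : ℂ) • (gT D a z * gT D a z)
    = (3 : ℂ) • (1 : Matrix (Fin 4) (Fin 4) ℂ) := by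
  rw [← sum_sgn_smul_mul_mat D z, ← sub_eq_zero, ← Finset.sum_sub_distrib]
  have h := congrArg (fun M => -(M * gz D z)) (sum_low_mul_gT D z)
  simp only [Finset.sum_mul, zero_mul, neg_zero, ← Finset.sum_neg_distrib] at h
  rw [← h]
  refine Finset.sum_congr rfl fun a _ => ?_
  conv_lhs => rw [← smul_sub, ← mul_sub]
  rw [show gT D a z - D.mat a = -((pt z a : ℂ) • gz D z) by rw [gT]; abel, mul_neg, mul_smul_comm,
    smul_neg, smul_smul, smul_mul_assoc, low]
  push_cast; rfl

/-- In terms of the spatial coordinates `h` is a Dirac operator on hyperbolic space. -/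
lemma hFun_eq (f : Space → Spinor) (z : Space) : hFun D f z
    = ∑ j : Fin 3, act (gT D j.succ z) (pderiv j f z) - (3 / 2 : ℂ) • act (gz D z) (f z) := by
  have e1 : ∑ a, act (gT D a z) (delta a f z)
      = ∑ j : Fin 3, act (gT D j.succ z) (pderiv j f z) := by
    simp only [delta, map_sum]
    rw [Finset.sum_comm]
    refine Finset.sum_congr rfl fun j _ => ?_
    have h : ∑ a, (proj a j.succ z : ℂ) • gT D a z = gT D j.succ z := by
      simp only [proj, Complex.ofReal_sub, Complex.ofReal_mul, sub_smul, Finset.sum_sub_distrib,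
        mul_comm (low _ z : ℂ), mul_smul, ← Finset.smul_sum, sum_low_mul_gT, smul_zero, sub_zero]
      simp [Finset.sum_ite_eq']
    rw [← h, act_sum]
    refine Finset.sum_congr rfl fun a _ => ?_
    rw [act_smul, ← Complex.coe_smul, map_smul]
  have e2 : ∑ a, act (gT D a z) (act (gz D z) (act ((sgn a : ℂ) • gT D a z) (f z)))
      = -(3 : ℂ) • act (gz D z) (f z) := by
    have : ∑ a, gT D a z * (gz D z * ((sgn a : ℂ) • gT D a z)) = -(3 : ℂ) • gz D z := by
      have h := congrArg (fun M => -(gz D z * M)) (sum_sgn_smul_gT_mul_gT D z)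
      simp only [Finset.mul_sum, ← Finset.sum_neg_distrib] at h
      rw [mul_smul_comm, mul_one] at h
      rw [neg_smul, ← h]
      refine Finset.sum_congr rfl fun a _ => ?_
      rw [← mul_assoc, gT_mul_gz, mul_smul_comm, mul_smul_comm, neg_mul, smul_neg, mul_assoc]
    rw [← act_smul, ← this, act_sum]
    simp only [act_mul]
  have e3 : ∑ a, act (gT D a z) ((low a z : ℂ) • f z) = 0 := by
    have h := congrArg (fun M => act M (f z)) (sum_low_mul_gT D z)
    simp only [act_sum, act_smul] at h
    simp only [map_smul]
    rw [h]; simp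
  have e : ∀ a, act (gT D a z) (momentum D a f z) = Complex.I • (act (gT D a z) (delta a f z)
      + (1 / 2 : ℂ) • act (gT D a z) (act (gz D z) (act ((sgn a : ℂ) • gT D a z) (f z)))
      - (3 / 2 : ℂ) • act (gT D a z) ((low a z : ℂ) • f z)) := fun a => by
    rw [momentum, map_smul, map_sub, map_add, map_smul, mul_smul, map_smul _ (3 / 2 : ℂ)]
  simp only [hFun, e, ← Finset.smul_sum, Finset.sum_sub_distrib, Finset.sum_add_distrib, e1, e2,
    e3]
  rw [smul_smul, neg_mul, Complex.I_mul_I, neg_neg, one_smul]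
  module

/-! ### Derivatives along the coordinate axes -/

/-- The line through `z` in the direction of the `j`-th axis. -/
abbrev axisLine (z : Space) (j : Fin 3) (t : ℝ) : Space := z + t • EuclideanSpace.single j 1

lemma hasDerivAt_axisLine {E : Type*} [NormedAddCommGroup E] [NormedSpace ℝ E] {f : Space → E}
    {f' : Space →L[ℝ] E} {z : Space} (hf : HasFDerivAt f f' z) (j : Fin 3) :
    HasDerivAt (fun t => f (axisLine z j t)) (f' (EuclideanSpace.single j 1)) 0 :=
  hf.hasLineDerivAt (EuclideanSpace.single j 1)

lemma hasDerivAt_time (z : Space) (j : Fin 3) :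
    HasDerivAt (fun t => time (axisLine z j t)) (z j / time z) 0 := by
  refine (hasDerivAt_axisLine (hasFDerivAt_time z) j).congr_deriv ?_
  simp [EuclideanSpace.inner_single_right, div_eq_inv_mul]

lemma hasDerivAt_pt (z : Space) (j : Fin 3) (a : Fin 4) :
    HasDerivAt (fun t => pt (axisLine z j t) a)
      (Fin.cases (z j / time z) (Pi.single j 1) a : ℝ) 0 := by
  refine Fin.cases ?_ (fun k => ?_) a
  · simp only [pt_zero_eq, Fin.cases_zero]
    exact hasDerivAt_time z j
  · simp only [pt_succ_eq, Fin.cases_succ]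
    have h := (EuclideanSpace.proj (𝕜 := ℝ) k : Space →L[ℝ] ℝ).hasFDerivAt (x := z)
    refine (hasDerivAt_axisLine h j).congr_deriv ?_
    simp [Pi.single_apply, eq_comm]

lemma pderiv_eq_of_hasDerivAt {f : Space → Spinor} {z : Space} {j : Fin 3} {d : Spinor}
    (hf : DifferentiableAt ℝ f z) (h : HasDerivAt (fun t => f (axisLine z j t)) d 0) :
    pderiv j f z = d :=
  (hasDerivAt_axisLine hf.hasFDerivAt j).unique h

lemma hasDerivAt_act (M : Matrix (Fin 4) (Fin 4) ℂ) {f : Space → Spinor} {z : Space}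
    (hf : DifferentiableAt ℝ f z) (j : Fin 3) :
    HasDerivAt (fun t => act M (f (axisLine z j t))) (act M (pderiv j f z)) 0 :=
  hasDerivAt_axisLine (f := fun z => act M (f z))
    (((act M).restrictScalars ℝ).hasFDerivAt.comp z hf.hasFDerivAt) j

lemma axisLine_zero (z : Space) (j : Fin 3) : axisLine z j 0 = z := by simp [axisLine]

lemma hasDerivAt_gz_apply {f : Space → Spinor} {z : Space} (hf : DifferentiableAt ℝ f z)
    (j : Fin 3) : HasDerivAt (fun t => act (gz D (axisLine z j t)) (f (axisLine z j t)))
      (act (gz D z) (pderiv j f z) + ((z j / time z : ℝ) : ℂ) • act (D.mat 0) (f z)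
        - act (D.mat j.succ) (f z)) 0 := by
  have h0 : ∀ z x, act (gz D z) x = ∑ a, ((sgn a * pt z a : ℝ) : ℂ) • act (D.mat a) x := by
    intro z x
    rw [gz, slash, act_sum]
    simp only [act_smul]
  simp only [h0]
  have hterm : ∀ a, HasDerivAt (fun t : ℝ => ((sgn a * pt (axisLine z j t) a : ℝ) : ℂ) •
        act (D.mat a) (f (axisLine z j t)))
      (((sgn a * pt z a : ℝ) : ℂ) • act (D.mat a) (pderiv j f z)
        + ((sgn a * (Fin.cases (z j / time z) (Pi.single j 1) a : ℝ) : ℝ) : ℂ) •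
          act (D.mat a) (f z)) 0 := by
    intro a
    have h1 := ((hasDerivAt_pt z j a).const_mul (sgn a)).ofReal_comp
    have h3 := h1.smul (hasDerivAt_act (D.mat a) hf j)
    rw [axisLine_zero] at h3
    exact h3
  have hs := HasDerivAt.fun_sum (u := Finset.univ) fun a _ => hterm a
  refine HasDerivAt.congr_deriv hs ?_
  rw [Finset.sum_add_distrib, add_sub_assoc]
  congr 1
  rw [Fin.sum_univ_succ]
  simp only [Fin.cases_zero, Fin.cases_succ, sgn_zero, sgn_succ, Pi.single_apply]
  simp [sub_eq_add_neg]

end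

section

attribute [local irreducible] mdot pt time

variable (D : DiracMatrices)

/-! ### Commutation of `h` with plane waves and with `Γ` -/

lemma time_sq_eq_sum (z : Space) :
    (time z : ℂ) ^ 2 = 1 + ((z 0 : ℂ) ^ 2 + (z 1 : ℂ) ^ 2 + (z 2 : ℂ) ^ 2) := by
  have h := sum_sq_eq z
  rw [Fin.sum_univ_three] at h
  have : time z ^ 2 = 1 + (z 0 ^ 2 + z 1 ^ 2 + z 2 ^ 2) := by linarith
  exact_mod_cast this

lemma time_ne_zero (z : Space) : (time z : ℂ) ≠ 0 := by exact_mod_cast (time_pos z).ne'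

lemma act_gT_succ (j : Fin 3) (z : Space) (x : Spinor) :
    act (gT D j.succ z) x = act (D.mat j.succ) x - (z j : ℂ) • act (gz D z) x := by
  rw [act_gT, pt_succ_eq]

lemma _root_.Differentiable.gz_apply {f : Space → Spinor} (hf : Differentiable ℝ f) :
    Differentiable ℝ fun z => act (gz D z) (f z) := by
  have h : Differentiable ℝ fun z => act (gz D z) :=
    (contDiff_act_gz (n := 1) D).differentiable one_ne_zero
  exact (((ContinuousLinearMap.restrictScalarsL ℂ Spinor Spinor ℝ ℝ).differentiable).comp
    h).clm_apply hf

/-- `h` anticommutes with `γ·z`. -/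
lemma hFun_gz {f : Space → Spinor} (hf : Differentiable ℝ f) (z : Space) :
    hFun D (fun z => act (gz D z) (f z)) z = -act (gz D z) (hFun D f z) := by
  have hg : DifferentiableAt ℝ (fun z => act (gz D z) (f z)) z :=
    hf.gz_apply D z
  have hp : ∀ j, pderiv j (fun z => act (gz D z) (f z)) z = _ := fun j =>
    pderiv_eq_of_hasDerivAt hg (hasDerivAt_gz_apply D (hf z) j)
  have hanti : ∀ j x, act (gT D j z) (act (gz D z) x) = -act (gz D z) (act (gT D j z) x) := by
    intro j x
    rw [← act_mul, gT_mul_gz, act_neg, act_mul]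
  have h3 : ∀ x, act (gT D 0 z) (act (D.mat 0) x)
      - ∑ j : Fin 3, act (gT D j.succ z) (act (D.mat j.succ) x) = (3 : ℂ) • x := by
    intro x
    have h := congrArg (fun M => act M x) (sum_sgn_smul_mul_mat D z)
    simp only [act_sum, act_smul, act_mul, act_one] at h
    rw [Fin.sum_univ_succ] at h
    simpa only [sgn_zero, sgn_succ, Complex.ofReal_one, one_smul, Complex.ofReal_neg, neg_smul,
      Finset.sum_neg_distrib, ← sub_eq_add_neg] using h
  have h0 : ∀ x, ∑ j : Fin 3, ((z j / time z : ℝ) : ℂ) • act (gT D j.succ z) x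
      = act (gT D 0 z) x := by
    intro x
    have h := congrArg (fun M => act M x) (sum_low_mul_gT D z)
    simp only [act_sum, act_smul, map_zero, zero_apply] at h
    simp only [Fin.sum_univ_succ (n := 3), low, pt_zero_eq, pt_succ_eq, sgn_zero, sgn_succ] at h
    have h' := congrArg (fun y => ((time z : ℂ)⁻¹) • y) h
    simp only [smul_add, Finset.smul_sum, smul_smul, smul_zero] at h'
    have e : ((time z : ℂ)⁻¹ * ((1 * time z : ℝ) : ℂ)) = 1 := by
      push_cast; rw [one_mul, inv_mul_cancel₀ (time_ne_zero z)]
    rw [e, one_smul, add_eq_zero_iff_eq_neg] at h'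
    rw [h', ← Finset.sum_neg_distrib]
    refine Finset.sum_congr rfl fun j _ => ?_
    rw [← neg_smul]
    congr 1
    push_cast
    ring
  rw [hFun_eq, hFun_eq]
  simp only [hp, map_add, map_sub, map_smul, hanti, Finset.sum_add_distrib,
    Finset.sum_sub_distrib, Finset.sum_neg_distrib, map_sum, act_gz_gz, h0]
  have := h3 (f z)
  rw [sub_eq_iff_eq_add] at this
  rw [this]
  module

/-- The divergence of `γ_T f`, which arises on integrating by parts against a plane wave, is `h f`
up to a term of order zero. -/
lemma sum_pderiv_gT {f : Space → Spinor} (hf : ContDiff ℝ 1 f) (z : Space) :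
    ∑ j : Fin 3, time z • pderiv j (fun z => (time z)⁻¹ • act (gT D j.succ z) (f z)) z
      = hFun D f z - (3 / 2 : ℂ) • act (gz D z) (f z) := by
  have hd : Differentiable ℝ f := hf.differentiable one_ne_zero
  have hp : ∀ j : Fin 3, time z • pderiv j (fun z => (time z)⁻¹ • act (gT D j.succ z) (f z)) z
      = act (gT D j.succ z) (pderiv j f z) - (((z j : ℂ) / time z) ^ 2 * (-1) + 1) •
          act (gz D z) (f z) - ((z j : ℂ) ^ 2 / time z) • act (D.mat 0) (f z)
        + ((z j : ℂ) - z j / (time z) ^ 2) • act (D.mat j.succ) (f z) := by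
    intro j
    have hgd : DifferentiableAt ℝ (fun z => (time z)⁻¹ • act (gT D j.succ z) (f z)) z := by
      have : ContDiff ℝ 1 fun z => (time z)⁻¹ • act (gT D j.succ z) (f z) :=
        contDiff_rsmul (contDiff_time.inv fun z => (time_pos z).ne')
          (contDiff_apply (contDiff_act_gT j.succ) hf)
      exact this.differentiable one_ne_zero z
    have hz : HasDerivAt (fun t => ((axisLine z j t) j : ℝ)) 1 0 := by
      have := hasDerivAt_pt z j j.succ
      simpa only [pt_succ_eq, Fin.cases_succ, Pi.single_eq_same] using this
    have h1 := (hasDerivAt_time z j).inv (by rw [axisLine_zero]; exact (time_pos z).ne')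
    have h2 := (hasDerivAt_act (D.mat j.succ) (hd z) j).sub
      (hz.ofReal_comp.smul (hasDerivAt_gz_apply D (hd z) j))
    have h3 : HasDerivAt (fun t => (time (axisLine z j t))⁻¹ • (act (D.mat j.succ)
        (f (axisLine z j t)) - (((axisLine z j t) j : ℝ) : ℂ) •
          act (gz D (axisLine z j t)) (f (axisLine z j t)))) _ 0 := h1.smul h2
    rw [pderiv_eq_of_hasDerivAt hgd (d := _) (h3.congr_of_eventuallyEq ?_)]
    · simp only [axisLine_zero, Pi.inv_apply]
      rw [act_gT_succ]
      simp only [← Complex.coe_smul]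
      have ht := time_ne_zero z
      push_cast
      match_scalars <;> (field_simp; try ring)
    · refine Eventually.of_forall fun t => ?_
      simp only [act_gT_succ]
  simp only [hp]
  rw [hFun_eq, Fin.sum_univ_three, Fin.sum_univ_three, act_gz_eq, Fin.sum_univ_three]
  have ht := time_ne_zero z
  have hs := time_sq_eq_sum z
  -- the coefficients of `γ⁰ f` and `γ^j f` agree by means of `(z⁰)² = 1 + |z|²`
  match_scalars
  all_goals field_simp
  all_goals first
    | ring1
    | linear_combination (2 * (z 0 : ℂ)) * hs
    | linear_combination (2 * (z 1 : ℂ)) * hs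
    | linear_combination (2 * (z 2 : ℂ)) * hs

/-- Integration by parts: multiplication by `u·z γ·z` under a plane wave amounts to `γ·u` and the
operator `h`. -/
lemma wave_mdot_gz {l : ℂ} (hl : l ≠ 0) {f : Space → Spinor} (hf : ContDiff ℝ 1 f)
    (hc : HasCompactSupport f) (u : Space) :
    wave l (fun z => (mdot (pt u) (pt z) : ℂ) • act (gz D z) (f z)) u
      = act (gz D u) (wave l f u)
        - l⁻¹ • wave l (fun z => hFun D f z - (3 / 2 : ℂ) • act (gz D z) (f z)) u := by
  set g : Fin 3 → Space → Spinor := fun j z => (time z)⁻¹ • act (gT D j.succ z) (f z) with hg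
  have hg1 : ∀ j, ContDiff ℝ 1 (g j) := fun j =>
    contDiff_rsmul (contDiff_time.inv fun z => (time_pos z).ne')
      (contDiff_apply (contDiff_act_gT j.succ) hf)
  have hgc : ∀ j, HasCompactSupport (g j) := fun j =>
    hasCompactSupport_of_zero hc fun z h => by simp [hg, h]
  have hcoord : ∀ j : Fin 3, Continuous fun z : Space => z j := fun j => by fun_prop
  have hA : ∀ j, Continuous fun z => time z • g j z := fun j =>
    continuous_time.smul (hg1 j).continuous
  have hB : ∀ j, Continuous fun z : Space => z j • g j z := fun j =>
    (hcoord j).smul (hg1 j).continuous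
  have hAc : ∀ j, HasCompactSupport fun z => time z • g j z := fun j =>
    hasCompactSupport_rsmul (hgc j) _
  have hBc : ∀ j, HasCompactSupport fun z : Space => z j • g j z := fun j =>
    hasCompactSupport_rsmul (hgc j) _
  have hP : ∀ j, Continuous fun z => time z • pderiv j (g j) z := fun j =>
    continuous_time.smul (continuous_pderiv j (hg1 j))
  have hPc : ∀ j, HasCompactSupport fun z => time z • pderiv j (g j) z := fun j =>
    hasCompactSupport_rsmul (hasCompactSupport_pderiv j (hgc j)) _
  set k : Fin 3 → Space → Spinor := fun j z =>
    (u j : ℂ) • (time z • g j z) + (-(time u : ℂ)) • (z j • g j z) with hk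
  have hkc : ∀ j, Continuous (k j) := fun j =>
    ((hA j).const_smul (u j : ℂ)).add ((hB j).const_smul (-(time u : ℂ)))
  have hks : ∀ j, HasCompactSupport (k j) := fun j =>
    hasCompactSupport_of_zero hc fun z h => by simp [hk, hg, h]
  have hwk : ∀ j, wave l (k j) u = -(l⁻¹ • wave l (fun z => time z • pderiv j (g j) z) u) := by
    intro j
    have e := smul_wave_eq hl (hg1 j) (hgc j) u j
    have e' := wave_add l (g := fun z => (u j : ℂ) • (time z • g j z))
      (g' := fun z => (-(time u : ℂ)) • (z j • g j z)) ((hA j).const_smul (u j : ℂ))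
      (hasCompactSupport_of_zero (hAc j) fun z h => by rw [h, smul_zero])
      ((hB j).const_smul (-(time u : ℂ)))
      (hasCompactSupport_of_zero (hBc j) fun z h => by rw [h, smul_zero]) u
    rw [wave_smul, wave_smul, Complex.coe_smul, neg_smul, Complex.coe_smul, e] at e'
    rw [hk, e']
    abel
  have hsum : ∀ z, (mdot (pt u) (pt z) : ℂ) • act (gz D z) (f z)
      = act (gz D u) (f z) + ∑ j, k j z := by
    intro z
    have hm : mdot (pt u) (pt z) = time u * time z - ∑ j, u j * z j := by
      rw [mdot, Fin.sum_univ_succ]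
      simp only [pt_zero_eq, pt_succ_eq, sgn_zero, sgn_succ, one_mul, neg_mul,
        Finset.sum_neg_distrib, sub_eq_add_neg]
    have ht := time_ne_zero z
    have hs := time_sq_eq_sum z
    simp only [hk, hg, act_gT_succ, ← Complex.coe_smul]
    rw [hm, act_gz_eq D u, Fin.sum_univ_three, Fin.sum_univ_three, Fin.sum_univ_three]
    have hX := act_gz_eq D z (f z)
    rw [Fin.sum_univ_three] at hX
    rw [hX]
    push_cast
    -- the coefficients of `γ⁰ f` and `γ^j f` agree by means of `(z⁰)² = 1 + |z|²`
    match_scalars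
    all_goals field_simp
    all_goals first
      | linear_combination (time u : ℂ) * hs
      | linear_combination (-(time u : ℂ) * z 0) * hs
      | linear_combination (-(time u : ℂ) * z 1) * hs
      | linear_combination (-(time u : ℂ) * z 2) * hs
  have hdiv : ∀ z, hFun D f z - (3 / 2 : ℂ) • act (gz D z) (f z)
      = ∑ j, time z • pderiv j (g j) z := fun z => (sum_pderiv_gT D hf z).symm
  simp only [hsum, hdiv]
  rw [wave_add l (g := fun z => act (gz D u) (f z)) ((act (gz D u)).continuous.comp hf.continuous)
    (hasCompactSupport_of_zero hc fun z h => by simp [h])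
    (continuous_finsetSum _ fun j _ => hkc j)
    (hasCompactSupport_of_zero hc fun z h => by simp [hk, hg, h]), wave_clm l _ hf.continuous hc,
    wave_sum l _ hkc hks, wave_sum l _ hP hPc, Finset.smul_sum, sub_eq_add_neg,
    ← Finset.sum_neg_distrib]
  simp only [hwk]

end

section

attribute [local irreducible] mdot pt time

variable (D : DiracMatrices)

/-! ### Dependence on the frequency -/

/-- Differentiation under the integral sign for integrands supported in a fixed compact set. -/
lemma hasDerivAt_integral_of_compact {E : Type*} [NormedAddCommGroup E] [NormedSpace ℝ E]
    {k k' : ℝ → Space → E} {K : Set Space} (hK : IsCompact K) {S : Set ℝ} (hS : IsOpen S)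
    (hk : ∀ t ∈ S, Continuous (k t)) (hk0 : ∀ t ∈ S, ∀ z ∉ K, k t z = 0)
    (hk' : ContinuousOn (Function.uncurry k') (S ×ˢ Set.univ))
    (hk'0 : ∀ t ∈ S, ∀ z ∉ K, k' t z = 0)
    (hd : ∀ t ∈ S, ∀ z, HasDerivAt (fun t => k t z) (k' t z) t) {t : ℝ} (ht : t ∈ S) :
    HasDerivAt (fun t => ∫ z, k t z ∂hypMeasure) (∫ z, k' t z ∂hypMeasure) t := by
  obtain ⟨r, hr, hrS⟩ := Metric.nhds_basis_closedBall.mem_iff.mp (hS.mem_nhds ht)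
  obtain ⟨M, hM⟩ := ((isCompact_closedBall t r).prod hK).exists_bound_of_continuousOn
    (hk'.mono (Set.prod_mono hrS (Set.subset_univ K)))
  have hslice : ∀ s ∈ S, Continuous (k' s) := fun s hs =>
    continuousOn_univ.mp (hk'.comp (continuousOn_const.prodMk continuousOn_id)
      fun z _ => ⟨hs, trivial⟩)
  refine (hasDerivAt_integral_of_dominated_loc_of_deriv_le (bound := K.indicator fun _ => M)
    (s := Metric.ball t r) (Metric.ball_mem_nhds t hr) ?_ ?_ (hslice t ht).aestronglyMeasurable
    ?_ ?_ ?_).2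
  · filter_upwards [hS.mem_nhds ht] with s hs
    exact (hk s hs).aestronglyMeasurable
  · exact (hk t ht).integrable_of_hasCompactSupport (HasCompactSupport.intro hK (hk0 t ht))
  · refine Eventually.of_forall fun z s hs => ?_
    have hs' := Metric.ball_subset_closedBall hs
    by_cases hz : z ∈ K
    · rw [Set.indicator_of_mem hz]
      exact hM (s, z) ⟨hs', hz⟩
    · rw [Set.indicator_of_notMem hz, hk'0 s (hrS hs') z hz, norm_zero]
  · exact (integrable_indicator_iff hK.measurableSet).mpr
      (integrableOn_const hK.measure_lt_top.ne)
  · exact Eventually.of_forall fun z s hs => hd s (hrS (Metric.ball_subset_closedBall hs)) z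

/-- Each derivative in the frequency multiplies the amplitude by `-i u·z`, which `wave_mdot_gz`
removes again. -/
lemma hasDerivAt_wave {g : Space → Spinor} (hg : Continuous g) (hc : HasCompactSupport g)
    (u : Space) (κ : ℝ) :
    HasDerivAt (fun κ => wave (freq 0 κ) g u)
      (-Complex.I • wave (freq 0 κ) (fun z => (mdot (pt u) (pt z) : ℂ) • g z) u) κ := by
  have hm : Continuous fun z => (mdot (pt u) (pt z) : ℂ) :=
    Complex.continuous_ofReal.comp (continuous_mdot_pt_comp continuous_const continuous_id)
  have hfr : ∀ κ : ℝ, HasDerivAt (fun κ => freq 0 κ) Complex.I κ := fun κ => by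
    have h := ((hasDerivAt_id κ).ofReal_comp.const_mul Complex.I).const_add ((0 : ℝ) : ℂ)
    simpa [freq] using h
  have hfc : Continuous (freq 0) := continuous_iff_continuousAt.mpr fun κ => (hfr κ).continuousAt
  have hexp : Continuous fun p : ℝ × Space =>
      Complex.exp (-(freq 0 p.1 * mdot (pt u) (pt p.2))) :=
    Complex.continuous_exp.comp ((hfc.comp continuous_fst).mul (hm.comp continuous_snd)).neg
  have h := hasDerivAt_integral_of_compact
    (k := fun κ z => Complex.exp (-(freq 0 κ * mdot (pt u) (pt z))) • g z)
    (k' := fun κ z => -Complex.I • Complex.exp (-(freq 0 κ * mdot (pt u) (pt z))) •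
      (mdot (pt u) (pt z) : ℂ) • g z) hc.isCompact isOpen_univ
    (fun κ _ => (Complex.continuous_exp.comp (continuous_const.mul hm).neg).smul hg)
    (fun κ _ z hz => by rw [image_eq_zero_of_notMem_tsupport hz, smul_zero])
    (Continuous.continuousOn ((hexp.smul ((hm.comp continuous_snd).smul
      (hg.comp continuous_snd))).const_smul (-Complex.I)))
    (fun κ _ z hz => by simp [image_eq_zero_of_notMem_tsupport hz])
    (fun κ _ z => by
      have h1 := ((hfr κ).mul_const (mdot (pt u) (pt z) : ℂ)).neg.cexp.smul_const (g z)
      refine h1.congr_deriv ?_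
      simp only [smul_smul, Pi.neg_apply]
      congr 1; ring) (Set.mem_univ κ)
  rw [integral_smul] at h
  exact h

/-- The combination of superpositions in which the transform `F*` of `γ·z g` is expressed. -/
def starWave (κ : ℝ) (g : Space → Spinor) (u : Space) : Spinor :=
  posPart D (wave (freq 0 (-κ)) g) u - negPart D (wave (freq 0 κ) g) u

lemma dampedFStar_zero (κ : ℝ) (f : Space → Spinor) :
    dampedFStar D κ f 0 = starWave D κ fun z => act (gz D z) (f z) := rfl

lemma continuous_starWave {g : Space → Spinor} (hg : Continuous g) (hc : HasCompactSupport g) :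
    Continuous fun p : ℝ × Space => starWave D p.1 g p.2 := by
  have hf : Continuous fun κ : ℝ => freq 0 κ :=
    continuous_const.add (continuous_const.mul Complex.continuous_ofReal)
  have hw : Continuous fun p : ℝ × Space => wave (freq 0 p.1) g p.2 :=
    (continuous_wave hg hc).comp ((hf.comp continuous_fst).prodMk continuous_snd)
  have hw' : Continuous fun p : ℝ × Space => wave (freq 0 (-p.1)) g p.2 :=
    (continuous_wave hg hc).comp ((hf.comp continuous_fst.neg).prodMk continuous_snd)
  simp only [starWave, posPart, negPart]
  exact (((continuous_act_gz_apply D continuous_snd hw').add hw').const_smul (1 / 2 : ℂ)).sub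
    (((continuous_act_gz_apply D continuous_snd hw).sub hw).const_smul (1 / 2 : ℂ))

lemma starWave_smul (κ : ℝ) (c : ℂ) (g : Space → Spinor) (u : Space) :
    starWave D κ (fun z => c • g z) u = c • starWave D κ g u := by
  simp only [starWave, posPart, negPart, wave_smul, map_smul]
  module

/-- The differential equation in the frequency, on which the convergence rests. -/
lemma hasDerivAt_starWave {κ : ℝ} (hκ : 0 < κ) {f : Space → Spinor} (hf : ContDiff ℝ 1 f)
    (hc : HasCompactSupport f) (u : Space) :
    HasDerivAt (fun κ => starWave D κ (fun z => act (gz D z) (f z)) u)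
      (Complex.I • starWave D κ f u + (κ : ℂ)⁻¹ • (starWave D κ (hFun D f) u
        - (3 / 2 : ℂ) • starWave D κ (fun z => act (gz D z) (f z)) u)) κ := by
  have hgf : ContDiff ℝ 1 fun z => act (gz D z) (f z) := contDiff_gz_apply hf
  have hgc := hasCompactSupport_gz D hc
  have hh : Continuous (hFun D f) :=
    (contDiff_hFun (D := D) 0 (by simpa using hf)).continuous
  have hhc : HasCompactSupport (hFun D f) := compact_hFun hc
  have hk0 : (κ : ℂ) ≠ 0 := by exact_mod_cast hκ.ne'
  have h1 := hasDerivAt_wave hgf.continuous hgc u κ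
  have h2 := (hasDerivAt_wave hgf.continuous hgc u (-κ)).scomp κ (hasDerivAt_neg κ)
  have hw : ∀ l, wave l (fun z => hFun D f z - (3 / 2 : ℂ) • act (gz D z) (f z)) u
      = wave l (hFun D f) u - (3 / 2 : ℂ) • wave l (fun z => act (gz D z) (f z)) u := by
    intro l
    have e := wave_add l (g' := fun z => (-(3 / 2) : ℂ) • act (gz D z) (f z)) hh hhc
      (hgf.continuous.const_smul (-(3 / 2) : ℂ))
      (hasCompactSupport_of_zero hgc fun z h => by rw [h, smul_zero]) u
    rw [wave_smul] at e
    simpa [sub_eq_add_neg] using e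
  have hn : freq 0 (-κ) ≠ 0 := by simp [freq, hk0]
  have hp : freq 0 κ ≠ 0 := by simp [freq, hk0]
  rw [wave_mdot_gz D hp hf hc, hw] at h1
  rw [wave_mdot_gz D hn hf hc, hw] at h2
  have hA : ∀ (A : Spinor →L[ℂ] Spinor) {x : ℝ → Spinor} {x' : Spinor},
      HasDerivAt x x' κ → HasDerivAt (fun κ => A (x κ)) (A x') κ := fun A _ _ h =>
    (A.restrictScalars ℝ).hasFDerivAt.comp_hasDerivAt κ h
  have h3 := (((hA (act (gz D u)) h2).add h2).const_smul (1 / 2 : ℂ)).sub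
    (((hA (act (gz D u)) h1).sub h1).const_smul (1 / 2 : ℂ))
  refine h3.congr_deriv ?_
  have e1 : (freq 0 (-κ))⁻¹ = Complex.I * (κ : ℂ)⁻¹ := by
    simp only [freq]
    rw [Complex.ofReal_zero, zero_add, mul_inv, Complex.inv_I, Complex.ofReal_neg, inv_neg]
    ring
  have e2 : (freq 0 κ)⁻¹ = -Complex.I * (κ : ℂ)⁻¹ := by
    simp only [freq]
    rw [Complex.ofReal_zero, zero_add, mul_inv, Complex.inv_I]
  rw [e1, e2]
  simp only [starWave, posPart, negPart, map_sub, map_smul, act_gz_gz, neg_smul, map_neg, one_smul]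
  generalize (κ : ℂ)⁻¹ = c
  have hI : Complex.I ^ 2 = -1 := Complex.I_sq
  match_scalars <;> ring_nf <;> simp only [hI] <;> ring

end

section

attribute [local irreducible] mdot pt time

variable (D : DiracMatrices)

/-! ### Matrix elements as functions of the frequency -/

/-- The matrix element `(g, F* γ·z φ)` as a function of the frequency. -/
def matrixElement (g : Space → Spinor) (φ : Space → Spinor) (κ : ℝ) : ℂ :=
  (coeff κ : ℂ) * ∫ u, dbar D (g u) (act (gz D u) (starWave D κ φ u)) ∂hypMeasure

variable {D}

lemma norm_Gam (x : State D) : ‖Gam D x‖ = ‖x‖ :=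
  norm_eq_of_inner_self (by rw [inner_Gam_left, Gam_apply_Gam])

lemma inner_adjoint_F {κ : ℝ} (hκ : 0 < κ) (g : C0 ((⊤ : ℕ∞) : WithTop ℕ∞)) {x : State D}
    {ψ : Space → Spinor} (hx : x.fn =ᵐ[hypMeasure] ψ) (hψ : Continuous ψ)
    (hc : HasCompactSupport ψ) :
    (inner ℂ (toState D g) (ContinuousLinearMap.adjoint (F D κ) x) : ℂ)
      = matrixElement D g.toFun (fun z => act (gz D z) (ψ z)) κ := by
  rw [ContinuousLinearMap.adjoint_inner_right, State.inner_def]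
  have h1 := integral_dbar_fourierInt (D := D) κ (f := g.toFun) (g := ψ)
    ⟨g.contDiff.continuous, g.compact⟩ ⟨hψ, hc⟩
  refine Eq.trans (integral_congr_ae ?_) (h1.trans ?_)
  · filter_upwards [F_extends hκ g, hx] with z h2 h3
    rw [h2, h3]
  · simp only [fourierStarInt_eq D κ hψ hc, dampedFStar_zero, map_smul, dbar_smul_right]
    rw [integral_const_mul, matrixElement]

lemma inner_adjoint_F_toState {κ : ℝ} (hκ : 0 < κ) (g : C0 ((⊤ : ℕ∞) : WithTop ℕ∞))
    {k : WithTop ℕ∞} (f : C0 k) :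
    (inner ℂ (toState D g) (ContinuousLinearMap.adjoint (F D κ) (toState D f)) : ℂ)
      = matrixElement D g.toFun (fun z => act (gz D z) (f.toFun z)) κ :=
  inner_adjoint_F hκ g (toState_fn D f) f.contDiff.continuous f.compact

lemma inner_adjoint_F_Gam {κ : ℝ} (hκ : 0 < κ) (g : C0 ((⊤ : ℕ∞) : WithTop ℕ∞))
    {k : WithTop ℕ∞} (f : C0 k) :
    (inner ℂ (toState D g) (ContinuousLinearMap.adjoint (F D κ) (Gam D (toState D f))) : ℂ)
      = matrixElement D g.toFun f.toFun κ := by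
  have hx : (Gam D (toState D f)).fn =ᵐ[hypMeasure] fun z => act (gz D z) (f.toFun z) := by
    filter_upwards [Gam_fn (toState D f), toState_fn D f] with z h1 h2
    rw [h1, h2]
  rw [inner_adjoint_F hκ g hx (continuous_act_gz_apply D continuous_id f.contDiff.continuous)
    (hasCompactSupport_gz D f.compact)]
  simp only [act_gz_gz]

lemma continuous_starWave_right {φ : Space → Spinor} (hφ : ContinuousCompact φ)
    (κ : ℝ) : Continuous fun u => starWave D κ φ u :=
  continuous_section (A := fun κ => starWave D κ φ) (continuous_starWave D hφ.1 hφ.2) κ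

lemma continuous_dbar_gz {g ψ : Space → Spinor} (hg : Continuous g) (hψ : Continuous ψ) :
    Continuous fun u => dbar D (g u) (act (gz D u) (ψ u)) :=
  continuous_dbar D hg (continuous_act_gz_apply D continuous_id hψ)

lemma integrable_dbar_gz {g ψ : Space → Spinor} (hg : ContinuousCompact g)
    (hψ : Continuous ψ) :
    Integrable (fun u => dbar D (g u) (act (gz D u) (ψ u))) hypMeasure :=
  (continuous_dbar_gz hg.1 hψ).integrable_of_hasCompactSupport
    (hg.2.mono fun z hz h => hz (by simp [h, dbar]))

lemma hasDerivAt_coeff {κ : ℝ} (hκ : 0 < κ) : HasDerivAt coeff (3 / 2 * κ⁻¹ * coeff κ) κ := by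
  have hp := Real.pi_pos
  have h0 : 0 < κ / (2 * Real.pi) := by positivity
  have h := (Real.hasDerivAt_rpow_const (p := 3 / 2) (Or.inl h0.ne')).comp κ
    ((hasDerivAt_id κ).div_const (2 * Real.pi))
  refine h.congr_deriv ?_
  rw [coeff, Real.rpow_sub_one h0.ne']
  field_simp

lemma dbarIntegral_starWave_add_smul {g : Space → Spinor}
    (hg : ContinuousCompact g) {κ : ℝ} {φ₁ φ₂ φ₃ : Space → Spinor}
    (h₁ : ContinuousCompact φ₁) (h₂ : ContinuousCompact φ₂)
    (h₃ : ContinuousCompact φ₃) (a b c : ℂ) :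
    ∫ u, dbar D (g u) (act (gz D u) (a • starWave D κ φ₁ u
        + b • (starWave D κ φ₂ u - c • starWave D κ φ₃ u))) ∂hypMeasure
      = a * ∫ u, dbar D (g u) (act (gz D u) (starWave D κ φ₁ u)) ∂hypMeasure
        + b * (∫ u, dbar D (g u) (act (gz D u) (starWave D κ φ₂ u)) ∂hypMeasure
          - c * ∫ u, dbar D (g u) (act (gz D u) (starWave D κ φ₃ u)) ∂hypMeasure) := by
  have hi : ∀ {φ : Space → Spinor}, ContinuousCompact φ →
      Integrable (fun u => dbar D (g u) (act (gz D u) (starWave D κ φ u))) hypMeasure :=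
    fun hφ => integrable_dbar_gz hg (continuous_starWave_right hφ κ)
  have i23 : Integrable (fun u => b * (dbar D (g u) (act (gz D u) (starWave D κ φ₂ u))
      - c * dbar D (g u) (act (gz D u) (starWave D κ φ₃ u)))) hypMeasure :=
    ((hi h₂).sub ((hi h₃).const_mul c)).const_mul b
  simp only [map_add, map_smul, map_sub, dbar_add_right, dbar_sub_right, dbar_smul_right]
  rw [integral_add ((hi h₁).const_mul a) i23, integral_const_mul, integral_const_mul,
    integral_sub (hi h₂) ((hi h₃).const_mul c), integral_const_mul]

/-- The logarithmic derivative of the normalisation cancels the zero-order term of the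
differential equation. -/
lemma hasDerivAt_matrixElement {κ : ℝ} (hκ : 0 < κ) {g f : Space → Spinor}
    (hg : ContinuousCompact g) (hf : ContDiff ℝ 1 f) (hc : HasCompactSupport f) :
    HasDerivAt (matrixElement D g fun z => act (gz D z) (f z))
      (Complex.I * matrixElement D g f κ + (κ : ℂ)⁻¹ * matrixElement D g (hFun D f) κ) κ := by
  have hgf : ContDiff ℝ 1 fun z => act (gz D z) (f z) := contDiff_gz_apply hf
  have hgc := hasCompactSupport_gz D hc
  have hh : Continuous (hFun D f) :=
    (contDiff_hFun (D := D) 0 (by simpa using hf)).continuous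
  have hhc : HasCompactSupport (hFun D f) := compact_hFun hc
  have w0 := continuous_starWave D hf.continuous hc
  have w1 := continuous_starWave D hh hhc
  have w2 := continuous_starWave D hgf.continuous hgc
  have hdb : ∀ u, HasDerivAt (fun κ => starWave D κ (fun z => act (gz D z) (f z)) u) _ κ :=
    fun u => hasDerivAt_starWave D hκ hf hc u
  have hI := hasDerivAt_integral_of_compact
    (k := fun κ u => dbar D (g u) (act (gz D u) (starWave D κ (fun z => act (gz D z) (f z)) u)))
    (k' := fun κ u => dbar D (g u) (act (gz D u)
      (Complex.I • starWave D κ f u + (κ : ℂ)⁻¹ • (starWave D κ (hFun D f) u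
        - (3 / 2 : ℂ) • starWave D κ (fun z => act (gz D z) (f z)) u))))
    hg.2.isCompact (isOpen_Ioi (a := (0 : ℝ)))
    (fun s _ => continuous_dbar_gz hg.1 (continuous_starWave_right ⟨hgf.continuous, hgc⟩ s))
    (fun s _ z hz => by simp [image_eq_zero_of_notMem_tsupport hz, dbar])
    (by
      intro p hp
      have hp0 : (p.1 : ℂ) ≠ 0 := by exact_mod_cast (ne_of_gt hp.1)
      have c1 : ContinuousAt (fun p : ℝ × Space => (p.1 : ℂ)⁻¹) p :=
        (Complex.continuous_ofReal.comp continuous_fst).continuousAt.inv₀ hp0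
      have c2 : ContinuousAt (fun p : ℝ × Space => Complex.I • starWave D p.1 f p.2
          + (p.1 : ℂ)⁻¹ • (starWave D p.1 (hFun D f) p.2
          - (3 / 2 : ℂ) • starWave D p.1 (fun z => act (gz D z) (f z)) p.2)) p :=
        (w0.const_smul Complex.I).continuousAt.add
          (c1.smul (w1.sub (w2.const_smul (3 / 2 : ℂ))).continuousAt)
      have c3 : Continuous fun p : Space × Spinor × Space =>
          dbar D (g p.1) (act (gz D p.1) p.2.1) :=
        continuous_dbar D (hg.1.comp continuous_fst) (continuous_act_gz_apply D continuous_fst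
          (continuous_fst.comp continuous_snd))
      have c4 := c3.continuousAt.comp (x := p)
        (f := fun p : ℝ × Space => (p.2, Complex.I • starWave D p.1 f p.2
          + (p.1 : ℂ)⁻¹ • (starWave D p.1 (hFun D f) p.2
          - (3 / 2 : ℂ) • starWave D p.1 (fun z => act (gz D z) (f z)) p.2), p.2))
        (continuousAt_snd.prodMk (c2.prodMk continuousAt_snd))
      exact c4.continuousWithinAt)
    (fun s _ z hz => by simp [image_eq_zero_of_notMem_tsupport hz, dbar])
    (fun s hs z => ((dbarL D (g z)).comp (act (gz D z))).restrictScalars ℝ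
      |>.hasFDerivAt.comp_hasDerivAt s (hasDerivAt_starWave D hs hf hc z)) (Set.mem_Ioi.mpr hκ)
  have h := (hasDerivAt_coeff hκ).ofReal_comp.mul hI
  refine h.congr_deriv ?_
  rw [dbarIntegral_starWave_add_smul hg ⟨hf.continuous, hc⟩ ⟨hh, hhc⟩ ⟨hgf.continuous, hgc⟩]
  simp only [matrixElement]
  push_cast
  ring

/-- Integration of the differential equation from `κ` to `κ₁`, after one integration by parts
of the oscillating terms. -/
lemma norm_sub_le_of_system {β₀ β₁ η₀ η₁ ζ₀ ζ₁ : ℝ → ℂ} {A C : ℝ}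
    (hβ₁ : ∀ κ > 0, HasDerivAt β₁ (Complex.I * β₀ κ + (κ : ℂ)⁻¹ * η₀ κ) κ)
    (hβ₀ : ∀ κ > 0, HasDerivAt β₀ (Complex.I * β₁ κ - (κ : ℂ)⁻¹ * η₁ κ) κ)
    (hη₁ : ∀ κ > 0, HasDerivAt η₁ (Complex.I * η₀ κ + (κ : ℂ)⁻¹ * ζ₀ κ) κ)
    (hη₀ : ∀ κ > 0, HasDerivAt η₀ (Complex.I * η₁ κ - (κ : ℂ)⁻¹ * ζ₁ κ) κ)
    {c s b : ℝ → ℂ} (hc : ∀ κ, HasDerivAt c (-s κ) κ) (hs : ∀ κ, HasDerivAt s (c κ) κ)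
    (hb : ∀ κ > 0, b κ = -Complex.I * (c κ * β₁ κ - Complex.I * s κ * β₀ κ))
    (hQ : ∀ κ > 0, ‖c κ * η₁ κ + Complex.I * s κ * η₀ κ‖ ≤ A)
    (hR : ∀ κ > 0, ‖c κ * ζ₀ κ - Complex.I * s κ * ζ₁ κ‖ ≤ C) {κ κ₁ : ℝ} (hκ : 0 < κ)
    (h1 : κ ≤ κ₁) : ‖b κ₁ - b κ‖ ≤ κ⁻¹ * (A + C) := by
  have hκ₁ : 0 < κ₁ := hκ.trans_le h1
  have hI : Complex.I ^ 2 = -1 := Complex.I_sq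
  set Q : ℝ → ℂ := fun κ => c κ * η₁ κ + Complex.I * s κ * η₀ κ with hQdef
  set R : ℝ → ℂ := fun κ => c κ * ζ₀ κ - Complex.I * s κ * ζ₁ κ with hRdef
  -- The derivative of `b` is `κ⁻¹` times an oscillation of frequency `2`, whose primitive is a
  -- multiple of `Q`; adding it to `b` leaves a derivative of order `κ⁻²`.
  set Y : ℝ → ℂ := fun κ => -Complex.I * (c κ * β₁ κ - Complex.I * s κ * β₀ κ)
    + (1 / 2 : ℂ) * (κ : ℂ)⁻¹ * Q κ with hY
  have hYd : ∀ t : ℝ, 0 < t → HasDerivAt Y ((1 / 2 : ℂ) * ((t : ℂ)⁻¹) ^ 2 * (R t - Q t)) t := by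
    intro t ht
    have ht0 : (t : ℂ) ≠ 0 := by exact_mod_cast ht.ne'
    have hinv : HasDerivAt (fun κ : ℝ => (κ : ℂ)⁻¹) (-((t : ℂ)⁻¹) ^ 2) t := by
      have h := (hasDerivAt_inv ht.ne').ofReal_comp
      simp only [Complex.ofReal_inv] at h
      refine h.congr_deriv ?_
      push_cast
      rw [inv_pow]
    have hQd := ((hc t).mul (hη₁ t ht)).add (((hs t).const_mul Complex.I).mul (hη₀ t ht))
    have h := ((((hc t).mul (hβ₁ t ht)).sub (((hs t).const_mul Complex.I).mul
      (hβ₀ t ht))).const_mul (-Complex.I)).add ((hinv.const_mul (1 / 2 : ℂ)).mul hQd)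
    refine h.congr_deriv ?_
    simp only [hQdef, hRdef, Pi.add_apply, Pi.mul_apply]
    generalize (t : ℂ)⁻¹ = i
    linear_combination (Complex.I * s t * β₁ t - 1 / 2 * s t * i * η₁ t) * hI
  have hYb : ‖Y κ₁ - Y κ‖ ≤ (A + C) / 2 * (κ⁻¹ - κ₁⁻¹) := by
    refine image_norm_le_of_norm_deriv_right_le_deriv_boundary' (a := κ) (b := κ₁)
      (f := fun x => Y x - Y κ) (f' := fun t => (1 / 2 : ℂ) * ((t : ℂ)⁻¹) ^ 2 * (R t - Q t))
      (B := fun x => (A + C) / 2 * (κ⁻¹ - x⁻¹)) (B' := fun x => (A + C) / 2 * (x ^ 2)⁻¹)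
      (fun t ht => ((hYd t (hκ.trans_le ht.1)).sub_const _).continuousAt.continuousWithinAt)
      (fun t ht => ((hYd t (hκ.trans_le ht.1)).sub_const _).hasDerivWithinAt) (by simp)
      (fun t ht => ?_) (fun t ht => ?_) (fun t ht => ?_) (Set.right_mem_Icc.mpr h1)
    · have ht0 : t ≠ 0 := (hκ.trans_le ht.1).ne'
      exact (((hasDerivAt_inv ht0).const_sub κ⁻¹).const_mul
        ((A + C) / 2)).continuousAt.continuousWithinAt
    · have ht0 : t ≠ 0 := (hκ.trans_le ht.1).ne'
      refine (((hasDerivAt_inv ht0).const_sub κ⁻¹).const_mul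
        ((A + C) / 2)).hasDerivWithinAt.congr_deriv ?_
      ring
    · have ht0 : 0 < t := hκ.trans_le ht.1
      have h2 : ‖R t - Q t‖ ≤ A + C := by
        rw [add_comm]
        exact (norm_sub_le _ _).trans (add_le_add (hR t ht0) (hQ t ht0))
      rw [norm_mul, norm_mul, norm_pow, norm_inv, Complex.norm_real, Real.norm_eq_abs,
        abs_of_pos ht0, inv_pow]
      norm_num
      nlinarith [mul_le_mul_of_nonneg_left h2 (inv_nonneg.mpr (sq_nonneg t))]
  have hbY : ∀ t : ℝ, 0 < t → b t = Y t - (1 / 2 : ℂ) * (t : ℂ)⁻¹ * Q t := fun t ht => by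
    rw [hb t ht]; simp only [hY]; ring
  have hQn : ∀ t : ℝ, 0 < t → ‖(1 / 2 : ℂ) * (t : ℂ)⁻¹ * Q t‖ ≤ 1 / 2 * t⁻¹ * A := fun t ht => by
    rw [norm_mul, norm_mul, norm_inv, Complex.norm_real, Real.norm_eq_abs, abs_of_pos ht]
    have h2 : ‖(1 / 2 : ℂ)‖ = 1 / 2 := by norm_num
    rw [h2]
    exact mul_le_mul_of_nonneg_left (hQ t ht) (by positivity)
  have hA : 0 ≤ A := (norm_nonneg _).trans (hQ κ hκ)
  have hC : 0 ≤ C := (norm_nonneg _).trans (hR κ hκ)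
  have hinv : κ₁⁻¹ ≤ κ⁻¹ := inv_anti₀ hκ h1
  have hi0 : 0 < κ₁⁻¹ := inv_pos.mpr hκ₁
  calc ‖b κ₁ - b κ‖ = ‖(Y κ₁ - Y κ) - ((1 / 2 : ℂ) * (κ₁ : ℂ)⁻¹ * Q κ₁
        - (1 / 2 : ℂ) * (κ : ℂ)⁻¹ * Q κ)‖ := by
        rw [hbY κ₁ hκ₁, hbY κ hκ]; congr 1; ring
    _ ≤ (A + C) / 2 * (κ⁻¹ - κ₁⁻¹) + (1 / 2 * κ₁⁻¹ * A + 1 / 2 * κ⁻¹ * A) :=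
        (norm_sub_le _ _).trans (add_le_add hYb ((norm_sub_le _ _).trans
          (add_le_add (hQn κ₁ hκ₁) (hQn κ hκ))))
    _ ≤ κ⁻¹ * (A + C) := by nlinarith

lemma hasDerivAt_cos_shift (κ : ℝ) :
    HasDerivAt (fun κ : ℝ => ((Real.cos (κ + Real.pi / 4) : ℝ) : ℂ))
      (-((Real.sin (κ + Real.pi / 4) : ℝ) : ℂ)) κ := by
  have h := ((Real.hasDerivAt_cos (κ + Real.pi / 4)).comp κ
    ((hasDerivAt_id κ).add_const (Real.pi / 4))).ofReal_comp
  refine h.congr_deriv ?_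
  push_cast; ring

lemma hasDerivAt_sin_shift (κ : ℝ) :
    HasDerivAt (fun κ : ℝ => ((Real.sin (κ + Real.pi / 4) : ℝ) : ℂ))
      ((Real.cos (κ + Real.pi / 4) : ℝ) : ℂ) κ := by
  have h := ((Real.hasDerivAt_sin (κ + Real.pi / 4)).comp κ
    ((hasDerivAt_id κ).add_const (Real.pi / 4))).ofReal_comp
  refine h.congr_deriv ?_
  push_cast; ring

/-- The phase `e^{-i(κ+π/4)γ·z}` mixes the matrix elements of `f` and of `γ·z f`. -/
lemma inner_adjoint_T {κ : ℝ} (hκ : 0 < κ) (g : C0 ((⊤ : ℕ∞) : WithTop ℕ∞))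
    {k : WithTop ℕ∞} (f : C0 k) :
    (inner ℂ (toState D g) (ContinuousLinearMap.adjoint (T D κ) (toState D f)) : ℂ)
      = -Complex.I * (((Real.cos (κ + Real.pi / 4) : ℝ) : ℂ)
          * matrixElement D g.toFun (fun z => act (gz D z) (f.toFun z)) κ
        - Complex.I * ((Real.sin (κ + Real.pi / 4) : ℝ) : ℂ)
          * matrixElement D g.toFun f.toFun κ) := by
  rw [adjoint_T_apply, G_apply, inner_smul_right, map_add, map_smul, map_smul, inner_add_right,
    inner_smul_right, inner_smul_right, inner_adjoint_F_toState hκ, inner_adjoint_F_Gam hκ,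
    Real.cos_neg, Real.sin_neg]
  push_cast
  ring

/-- The matrix elements of `T*` vary little at large frequencies. -/
lemma norm_inner_adjoint_T_sub_le {κ κ₁ : ℝ} (hκ : 0 < κ) (h1 : κ ≤ κ₁)
    (g : C0 ((⊤ : ℕ∞) : WithTop ℕ∞)) (f : C0 ((2 : ℕ) : WithTop ℕ∞)) :
    ‖(inner ℂ (toState D g) (ContinuousLinearMap.adjoint (T D κ₁) (toState D f)) : ℂ)
      - inner ℂ (toState D g) (ContinuousLinearMap.adjoint (T D κ) (toState D f))‖
      ≤ κ⁻¹ * (‖toState D g‖ * ‖toState D (hOp D f)‖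
        + ‖toState D g‖ * ‖toState D (hOp D (hOp D f))‖) := by
  have hg : Continuous g.toFun ∧ HasCompactSupport g.toFun := ⟨g.contDiff.continuous, g.compact⟩
  have hf : ContDiff ℝ 1 f.toFun := f.contDiff.of_le (by norm_num)
  have hh : ContDiff ℝ 1 (hFun D f.toFun) := contDiff_hFun 1 f.contDiff
  have hhc : HasCompactSupport (hFun D f.toFun) := compact_hFun f.compact
  have key : ∀ {φ : Space → Spinor}, ContDiff ℝ 1 φ → HasCompactSupport φ → ∀ t : ℝ, 0 < t →
      HasDerivAt (matrixElement D g.toFun φ)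
        (Complex.I * matrixElement D g.toFun (fun z => act (gz D z) (φ z)) t
          - (t : ℂ)⁻¹ * matrixElement D g.toFun (fun z => act (gz D z) (hFun D φ z)) t) t := by
    intro φ hφ hφc t ht
    have h := hasDerivAt_matrixElement (D := D) ht hg (contDiff_gz_apply (D := D) hφ)
      (hasCompactSupport_gz D hφc)
    have e : hFun D (fun z => act (gz D z) (φ z))
        = fun z => (-1 : ℂ) • act (gz D z) (hFun D φ z) := funext fun z => by
      rw [hFun_gz D (hφ.differentiable (by norm_num)), neg_one_smul]
    have e2 : ∀ ψ : Space → Spinor, matrixElement D g.toFun (fun z => (-1 : ℂ) • ψ z) t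
        = -matrixElement D g.toFun ψ t := fun ψ => by
      simp only [matrixElement, starWave_smul, map_smul, dbar_smul_right]
      rw [integral_const_mul]; ring
    simp only [act_gz_gz] at h
    rw [e, e2] at h
    exact h.congr_deriv (by ring)
  have hnorm : ∀ t : ℝ, 0 < t → ∀ x : State D,
      ‖(inner ℂ (toState D g) (ContinuousLinearMap.adjoint (F D t) x) : ℂ)‖
        ≤ ‖toState D g‖ * ‖x‖ := fun t ht x => by
    refine (norm_inner_le_norm _ _).trans (le_of_eq ?_)
    rw [(adjoint_F ht).2]
  refine norm_sub_le_of_system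
    (β₁ := matrixElement D g.toFun fun z => act (gz D z) (f.toFun z))
    (β₀ := matrixElement D g.toFun f.toFun)
    (η₁ := matrixElement D g.toFun fun z => act (gz D z) (hFun D f.toFun z))
    (η₀ := matrixElement D g.toFun (hFun D f.toFun))
    (ζ₁ := matrixElement D g.toFun fun z => act (gz D z) (hFun D (hFun D f.toFun) z))
    (ζ₀ := matrixElement D g.toFun (hFun D (hFun D f.toFun)))
    (fun t ht => hasDerivAt_matrixElement ht hg hf f.compact) (key hf f.compact)
    (fun t ht => hasDerivAt_matrixElement ht hg hh hhc) (key hh hhc)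
    hasDerivAt_cos_shift hasDerivAt_sin_shift
    (b := fun t => inner ℂ (toState D g) (ContinuousLinearMap.adjoint (T D t) (toState D f)))
    (fun t ht => inner_adjoint_T ht g f) (fun t ht => ?_) (fun t ht => ?_) hκ h1
  · refine le_trans (le_of_eq ?_) ((hnorm t ht (G D (t + Real.pi / 4) (toState D (hOp D f)))).trans
      (by rw [norm_G]))
    rw [G_apply, map_add, map_smul, map_smul, inner_add_right, inner_smul_right, inner_smul_right,
      inner_adjoint_F_toState ht, inner_adjoint_F_Gam ht]
    rfl
  · refine le_trans (le_of_eq ?_) ((hnorm t ht (G D (-(t + Real.pi / 4))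
      (Gam D (toState D (hOp D (hOp D f)))))).trans (by
        rw [norm_G, norm_Gam]))
    rw [G_apply, Gam_apply_Gam, map_add, map_smul, map_smul, inner_add_right, inner_smul_right,
      inner_smul_right, inner_adjoint_F_toState ht, inner_adjoint_F_Gam ht, Real.cos_neg,
      Real.sin_neg]
    congr 1
    push_cast
    simp only [hOp]
    ring

end

section

attribute [local irreducible] mdot pt time

/-! ### Abel means -/

/-- The weight `R⁻¹ e^{-κ/R}` of the Abel mean. -/
def abelWeight (R κ : ℝ) : ℝ := R⁻¹ * Real.exp (-R⁻¹ * κ)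

lemma integrableOn_abelWeight {R : ℝ} (hR : 0 < R) : IntegrableOn (abelWeight R) (Set.Ioi 0) :=
  (integrableOn_exp_mul_Ioi (by simpa using hR) 0).const_mul _

lemma integral_abelWeight {R : ℝ} (hR : 0 < R) : ∫ κ in Set.Ioi 0, abelWeight R κ = 1 := by
  simp only [abelWeight]
  rw [integral_const_mul, integral_exp_mul_Ioi (by simpa using hR)]
  field_simp
  simp

lemma abelWeight_nonneg {R : ℝ} (hR : 0 < R) (κ : ℝ) : 0 ≤ abelWeight R κ := by
  unfold abelWeight; positivity

/-- A function which stays close to its value at `κ` from there on has an Abel limit close to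
that value. -/
lemma norm_abel_limit_sub_le {b : ℝ → ℂ} {L : ℂ} {κ C M : ℝ} (hκ : 0 ≤ κ) (hC : 0 ≤ C)
    (hM : ∀ t > 0, ‖b t - b κ‖ ≤ M) (hb : ∀ t, κ ≤ t → ‖b t - b κ‖ ≤ C)
    (hi : ∀ R > 0, IntegrableOn (fun t => (abelWeight R t : ℂ) * b t) (Set.Ioi 0))
    (hL : Tendsto (fun R => ∫ t in Set.Ioi 0, (abelWeight R t : ℂ) * b t) atTop (𝓝 L)) :
    ‖L - b κ‖ ≤ C := by
  have hM0 : 0 ≤ M := (norm_nonneg _).trans (hM 1 one_pos)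
  have hlim : Tendsto (fun R : ℝ => C + M * κ * R⁻¹) atTop (𝓝 (C + M * κ * 0)) :=
    (tendsto_inv_atTop_zero.const_mul _).const_add _
  rw [mul_zero, add_zero] at hlim
  refine le_of_tendsto_of_tendsto (hL.sub_const (b κ)).norm hlim ?_
  filter_upwards [eventually_gt_atTop 0] with R hR
  have hw := integrableOn_abelWeight hR
  have hw1 : ∫ t in Set.Ioi (0 : ℝ), (abelWeight R t : ℂ) * b κ = b κ := by
    rw [integral_mul_const, integral_complex_ofReal, integral_abelWeight hR, Complex.ofReal_one,
      one_mul]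
  have hwi : IntegrableOn (fun t => (abelWeight R t : ℂ) * b κ) (Set.Ioi 0) :=
    hw.ofReal.mul_const _
  have e : (∫ t in Set.Ioi 0, (abelWeight R t : ℂ) * b t) - b κ
      = ∫ t in Set.Ioi 0, (abelWeight R t : ℂ) * (b t - b κ) := by
    conv_lhs => rw [← hw1]
    rw [← integral_sub (hi R hR) hwi]
    simp only [mul_sub]
  have hind : IntegrableOn (fun t => (Set.Ioc 0 κ).indicator (fun _ => R⁻¹ * M) t)
      (Set.Ioi 0) :=
    (((integrable_indicator_iff measurableSet_Ioc).mpr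
      (integrableOn_const measure_Ioc_lt_top.ne)) : Integrable _ volume).integrableOn
  have hle := norm_integral_le_of_norm_le (μ := volume.restrict (Set.Ioi 0))
    (f := fun t => (abelWeight R t : ℂ) * (b t - b κ))
    (g := fun t => abelWeight R t * C + (Set.Ioc 0 κ).indicator (fun _ => R⁻¹ * M) t)
    ((hw.mul_const C).add hind) ((ae_restrict_iff' measurableSet_Ioi).mpr
      (Eventually.of_forall fun t ht => ?_))
  · rw [e]
    refine hle.trans (le_of_eq ?_)
    rw [integral_add (hw.mul_const C) hind, integral_mul_const, integral_abelWeight hR, one_mul,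
      setIntegral_indicator measurableSet_Ioc,
      Set.inter_eq_self_of_subset_right Set.Ioc_subset_Ioi_self, setIntegral_const]
    simp [Measure.real, hκ]
    ring
  · have ht' : (0 : ℝ) < t := ht
    have ha := abelWeight_nonneg hR t
    rw [norm_mul, Complex.norm_real, Real.norm_of_nonneg ha]
    by_cases h : t ≤ κ
    · rw [Set.indicator_of_mem (show t ∈ Set.Ioc 0 κ from ⟨ht', h⟩)]
      have h1 : abelWeight R t ≤ R⁻¹ := by
        unfold abelWeight
        refine mul_le_of_le_one_right (by positivity) (Real.exp_le_one_iff.mpr ?_)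
        have : 0 ≤ R⁻¹ * t := by positivity
        linarith
      have h2 := mul_le_mul h1 (hM t ht') (norm_nonneg _) (by positivity)
      nlinarith [mul_nonneg ha hC]
    · rw [Set.indicator_of_notMem fun h' => h h'.2, add_zero]
      exact mul_le_mul_of_nonneg_left (hb t (not_le.mp h).le) ha

/-- The growth `κ^{3/2}` of the normalisation turns the Abel mean of an oscillation `e^{iκx}` into
the kernel `R^{3/2} (1 - iRx)^{-5/2}`, which is an approximate identity in dimension three if
`x` vanishes to second order on the diagonal. -/
lemma integral_abelWeight_coeff {R : ℝ} (hR : 0 < R) (x : ℝ) :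
    ∫ κ in Set.Ioi (0 : ℝ), (abelWeight R κ : ℂ) * (coeff κ * Complex.exp (Complex.I * κ * x))
      = Complex.Gamma (5 / 2) * (((2 * Real.pi) ^ (3 / 2 : ℝ) : ℝ) : ℂ)⁻¹
        * ((√R ^ 3 : ℝ) * (1 - Complex.I * (R * x : ℝ)) ^ ((-(5 / 2) : ℝ) : ℂ)) := by
  have hp := Real.pi_pos
  have hre : (1 - Complex.I * (R * x : ℝ)).re = 1 := by simp
  have hne : (1 - Complex.I * (R * x : ℝ)) ≠ 0 := fun h => by rw [h] at hre; simp at hre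
  have hb : ((R⁻¹ : ℝ) : ℂ) * (1 - Complex.I * (R * x : ℝ)) = ((R⁻¹ : ℝ) : ℂ) - Complex.I * x := by
    have : (R : ℂ) ≠ 0 := by exact_mod_cast hR.ne'
    push_cast
    field_simp
  have hbre : (((R⁻¹ : ℝ) : ℂ) - Complex.I * x).re = R⁻¹ := by simp
  have e : ∀ κ ∈ Set.Ioi (0 : ℝ),
      (abelWeight R κ : ℂ) * (coeff κ * Complex.exp (Complex.I * κ * x))
        = ((R⁻¹ : ℝ) : ℂ) * (((2 * Real.pi) ^ (3 / 2 : ℝ) : ℝ) : ℂ)⁻¹ *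
          (((κ ^ ((5 / 2 : ℝ) - 1) : ℝ) : ℂ)
            * Complex.exp (-((((R⁻¹ : ℝ) : ℂ) - Complex.I * x) * κ))) := by
    intro κ hκ
    rw [abelWeight, coeff, Real.div_rpow (le_of_lt hκ) (by positivity),
      show (5 / 2 : ℝ) - 1 = 3 / 2 by norm_num,
      show -((((R⁻¹ : ℝ) : ℂ) - Complex.I * x) * κ)
        = ((-R⁻¹ * κ : ℝ) : ℂ) + Complex.I * κ * x by push_cast; ring, Complex.exp_add]
    simp only [Complex.ofReal_mul, Complex.ofReal_exp, Complex.ofReal_div]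
    ring
  rw [setIntegral_congr_fun measurableSet_Ioi e, integral_const_mul,
    integral_rpow_mul_cexp (by norm_num) (by rw [hbre]; positivity), ← hb,
    ofReal_mul_cpow (inv_pos.mpr hR) hne]
  have h1 : ((R⁻¹ : ℝ) : ℂ) * ((R⁻¹ : ℝ) : ℂ) ^ (-((5 / 2 : ℝ) : ℂ)) = ((√R ^ 3 : ℝ) : ℂ) := by
    rw [← Complex.ofReal_neg, ← Complex.ofReal_cpow (by positivity), ← Complex.ofReal_mul]
    congr 1
    rw [Real.inv_rpow hR.le, Real.rpow_neg hR.le, inv_inv, Real.sqrt_eq_rpow, ← Real.rpow_natCast,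
      ← Real.rpow_mul hR.le, ← Real.rpow_neg_one, ← Real.rpow_add hR]
    norm_num
  rw [← h1, Complex.ofReal_neg]
  push_cast
  ring

/-! ### Oscillatory double integrals -/

/-- The double integral of an amplitude with the oscillating factor `e^{iκx}`. -/
def oscInt (a : Space → Space → ℂ) (x : Space × Space → ℝ) (κ : ℝ) : ℂ :=
  ∫ p : Space × Space, a p.1 p.2 * Complex.exp (Complex.I * κ * x p)
    ∂(hypMeasure.prod hypMeasure)

variable {a : Space → Space → ℂ} {K : Set Space} {x : Space × Space → ℝ}

lemma integrable_of_supported {b : Space × Space → ℂ} (hb : Continuous b) (hK : IsCompact K)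
    (h : ∀ z z', b (z, z') ≠ 0 → z ∈ K ∧ z' ∈ K) :
    Integrable b (hypMeasure.prod hypMeasure) := by
  refine hb.integrable_of_hasCompactSupport (HasCompactSupport.intro (hK.prod hK) fun p hp => ?_)
  by_contra h0
  exact hp (h p.1 p.2 h0)

lemma abel_oscInt (ha : Continuous (Function.uncurry a)) (hK : IsCompact K)
    (haK : ∀ z z', a z z' ≠ 0 → z ∈ K ∧ z' ∈ K) (hx : Continuous x) {R : ℝ} (hR : 0 < R) :
    IntegrableOn (fun κ => (abelWeight R κ : ℂ) * (coeff κ * oscInt a x κ)) (Set.Ioi 0) ∧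
    ∫ κ in Set.Ioi 0, (abelWeight R κ : ℂ) * (coeff κ * oscInt a x κ)
      = Complex.Gamma (5 / 2) * (((2 * Real.pi) ^ (3 / 2 : ℝ) : ℝ) : ℂ)⁻¹ *
        ∫ p : Space × Space, a p.1 p.2 * ((√R ^ 3 : ℝ) *
          (1 - Complex.I * (R * x p : ℝ)) ^ ((-(5 / 2) : ℝ) : ℂ))
          ∂(hypMeasure.prod hypMeasure) := by
  have hp := Real.pi_pos
  have hai : Integrable (fun p : Space × Space => a p.1 p.2) (hypMeasure.prod hypMeasure) :=
    integrable_of_supported ha hK haK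
  have hwc : IntegrableOn (fun κ => ((abelWeight R κ * coeff κ : ℝ) : ℂ)) (Set.Ioi 0) := by
    have h := (integrableOn_rpow_mul_exp (a := 3 / 2) (d := R⁻¹) (by norm_num)
      (by positivity)).const_mul (R⁻¹ * ((2 * Real.pi) ^ (3 / 2 : ℝ))⁻¹)
    have h2 : IntegrableOn (fun κ => abelWeight R κ * coeff κ) (Set.Ioi 0) := by
      refine h.congr ((ae_restrict_iff' measurableSet_Ioi).mpr
        (Eventually.of_forall fun κ hκ => ?_))
      simp only [abelWeight, coeff]
      rw [Real.div_rpow (le_of_lt hκ) (by positivity)]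
      ring
    exact h2.ofReal
  have hprod := hwc.mul_prod hai
  have hint : Integrable (fun q : ℝ × Space × Space =>
      ((abelWeight R q.1 * coeff q.1 : ℝ) : ℂ) * a q.2.1 q.2.2
        * Complex.exp (Complex.I * q.1 * x q.2))
      ((volume.restrict (Set.Ioi 0)).prod (hypMeasure.prod hypMeasure)) := by
    refine hprod.mul_bdd (c := 1) ?_ (Eventually.of_forall fun q => ?_)
    · refine Continuous.aestronglyMeasurable (Complex.continuous_exp.comp ?_)
      exact (continuous_const.mul (Complex.continuous_ofReal.comp continuous_fst)).mul
        (Complex.continuous_ofReal.comp (hx.comp continuous_snd))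
    · rw [mul_assoc, mul_comm Complex.I, ← Complex.ofReal_mul, Complex.norm_exp_ofReal_mul_I]
  have e : ∀ κ, (abelWeight R κ : ℂ) * (coeff κ * oscInt a x κ)
      = ∫ p : Space × Space, ((abelWeight R κ * coeff κ : ℝ) : ℂ) * a p.1 p.2
        * Complex.exp (Complex.I * κ * x p) ∂(hypMeasure.prod hypMeasure) := fun κ => by
    rw [oscInt, ← integral_const_mul, ← integral_const_mul]
    refine integral_congr_ae (Eventually.of_forall fun p => ?_)
    push_cast
    ring
  simp only [e]
  refine ⟨hint.integral_prod_left, ?_⟩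
  rw [integral_integral_swap hint, ← integral_const_mul]
  refine integral_congr_ae (Eventually.of_forall fun p => ?_)
  simp only
  rw [mul_left_comm, ← integral_abelWeight_coeff hR (x p), ← integral_const_mul]
  refine integral_congr_ae (Eventually.of_forall fun κ => ?_)
  push_cast
  ring

/-- For a phase which is stationary on the diagonal, the Abel mean selects the diagonal. -/
lemma tendsto_abel_oscInt (ha : Continuous (Function.uncurry a)) (hK : IsCompact K)
    (haK : ∀ z z', a z z' ≠ 0 → z ∈ K ∧ z' ∈ K) {s : ℝ} (hs : s = 1 ∨ s = -1) :
    Tendsto (fun R => ∫ κ in Set.Ioi 0, (abelWeight R κ : ℂ) *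
      (coeff κ * oscInt a (fun p => s * (mdot (pt p.1) (pt p.2) - 1)) κ)) atTop
      (𝓝 (Complex.exp (Complex.I * s * (3 * Real.pi / 4)) * ∫ z, a z z ∂hypMeasure)) := by
  have hp := Real.pi_pos
  have hs2 : s ^ 2 = 1 := by rcases hs with rfl | rfl <;> norm_num
  have hxc : Continuous fun p : Space × Space => s * (mdot (pt p.1) (pt p.2) - 1) :=
    continuous_const.mul (continuous_mdot_pt.sub continuous_const)
  have hkc : ∀ R, Continuous fun p : Space × Space => profile s (R * distSq p.1 p.2) := fun R =>
    (continuous_profile s).comp (continuous_const.mul continuous_distSq)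
  have h := tendsto_integral_kernel ha hK haK (k := fun R z z' => profile s (R * distSq z z'))
    (C := 8) (H := profile s) (Eventually.of_forall hkc) (by
      filter_upwards [eventually_ge_atTop 0] with R hR z z'
      exact norm_profile_le hs2 (mul_nonneg hR (distSq_nonneg z z')))
    fun z y => ((continuous_profile s).tendsto _).comp (tendsto_distSq z y)
  have h2 := h.const_mul (Complex.Gamma (5 / 2) * (((2 * Real.pi) ^ (3 / 2 : ℝ) : ℝ) : ℂ)⁻¹)
  have hc0 : (((2 * Real.pi) ^ (3 / 2 : ℝ) : ℝ) : ℂ) ≠ 0 := by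
    exact_mod_cast (Real.rpow_pos_of_pos (by positivity) _).ne'
  have e : Complex.Gamma (5 / 2) * (((2 * Real.pi) ^ (3 / 2 : ℝ) : ℝ) : ℂ)⁻¹
      * ((∫ z, a z z ∂hypMeasure) * ∫ y : Space, profile s (‖y‖ ^ 2))
      = Complex.exp (Complex.I * s * (3 * Real.pi / 4)) * ∫ z, a z z ∂hypMeasure := by
    have := integral_profile_eq hs
    generalize Complex.exp _ = E at this ⊢
    field_simp
    linear_combination (∫ z, a z z ∂hypMeasure) * this
  rw [e] at h2
  refine h2.congr' ?_
  filter_upwards [eventually_gt_atTop 0] with R hR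
  rw [(abel_oscInt ha hK haK hxc hR).2]
  congr 1
  have e2 : ∀ p : Space × Space, a p.1 p.2 * ((√R ^ 3 : ℝ) *
      (1 - Complex.I * (R * (s * (mdot (pt p.1) (pt p.2) - 1)) : ℝ)) ^ ((-(5 / 2) : ℝ) : ℂ))
      = (√R ^ 3 : ℝ) * (a p.1 p.2 * profile s (R * distSq p.1 p.2)) := fun p => by
    rw [profile, mdot_pt_eq_distSq]
    have : (1 - Complex.I * (R * (s * (1 + distSq p.1 p.2 / 2 - 1)) : ℝ) : ℂ)
        = 1 - Complex.I * s / 2 * (R * distSq p.1 p.2 : ℝ) := by push_cast; ring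
    rw [this]
    ring
  simp only [e2]
  have hint : Integrable (fun p : Space × Space =>
      ((√R ^ 3 : ℝ) : ℂ) * (a p.1 p.2 * profile s (R * distSq p.1 p.2)))
      (hypMeasure.prod hypMeasure) :=
    (integrable_of_supported (ha.mul (hkc R)) hK fun z z' h0 =>
      haK z z' (left_ne_zero_of_mul h0)).const_mul _
  rw [integral_prod _ hint]
  refine integral_congr_ae (Eventually.of_forall fun z => ?_)
  simp only
  rw [integral_const_mul, Complex.real_smul]

/-- For a phase without zeros the Abel mean tends to zero. -/
lemma tendsto_abel_oscInt_zero (ha : Continuous (Function.uncurry a)) (hK : IsCompact K)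
    (haK : ∀ z z', a z z' ≠ 0 → z ∈ K ∧ z' ∈ K) (hx : Continuous x) (h1 : ∀ p, 1 ≤ |x p|) :
    Tendsto (fun R => ∫ κ in Set.Ioi 0, (abelWeight R κ : ℂ) * (coeff κ * oscInt a x κ)) atTop
      (𝓝 0) := by
  have hai : Integrable (fun p : Space × Space => a p.1 p.2) (hypMeasure.prod hypMeasure) :=
    integrable_of_supported ha hK haK
  have hlim : Tendsto (fun R : ℝ => ‖Complex.Gamma (5 / 2) *
      (((2 * Real.pi) ^ (3 / 2 : ℝ) : ℝ) : ℂ)⁻¹‖ *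
        ((∫ p : Space × Space, ‖a p.1 p.2‖ ∂(hypMeasure.prod hypMeasure)) * R⁻¹)) atTop
      (𝓝 0) := by
    simpa using (tendsto_inv_atTop_zero (𝕜 := ℝ)).const_mul _ |>.const_mul _
  refine squeeze_zero_norm' ?_ hlim
  filter_upwards [eventually_gt_atTop 0] with R hR
  rw [(abel_oscInt ha hK haK hx hR).2, norm_mul]
  gcongr
  rw [← integral_mul_const]
  refine norm_integral_le_of_norm_le (hai.norm.mul_const _) (Eventually.of_forall fun p => ?_)
  rw [norm_mul]
  gcongr
  have hre : (1 - Complex.I * (R * x p : ℝ)).re = 1 := by simp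
  have hne : (1 - Complex.I * (R * x p : ℝ)) ≠ 0 := fun h => by rw [h] at hre; simp at hre
  have hn : R ≤ ‖1 - Complex.I * (R * x p : ℝ)‖ := by
    have h := Complex.abs_im_le_norm (1 - Complex.I * (R * x p : ℝ))
    have him : (1 - Complex.I * (R * x p : ℝ)).im = -(R * x p) := by simp
    rw [him, abs_neg, abs_mul, abs_of_pos hR] at h
    exact (le_mul_of_one_le_right hR.le (h1 p)).trans h
  rw [norm_mul, Complex.norm_real, Real.norm_of_nonneg (by positivity), Complex.norm_cpow_real]
  calc √R ^ 3 * ‖1 - Complex.I * (R * x p : ℝ)‖ ^ (-(5 / 2) : ℝ)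
      ≤ √R ^ 3 * R ^ (-(5 / 2) : ℝ) := by
        exact mul_le_mul_of_nonneg_left (Real.rpow_le_rpow_of_nonpos hR hn (by norm_num))
          (by positivity)
    _ = R⁻¹ := by
        rw [Real.sqrt_eq_rpow, ← Real.rpow_natCast, ← Real.rpow_mul hR.le, ← Real.rpow_add hR,
          ← Real.rpow_neg_one]
        norm_num

end

section

attribute [local irreducible] mdot pt time

variable {D : DiracMatrices}

/-! ### The limit of the matrix elements and the error estimate -/

section MatrixElements

variable {p q r : Space → Spinor}

lemma continuous_uncurry_dbar (hp : Continuous p) (hq : Continuous q) :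
    Continuous (Function.uncurry fun u z => dbar D (p u) (q z)) :=
  continuous_dbar D (hp.comp continuous_fst) (hq.comp continuous_snd)

lemma dbar_supported (z z' : Space) (h : dbar D (p z) (q z') ≠ 0) :
    z ∈ tsupport p ∪ tsupport q ∧ z' ∈ tsupport p ∪ tsupport q := by
  constructor
  · by_contra h'
    exact h (by simp [image_eq_zero_of_notMem_tsupport fun h0 => h' (Or.inl h0), dbar])
  · by_contra h'
    exact h (by simp [image_eq_zero_of_notMem_tsupport fun h0 => h' (Or.inr h0), dbar])

variable (D) in
/-- The oscillatory double integral of `p̄(u) q(z)` with phase `σ u·z + τ`. -/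
def pairOsc (p q : Space → Spinor) (σ τ κ : ℝ) : ℂ :=
  oscInt (fun u z => dbar D (p u) (q z)) (fun x => σ * mdot (pt x.1) (pt x.2) + τ) κ

lemma pairOsc_shift (p q : Space → Spinor) (σ τ κ : ℝ) :
    pairOsc D p q σ τ κ = Complex.exp (Complex.I * κ * τ) * pairOsc D p q σ 0 κ := by
  rw [pairOsc, pairOsc, oscInt, oscInt, ← integral_const_mul]
  refine integral_congr_ae (Eventually.of_forall fun x => ?_)
  simp only
  rw [mul_left_comm, ← Complex.exp_add]
  congr 2
  push_cast
  ring

lemma continuous_phase (σ τ : ℝ) :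
    Continuous fun x : Space × Space => σ * mdot (pt x.1) (pt x.2) + τ :=
  (continuous_const.mul continuous_mdot_pt).add continuous_const

lemma integrable_pairOsc (hp : ContinuousCompact p) (hq : ContinuousCompact q) (σ τ κ : ℝ) :
    Integrable (fun x : Space × Space => dbar D (p x.1) (q x.2)
      * Complex.exp (Complex.I * κ * (σ * mdot (pt x.1) (pt x.2) + τ : ℝ)))
      (hypMeasure.prod hypMeasure) := by
  refine integrable_of_supported ((continuous_uncurry_dbar hp.1 hq.1).mul
    (Complex.continuous_exp.comp (continuous_const.mul (Complex.continuous_ofReal.comp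
      (continuous_phase σ τ))))) (hp.2.isCompact.union hq.2.isCompact) fun z z' h => ?_
  exact dbar_supported z z' (left_ne_zero_of_mul h)

lemma pairOsc_add (hp : ContinuousCompact p) (hq : ContinuousCompact q) (hr : ContinuousCompact r)
    (σ κ : ℝ) : pairOsc D p (fun z => q z + r z) σ 0 κ
      = pairOsc D p q σ 0 κ + pairOsc D p r σ 0 κ := by
  simp only [pairOsc, oscInt, dbar_add_right, add_mul]
  exact integral_add (integrable_pairOsc hp hq σ 0 κ) (integrable_pairOsc hp hr σ 0 κ)

lemma pairOsc_sub (hp : ContinuousCompact p) (hq : ContinuousCompact q) (hr : ContinuousCompact r)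
    (σ κ : ℝ) : pairOsc D p (fun z => q z - r z) σ 0 κ
      = pairOsc D p q σ 0 κ - pairOsc D p r σ 0 κ := by
  simp only [pairOsc, oscInt, dbar_sub_right, sub_mul]
  exact integral_sub (integrable_pairOsc hp hq σ 0 κ) (integrable_pairOsc hp hr σ 0 κ)

lemma integral_dbar_wave_freq (hp : ContinuousCompact p) (hq : ContinuousCompact q) (σ κ : ℝ) :
    ∫ u, dbar D (p u) (wave (freq 0 (-(σ * κ))) q u) ∂hypMeasure = pairOsc D p q σ 0 κ := by
  rw [pairOsc, oscInt, integral_prod _ (integrable_pairOsc hp hq σ 0 κ)]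
  refine integral_congr_ae (Eventually.of_forall fun u => ?_)
  simp only
  rw [wave, ← integral_dbar_right D (integrable_wave hq.1 hq.2 _ u)]
  refine integral_congr_ae (Eventually.of_forall fun z => ?_)
  simp only [dbar_smul_right, freq]
  rw [mul_comm]
  congr 2
  push_cast
  ring

/-- Symmetry of `γ·u` moves the projections at `u` to the test function. -/
lemma matrixElement_eq {g φ : Space → Spinor} (hg : ContinuousCompact g)
    (hφ : ContinuousCompact φ) (κ : ℝ) :
    matrixElement D g φ κ = coeff κ * (pairOsc D (posPart D g) φ 1 0 κ
      + pairOsc D (negPart D g) φ (-1) 0 κ) := by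
  have hp := hg.posPart D
  have hn := hg.negPart D
  have hw : ∀ κ, Continuous fun u => wave (freq 0 κ) φ u := fun κ =>
    continuous_section (A := fun _ => wave (freq 0 κ) φ)
      ((continuous_wave hφ.1 hφ.2).comp (continuous_const.prodMk continuous_snd)) 0
  have hi : ∀ {p : Space → Spinor} (_ : ContinuousCompact p) (κ : ℝ),
      Integrable (fun u => dbar D (p u) (wave (freq 0 κ) φ u)) hypMeasure := fun hp κ =>
    (continuous_dbar D hp.1 (hw κ)).integrable_of_hasCompactSupport
      (hp.2.mono fun z hz h => hz (by simp [h, dbar]))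
  rw [matrixElement, ← integral_dbar_wave_freq hp hφ, ← integral_dbar_wave_freq hn hφ,
    ← integral_add (hi hp _) (hi hn _)]
  congr 1
  refine integral_congr_ae (Eventually.of_forall fun u => ?_)
  simp only [starWave, one_mul, neg_mul, neg_neg]
  rw [map_sub, act_gz_posPart, act_gz_negPart]
  simp only [posPart, negPart, dbar_smul_left, dbar_smul_right, dbar_add_left, dbar_add_right,
    dbar_sub_left, dbar_sub_right, dbar_neg_right, dbar_act_gz, map_div₀, map_one, map_ofNat]
  ring

lemma abel_pairOsc (hp : ContinuousCompact p) (hq : ContinuousCompact q) (σ τ : ℝ)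
    {R : ℝ} (hR : 0 < R) :
    IntegrableOn (fun κ => (abelWeight R κ : ℂ) * (coeff κ * pairOsc D p q σ τ κ))
      (Set.Ioi 0) :=
  (abel_oscInt (continuous_uncurry_dbar hp.1 hq.1) (hp.2.isCompact.union hq.2.isCompact)
    dbar_supported (continuous_phase σ τ) hR).1

/-- The phase `σ (u·z - 1)` is stationary on the diagonal. -/
lemma tendsto_abel_pairOsc (hp : ContinuousCompact p) (hq : ContinuousCompact q)
    {σ : ℝ} (hσ : σ = 1 ∨ σ = -1) :
    Tendsto (fun R => ∫ κ in Set.Ioi 0, (abelWeight R κ : ℂ) *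
      (coeff κ * pairOsc D p q σ (-σ) κ)) atTop
      (𝓝 (Complex.exp (Complex.I * σ * (3 * Real.pi / 4))
        * ∫ z, dbar D (p z) (q z) ∂hypMeasure)) := by
  have h := tendsto_abel_oscInt (continuous_uncurry_dbar (D := D) hp.1 hq.1)
    (hp.2.isCompact.union hq.2.isCompact) dbar_supported hσ
  have e : (fun x : Space × Space => σ * (mdot (pt x.1) (pt x.2) - 1))
      = fun x => σ * mdot (pt x.1) (pt x.2) + -σ := funext fun x => by ring
  rw [e] at h
  exact h

/-- The phase `σ (u·z + 1)` is bounded away from zero. -/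
lemma tendsto_abel_pairOsc_zero (hp : ContinuousCompact p) (hq : ContinuousCompact q)
    {σ : ℝ} (hσ : σ = 1 ∨ σ = -1) :
    Tendsto (fun R => ∫ κ in Set.Ioi 0, (abelWeight R κ : ℂ) *
      (coeff κ * pairOsc D p q σ σ κ)) atTop (𝓝 0) := by
  refine tendsto_abel_oscInt_zero (continuous_uncurry_dbar (D := D) hp.1 hq.1)
    (hp.2.isCompact.union hq.2.isCompact) dbar_supported (continuous_phase σ σ) fun x => ?_
  have h := one_le_mdot_pt x.1 x.2
  have e : |σ| = 1 := by rcases hσ with rfl | rfl <;> simp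
  rw [show σ * mdot (pt x.1) (pt x.2) + σ = σ * (mdot (pt x.1) (pt x.2) + 1) by ring, abs_mul, e,
    one_mul, abs_of_nonneg (by linarith)]
  linarith

end MatrixElements

/-- The matrix elements of `T*` in terms of oscillatory integrals. -/
lemma inner_adjoint_T_eq {κ : ℝ} (hκ : 0 < κ) (g : C0 ((⊤ : ℕ∞) : WithTop ℕ∞))
    {k : WithTop ℕ∞} (f : C0 k) :
    (inner ℂ (toState D g) (ContinuousLinearMap.adjoint (T D κ) (toState D f)) : ℂ)
      = -Complex.I * (Complex.exp (-(Complex.I * (Real.pi / 4))) *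
          (coeff κ * pairOsc D (posPart D g.toFun) (posPart D f.toFun) 1 (-1) κ
            + coeff κ * pairOsc D (negPart D g.toFun) (posPart D f.toFun) (-1) (-1) κ)
        + Complex.exp (Complex.I * (Real.pi / 4)) *
          (coeff κ * pairOsc D (posPart D g.toFun) (negPart D f.toFun) 1 1 κ
            + coeff κ * pairOsc D (negPart D g.toFun) (negPart D f.toFun) (-1) (- -1) κ)) := by
  have hg : ContinuousCompact g.toFun := ⟨g.contDiff.continuous, g.compact⟩
  have hf : ContinuousCompact f.toFun := ⟨f.contDiff.continuous, f.compact⟩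
  have e1 : (fun z => act (gz D z) (f.toFun z))
      = fun z => posPart D f.toFun z + negPart D f.toFun z := funext fun z => by
    simp only [posPart, negPart]; module
  have e2 : f.toFun = fun z => posPart D f.toFun z - negPart D f.toFun z := funext fun z => by
    simp only [posPart, negPart]; module
  have c1 : Complex.exp (Complex.I * (Real.pi / 4)) * Complex.exp (Complex.I * κ)
      = ((Real.cos (κ + Real.pi / 4) : ℝ) : ℂ)
        + Complex.I * ((Real.sin (κ + Real.pi / 4) : ℝ) : ℂ) := by
    rw [← Complex.exp_add, ← mul_add, add_comm, mul_comm Complex.I, Complex.exp_mul_I]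
    push_cast; ring
  have c2 : Complex.exp (-(Complex.I * (Real.pi / 4))) * Complex.exp (-(Complex.I * κ))
      = ((Real.cos (κ + Real.pi / 4) : ℝ) : ℂ)
        - Complex.I * ((Real.sin (κ + Real.pi / 4) : ℝ) : ℂ) := by
    rw [← Complex.exp_add, ← neg_add, ← mul_add, add_comm, mul_comm Complex.I, ← neg_mul,
      Complex.exp_mul_I, Complex.cos_neg, Complex.sin_neg]
    push_cast; ring
  have hγ : ContinuousCompact fun z => act (gz D z) (f.toFun z) :=
    ⟨continuous_act_gz_apply D continuous_id hf.1, hasCompactSupport_gz D hf.2⟩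
  have m1 := matrixElement_eq (D := D) hg hγ κ
  have m2 := matrixElement_eq (D := D) hg hf κ
  have l1 : ∀ {p : Space → Spinor} (_ : ContinuousCompact p) (σ : ℝ),
      pairOsc D p (fun z => act (gz D z) (f.toFun z)) σ 0 κ
        = pairOsc D p (posPart D f.toFun) σ 0 κ + pairOsc D p (negPart D f.toFun) σ 0 κ :=
    fun hp σ => by rw [e1, pairOsc_add hp (hf.posPart D) (hf.negPart D)]
  have l2 : ∀ {p : Space → Spinor} (_ : ContinuousCompact p) (σ : ℝ),
      pairOsc D p f.toFun σ 0 κ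
        = pairOsc D p (posPart D f.toFun) σ 0 κ - pairOsc D p (negPart D f.toFun) σ 0 κ :=
    fun hp σ => (congrArg (fun φ => pairOsc D _ φ σ 0 κ) e2).trans
      (pairOsc_sub hp (hf.posPart D) (hf.negPart D) σ κ)
  rw [l1 (hg.posPart D), l1 (hg.negPart D)] at m1
  rw [l2 (hg.posPart D), l2 (hg.negPart D)] at m2
  have s1 : ∀ (p q : Space → Spinor) (σ : ℝ),
      pairOsc D p q σ 1 κ = Complex.exp (Complex.I * κ) * pairOsc D p q σ 0 κ := fun p q σ => by
    rw [pairOsc_shift, Complex.ofReal_one, mul_one]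
  have s2 : ∀ (p q : Space → Spinor) (σ : ℝ),
      pairOsc D p q σ (-1) κ = Complex.exp (-(Complex.I * κ)) * pairOsc D p q σ 0 κ :=
    fun p q σ => by
      rw [pairOsc_shift, Complex.ofReal_neg, Complex.ofReal_one, mul_neg_one]
  rw [inner_adjoint_T hκ, m1, m2, neg_neg]
  simp only [s1, s2]
  linear_combination
    (Complex.I * coeff κ * (pairOsc D (posPart D g.toFun) (posPart D f.toFun) 1 0 κ
      + pairOsc D (negPart D g.toFun) (posPart D f.toFun) (-1) 0 κ)) * c2
    + (Complex.I * coeff κ * (pairOsc D (posPart D g.toFun) (negPart D f.toFun) 1 0 κ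
      + pairOsc D (negPart D g.toFun) (negPart D f.toFun) (-1) 0 κ)) * c1

/-- The Abel limit of the matrix elements of `T*` is the scalar product. -/
lemma abel_inner_adjoint_T (g : C0 ((⊤ : ℕ∞) : WithTop ℕ∞)) {k : WithTop ℕ∞} (f : C0 k) :
    (∀ R > 0, IntegrableOn (fun κ => (abelWeight R κ : ℂ) *
      (inner ℂ (toState D g) (ContinuousLinearMap.adjoint (T D κ) (toState D f)) : ℂ))
      (Set.Ioi 0)) ∧
    Tendsto (fun R => ∫ κ in Set.Ioi 0, (abelWeight R κ : ℂ) *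
      (inner ℂ (toState D g) (ContinuousLinearMap.adjoint (T D κ) (toState D f)) : ℂ)) atTop
      (𝓝 (inner ℂ (toState D g) (toState D f))) := by
  have hg : ContinuousCompact g.toFun := ⟨g.contDiff.continuous, g.compact⟩
  have hf : ContinuousCompact f.toFun := ⟨f.contDiff.continuous, f.compact⟩
  set E := Complex.exp (Complex.I * (Real.pi / 4)) with hE
  set E' := Complex.exp (-(Complex.I * (Real.pi / 4))) with hE'
  have e : ∀ R, ∀ κ ∈ Set.Ioi (0 : ℝ), -Complex.I * E' * ((abelWeight R κ : ℂ) *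
        (coeff κ * pairOsc D (posPart D g.toFun) (posPart D f.toFun) 1 (-1) κ))
      + -Complex.I * E' * ((abelWeight R κ : ℂ) *
        (coeff κ * pairOsc D (negPart D g.toFun) (posPart D f.toFun) (-1) (-1) κ))
      + (-Complex.I * E * ((abelWeight R κ : ℂ) *
        (coeff κ * pairOsc D (posPart D g.toFun) (negPart D f.toFun) 1 1 κ))
      + -Complex.I * E * ((abelWeight R κ : ℂ) *
        (coeff κ * pairOsc D (negPart D g.toFun) (negPart D f.toFun) (-1) (- -1) κ)))
      = (abelWeight R κ : ℂ) * (inner ℂ (toState D g)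
        (ContinuousLinearMap.adjoint (T D κ) (toState D f)) : ℂ) := fun R κ hκ => by
    rw [inner_adjoint_T_eq hκ]; ring
  have i1 := fun (R : ℝ) (hR : 0 < R) =>
    (abel_pairOsc (D := D) (hg.posPart D) (hf.posPart D) 1 (-1) hR).const_mul (-Complex.I * E')
  have i2 := fun (R : ℝ) (hR : 0 < R) =>
    (abel_pairOsc (D := D) (hg.negPart D) (hf.posPart D) (-1) (-1) hR).const_mul (-Complex.I * E')
  have i3 := fun (R : ℝ) (hR : 0 < R) =>
    (abel_pairOsc (D := D) (hg.posPart D) (hf.negPart D) 1 1 hR).const_mul (-Complex.I * E)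
  have i4 := fun (R : ℝ) (hR : 0 < R) =>
    (abel_pairOsc (D := D) (hg.negPart D) (hf.negPart D) (-1) (- -1) hR).const_mul (-Complex.I * E)
  refine ⟨fun R hR => IntegrableOn.congr_fun (((i1 R hR).add (i2 R hR)).add
    ((i3 R hR).add (i4 R hR))) (e R) measurableSet_Ioi, ?_⟩
  have t1 := (tendsto_abel_pairOsc (D := D) (hg.posPart D) (hf.posPart D)
    (σ := 1) (Or.inl rfl)).const_mul (-Complex.I * E')
  have t2 := (tendsto_abel_pairOsc_zero (D := D) (hg.negPart D) (hf.posPart D)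
    (σ := -1) (Or.inr rfl)).const_mul (-Complex.I * E')
  have t3 := (tendsto_abel_pairOsc_zero (D := D) (hg.posPart D) (hf.negPart D)
    (σ := 1) (Or.inl rfl)).const_mul (-Complex.I * E)
  have t4 := (tendsto_abel_pairOsc (D := D) (hg.negPart D) (hf.negPart D)
    (σ := -1) (Or.inr rfl)).const_mul (-Complex.I * E)
  have ht := (t1.add t2).add (t3.add t4)
  have x1 : -Complex.I * E' * Complex.exp (Complex.I * (1 : ℝ) * (3 * Real.pi / 4)) = 1 := by
    rw [hE', mul_assoc, ← Complex.exp_add,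
      show -(Complex.I * (Real.pi / 4)) + Complex.I * (1 : ℝ) * (3 * Real.pi / 4)
        = Real.pi / 2 * Complex.I by push_cast; ring, Complex.exp_pi_div_two_mul_I]
    simp
  have x2 : -Complex.I * E * Complex.exp (Complex.I * (-1 : ℝ) * (3 * Real.pi / 4)) = -1 := by
    rw [hE, mul_assoc, ← Complex.exp_add,
      show Complex.I * (Real.pi / 4) + Complex.I * (-1 : ℝ) * (3 * Real.pi / 4)
        = -Real.pi / 2 * Complex.I by push_cast; ring, Complex.exp_neg_pi_div_two_mul_I]
    simp
  have hlim : (inner ℂ (toState D g) (toState D f) : ℂ)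
      = ∫ z, dbar D (posPart D g.toFun z) (posPart D f.toFun z) ∂hypMeasure
        - ∫ z, dbar D (negPart D g.toFun z) (negPart D f.toFun z) ∂hypMeasure := by
    have j : ∀ {p q : Space → Spinor}, ContinuousCompact p → ContinuousCompact q →
        Integrable (fun z => dbar D (p z) (q z)) hypMeasure := fun hp hq =>
      (continuous_dbar D hp.1 hq.1).integrable_of_hasCompactSupport
        (hp.2.mono fun z hz h => hz (by simp [h, dbar]))
    rw [State.inner_def, ← integral_sub (j (hg.posPart D) (hf.posPart D))
      (j (hg.negPart D) (hf.negPart D))]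
    refine integral_congr_ae ?_
    filter_upwards [toState_fn D g, toState_fn D f] with z h1 h2
    rw [h1, h2]
    simp only [posPart, negPart, dbar_smul_left, dbar_smul_right, dbar_add_left, dbar_add_right,
      dbar_sub_left, dbar_sub_right, dbar_act_gz, act_gz_gz, map_div₀, map_one, map_ofNat]
    ring
  rw [← mul_assoc, ← mul_assoc, x1, x2, mul_zero, mul_zero, add_zero, zero_add, one_mul,
    neg_one_mul, ← sub_eq_add_neg, ← hlim] at ht
  refine ht.congr' ?_
  filter_upwards [eventually_gt_atTop 0] with R hR
  rw [← setIntegral_congr_fun measurableSet_Ioi (e R), integral_add_add (i1 R hR) (i2 R hR)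
    (i3 R hR) (i4 R hR)]
  simp only [integral_const_mul]

/-- By `norm_inner_adjoint_T_sub_le` the matrix elements of `T*` stay close to their value at `κ`,
hence so does their Abel limit, which is the scalar product. -/
lemma norm_adjoint_T_sub_le {κ : ℝ} (hκ : 0 < κ) (f : C0 ((2 : ℕ) : WithTop ℕ∞)) :
    ‖ContinuousLinearMap.adjoint (T D κ) (toState D f) - toState D f‖
      ≤ κ⁻¹ * (‖toState D (hOp D f)‖ + ‖toState D (hOp D (hOp D f))‖) := by
  set M := κ⁻¹ * (‖toState D (hOp D f)‖ + ‖toState D (hOp D (hOp D f))‖) with hM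
  have hM0 : 0 ≤ M := by positivity
  set y := ContinuousLinearMap.adjoint (T D κ) (toState D f) - toState D f with hy
  have key : ∀ x : State D, ‖(inner ℂ x y : ℂ)‖ ≤ ‖x‖ * M := by
    intro x
    refine denseRange_toState.induction (P := fun x : State D => ‖(inner ℂ x y : ℂ)‖ ≤ ‖x‖ * M)
      ?_ (isClosed_le (by fun_prop) (by fun_prop)) x
    rintro _ ⟨g, rfl⟩
    obtain ⟨hi, hL⟩ := abel_inner_adjoint_T (D := D) g f
    have hn : ∀ t > 0, ‖(inner ℂ (toState D g)
        (ContinuousLinearMap.adjoint (T D t) (toState D f)) : ℂ)‖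
        ≤ ‖toState D g‖ * ‖toState D f‖ := fun t ht => by
      refine (norm_inner_le_norm _ _).trans (le_of_eq ?_)
      rw [norm_adjoint_T ht]
    have h := norm_abel_limit_sub_le hκ.le (C := ‖toState D g‖ * M) (by positivity)
      (fun t ht => (norm_sub_le _ _).trans (add_le_add (hn t ht) (hn κ hκ)))
      (fun t ht => (norm_inner_adjoint_T_sub_le hκ ht g f).trans (le_of_eq (by rw [hM]; ring)))
      hi hL
    rw [hy, inner_sub_right, norm_sub_rev]
    exact h
  have h := key y
  rw [inner_self_eq_norm_sq_to_K, norm_pow, RCLike.norm_ofReal, abs_norm, sq] at h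
  rcases (norm_nonneg y).eq_or_lt with h0 | h0
  · rw [← h0]; exact hM0
  · exact le_of_mul_le_mul_left h h0

end

end HypDirac

end

open HypDirac in
theorem lemma4p3 (D : DiracMatrices) (κ : ℝ) (hκ : 0 < κ) :
    Extends (F D κ) (fourierInt D κ) ∧
    Extends (ContinuousLinearMap.adjoint (F D κ)) (fourierStarInt D κ) ∧
    ∀ f : C0 ((2 : ℕ) : WithTop ℕ∞),
      ‖T D κ (toState D f) - toState D f‖
        = ‖ContinuousLinearMap.adjoint (T D κ) (toState D f) - toState D f‖ ∧
      ‖ContinuousLinearMap.adjoint (T D κ) (toState D f) - toState D f‖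
        ≤ κ⁻¹ * (‖toState D (hOp D f)‖ + ‖toState D (hOp D (hOp D f))‖) :=
  ⟨F_extends hκ, (adjoint_F hκ).1, fun f =>
    ⟨norm_T_sub hκ (toState D f), norm_adjoint_T_sub_le hκ f⟩⟩
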